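/- Let $n\ge 0$ and $N\ge 1$ be integers, $h>0$, $T=Nh$, $x_0,\xi_0\in\mathbb R^n$, and let $f,g:\mathbb R^n\times\mathbb R^n\to\mathbb R^n$ be bounded functions of class $C^1$. Consider the delayed impulsive control system $$dx(t)=f(x(t),x(t-h))\,dt+g(x(t),x(t-h))\,d\mu(t),\quad t\in[0,T],\qquad x(0)=x_0,\quad x(t)=\xi_0\ \text{ for } t\in[-h,0).$$ **Impulsive controls.** An impulsive control $(\mu,\{w^r\}_{r\in[0,h]})$ consists of a finite nonnegative Borel measure $\mu$ on $[0,T]$ and, for each $r\in[0,h]$, a measurable function $w^r=(w^r_1,\dots,w^r_N):[0,1]\to[0,\infty)^N$ such that (i) for every $r\in[0,h]$, $\sum_{i=1}^N w^r_i(s)=\sum_{i=1}^N\int_0^1 w^r_i(s')\,ds'$ for a.e. $s\in[0,1]$; (ii) for every $r\in(0,h)$ and $i=1,\dots,N$, $\int_0^1 w^r_i(s)\,ds=\mu(\{r+(i-1)h\})$; (iii) for $i=0,\dots,N$, $\int_0^1[w^h_i(s)+w^0_{i+1}(s)]\,ds=\mu(\{ih\})$, where $w^h_0\equiv 0$ and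 $w^0_{N+1}\equiv 0$. **Extended processes.** A triple $(x,\mu,\{w^r\})$ is an extended process if $(\mu,\{w^r\})$ is an impulsive control, $x:[-h,T]\to\mathbb R^n$ has bounded variation, $x(t)=\xi_0$ on $[-h,0)$, $x(0)=x_0$, and there are functions $\zeta^r_i:[0,1]\to\mathbb R^n$ ($r\in[0,h]$, $0\le i\le N$), absolutely continuous for $i\ge1$, such that the following hold. The function $\zeta^r_0(s)$ equals $x_0$ if $r=h$ and $s=1$, and $\xi_0$ otherwise. For $i=1,\dots,N$ and $r\in[0,h]$, $$\tfrac{d}{ds}\zeta^r_i(s)=w^r_i(s)\,g(\zeta^r_i(s),\zeta^r_{i-1}(s))\ \text{ for a.e. } s\in[0,1],$$ with $\zeta^r_i(0)=x((r+(i-1)h)^-)$ if $r\in(0,h]$ and $\zeta^0_i(0)=\zeta^h_{i-1}(1)$. Moreover $x((i-1)h)=\zeta^0_i(1)$ for $i=2,\dots,N$, $x(T)=\zeta^h_N(1)$, and for $i=1,\dots,N$ and $t\in((i-1)h,ih)$ $$x(t)=\zeta^0_i(1)+\int_{(i-1)h}^t f(x(t'),x(t'-h))\,dt'+\int_{[(i-1)h,t]}g(x(t'),x(t'-h))\,d\mu^c(t')+\sum_{r\in(0,\,t-(i-1)h]}\big(\zeta^r_i(1)-x((r+(i-1)h)^-)\big).$$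 Here $\mu^c$ is the non-atomic part of $\mu$. A strict sense process $(x,u)$ is given by an extended process $(x,\mu,\{w^r\})$ for which $d\mu(t)=u(t)\,dt$ with $u\in L^1(0,T)$, $u\ge0$. **Reachable sets.** For $K>0$ let $$\mathcal R^e_K(T)=\{x(T): (x,\mu,\{w^r\})\text{ is an extended process with }\|\mu\|_{TV}\le K\},$$ $$\mathcal R^s_K(T)=\{x(T): (x,u)\text{ is a strict sense process with }\textstyle\int_0^T u(t)\,dt\le K\}.$$ **Statement.** For every $K>0$, the set $\mathcal R^e_K(T)$ is nonempty and compact, and $\mathcal R^e_K(T)=\overline{\mathcal R^s_K(T)}$. -/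

import Mathlib

open MeasureTheory Set

noncomputable section

/-- The data of the delayed impulsive control system
`dx(t) = f (x(t), x(t-h)) dt + g (x(t), x(t-h)) dμ(t)` on `[0, T]`, with `T = N h`, `x(0) = x₀` and
`x = ξ₀` on `[-h, 0)`. -/
structure DelaySystem (n : ℕ) where
  f : EuclideanSpace ℝ (Fin n) → EuclideanSpace ℝ (Fin n) → EuclideanSpace ℝ (Fin n)
  g : EuclideanSpace ℝ (Fin n) → EuclideanSpace ℝ (Fin n) → EuclideanSpace ℝ (Fin n)
  x₀ : EuclideanSpace ℝ (Fin n)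
  ξ₀ : EuclideanSpace ℝ (Fin n)
  /-- the time delay -/
  h : ℝ
  /-- the number of delay intervals that make up `[0, T]` -/
  N : ℕ

/-- The part of a measure that does not charge points: what is left after the atoms are removed
(so both the absolutely continuous and the singular continuous parts are kept). The set of atoms
of a finite measure on `ℝ` is countable, hence measurable. -/
def continuousPart (μ : Measure ℝ) : Measure ℝ := μ.restrict {t | μ {t} = 0}

namespace DelaySystem

variable {n : ℕ} (D : DelaySystem n)

/-- The end time `T = N h`. -/
def T : ℝ := D.N * D.h

/-- Impulsive controls `(μ, {w^r})`. The measure is a finite Borel measure on `ℝ` carried by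
`[0, T]`; `w r i s` stands for `w^r_i(s)`, and only the values with `r ∈ [0, h]`, `s ∈ [0, 1]` and
`1 ≤ i ≤ N` matter, apart from the conventions `w^h_0 ≡ 0` and `w^0_{N+1} ≡ 0`. -/
structure IsImpulsiveControl (μ : Measure ℝ) (w : ℝ → ℕ → ℝ → ℝ) : Prop where
  finite : IsFiniteMeasure μ
  carried : μ (Icc 0 D.T)ᶜ = 0
  /-- (Lebesgue) measurability of each `w^r_i` on `[0, 1]` -/
  measurable : ∀ r ∈ Icc 0 D.h, ∀ i ∈ Finset.Icc 1 D.N,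
    AEMeasurable (w r i) (volume.restrict (Icc 0 1))
  nonneg : ∀ r ∈ Icc 0 D.h, ∀ i ∈ Finset.Icc 1 D.N, ∀ s ∈ Icc (0 : ℝ) 1, 0 ≤ w r i s
  conv_zero : ∀ s ∈ Icc (0 : ℝ) 1, w D.h 0 s = 0
  conv_last : ∀ s ∈ Icc (0 : ℝ) 1, w 0 (D.N + 1) s = 0
  sum_eq : ∀ r ∈ Icc 0 D.h, ∀ᵐ s ∂(volume.restrict (Icc (0 : ℝ) 1)),
    ∑ i ∈ Finset.Icc 1 D.N, w r i s = ∑ i ∈ Finset.Icc 1 D.N, ∫ s' in (0 : ℝ)..1, w r i s'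
  atom_inner : ∀ r ∈ Ioo 0 D.h, ∀ i ∈ Finset.Icc 1 D.N,
    ∫ s in (0 : ℝ)..1, w r i s = μ.real {r + ((i : ℝ) - 1) * D.h}
  atom_node : ∀ i ∈ Finset.Icc 0 D.N,
    ∫ s in (0 : ℝ)..1, (w D.h i s + w 0 (i + 1) s) = μ.real {(i : ℝ) * D.h}

/-- The attached functions `ζ r i s = ζ^r_i(s)`: for every `r ∈ [0, h]`, absolutely continuous
functions `ζ^r_1, …, ζ^r_N` on `[0, 1]` that solve the coupled system
`(d/ds) ζ^r_i = w^r_i g(ζ^r_i, ζ^r_{i-1})` a.e., with the prescribed initial values, where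
`ζ^r_0(s)` is `x₀` if `r = h` and `s = 1`, and `ξ₀` otherwise. The left limit `x⁻(t)` is
`Function.leftLim x t`; it is only used for `x` of bounded variation on `[-h, T]` and for
`t ∈ (0, T]`, where the limit exists. -/
structure IsAttached (x : ℝ → EuclideanSpace ℝ (Fin n)) (w : ℝ → ℕ → ℝ → ℝ)
    (ζ : ℝ → ℕ → ℝ → EuclideanSpace ℝ (Fin n)) : Prop where
  zero_eq : ∀ r ∈ Icc 0 D.h, ∀ s ∈ Icc (0 : ℝ) 1, (s < 1 ∨ r < D.h) → ζ r 0 s = D.ξ₀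
  zero_end : ζ D.h 0 1 = D.x₀
  absCont : ∀ r ∈ Icc 0 D.h, ∀ i ∈ Finset.Icc 1 D.N, AbsolutelyContinuousOnInterval (ζ r i) 0 1
  ode : ∀ r ∈ Icc 0 D.h, ∀ i ∈ Finset.Icc 1 D.N, ∀ᵐ s ∂(volume.restrict (Icc (0 : ℝ) 1)),
    HasDerivAt (ζ r i) (w r i s • D.g (ζ r i s) (ζ r (i - 1) s)) s
  init_pos : ∀ r ∈ Ioc 0 D.h, ∀ i ∈ Finset.Icc 1 D.N,
    ζ r i 0 = Function.leftLim x (r + ((i : ℝ) - 1) * D.h)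
  init_zero : ∀ i ∈ Finset.Icc 1 D.N, ζ 0 i 0 = ζ D.h (i - 1) 1

/-- Extended processes `(x, μ, {w^r})`, with extended state trajectory `x`. Only the values of `x`
on `[-h, T]` matter. -/
structure IsExtendedProc (x : ℝ → EuclideanSpace ℝ (Fin n)) (μ : Measure ℝ)
    (w : ℝ → ℕ → ℝ → ℝ) : Prop where
  bv : BoundedVariationOn x (Icc (-D.h) D.T)
  control : D.IsImpulsiveControl μ w
  history : ∀ t ∈ Ico (-D.h) 0, x t = D.ξ₀
  initial : x 0 = D.x₀
  dynamics : ∃ ζ : ℝ → ℕ → ℝ → EuclideanSpace ℝ (Fin n), D.IsAttached x w ζ ∧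
    (∀ i ∈ Finset.Icc 2 D.N, x (((i : ℝ) - 1) * D.h) = ζ 0 i 1) ∧
    (∀ i ∈ Finset.Icc 1 D.N, ∀ t ∈ Ioo (((i : ℝ) - 1) * D.h) (i * D.h),
      x t = ζ 0 i 1
        + (∫ t' in (((i : ℝ) - 1) * D.h)..t, D.f (x t') (x (t' - D.h)))
        + (∫ t' in Icc (((i : ℝ) - 1) * D.h) t,
            D.g (x t') (x (t' - D.h)) ∂(continuousPart μ))
        + ∑' r : Ioc (0 : ℝ) (t - ((i : ℝ) - 1) * D.h),
            (ζ r i 1 - Function.leftLim x ((r : ℝ) + ((i : ℝ) - 1) * D.h))) ∧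
    x D.T = ζ D.h D.N 1

/-- The measure `u(t) dt` on `[0, T]`. -/
def densityMeasure (u : ℝ → ℝ) : Measure ℝ :=
  (volume.restrict (Icc 0 D.T)).withDensity fun t => ENNReal.ofReal (u t)

/-- Strict sense processes `(x, u)`: `u` is a nonnegative integrable function on `[0, T]` and `x` is
the state trajectory of an extended process whose measure is `u(t) dt`. -/
def IsStrictSenseProc (x : ℝ → EuclideanSpace ℝ (Fin n)) (u : ℝ → ℝ) : Prop :=
  (∀ t ∈ Icc 0 D.T, 0 ≤ u t) ∧ IntegrableOn u (Icc 0 D.T) ∧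
    ∃ w : ℝ → ℕ → ℝ → ℝ, D.IsExtendedProc x (D.densityMeasure u) w

/-- The `K`-extended reachable set. The total variation of a nonnegative measure is its mass. -/
def extendedReachableSet (K : ℝ) : Set (EuclideanSpace ℝ (Fin n)) :=
  {z | ∃ (x : ℝ → EuclideanSpace ℝ (Fin n)) (μ : Measure ℝ) (w : ℝ → ℕ → ℝ → ℝ),
    D.IsExtendedProc x μ w ∧ μ.real univ ≤ K ∧ x D.T = z}

/-- The `K`-strict sense reachable set. -/
def strictReachableSet (K : ℝ) : Set (EuclideanSpace ℝ (Fin n)) :=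
  {z | ∃ (x : ℝ → EuclideanSpace ℝ (Fin n)) (u : ℝ → ℝ),
    D.IsStrictSenseProc x u ∧ (∫ t in (0 : ℝ)..D.T, u t) ≤ K ∧ x D.T = z}

end DelaySystem

end

/-!
The proof is by graph completion. Delay intervals are folded on top of each other: on `[0, h]` the
state becomes the vector of its `N` pieces, and the delayed argument of the `i`-th piece is the
`(i - 1)`-st piece. Elapsed time plus spent mass serves as a new parameter, normalized to `[0, 1]`.
In this parameter an impulsive control becomes a family of uniformly Lipschitz functions
(`IsCompletedControl`: `W 0` is time, `W i` the mass spent on the `i`-th interval), an atom at `r`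
becomes an interval on which `W 0 = r` (the fiber over `r`), and the state together with its
attached functions becomes a solution of an ordinary differential equation that is linear in the
derivatives of the control (`IsCompletedTraj`). The requirement that the functions `w^r_i` have an
a.e. constant sum over `i` says exactly that the fibers are run at the normalized speed.

Completed controls form a compact set for pointwise convergence, by Tychonoff's theorem. As they are
uniformly Lipschitz, pointwise convergence implies weak convergence of the derivatives, which with
Grönwall's inequality makes the end point of the trajectory a continuous function of the control.
Hence the reachable set of the graph completion is compact (`isCompact_completedReachableSet`).

This set is the extended reachable set. From a completed trajectory one gets a process by evaluating
at the right ends of the fibers (`completedTraj_end_mem_extended`). Conversely, the parts of an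
impulsive control on the delay intervals are completed by inverting `r ↦ r + ν (-∞, r]`, where `ν`
is their sum (`exists_isCompletedControl_of_measures`), and the attached functions, glued along the
fibers, form a completed trajectory (`extendedReachableSet_subset`). Both directions rest on one
change of variables, `integral_eq_continuousPart_add_tsum`: an integral in the parameter splits into
an integral against the non-atomic part of the measure and a sum over the atoms.

Finally, mixing a little of the control that only lets time pass into a completed control makes time
run at positive speed (`exists_strictMono_near`). Then the measure has a density, so that the end
point is reached by a strict sense process (`completedTraj_end_mem_strict`); it is as close to the
original one as desired. This is the density of the strict sense reachable set.
-/

open Filter Topology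

/-! ### Ordinary differential equations with measurable time dependence -/

/-- Grönwall's inequality in integral form on `[0, 1]`. -/
theorem le_mul_exp_of_le_add_mul_integral {u : ℝ → ℝ} {η C : ℝ} (hu : Continuous u)
    (hC : 0 < C) (hu0 : ∀ s, 0 ≤ u s)
    (h : ∀ s ∈ Icc (0 : ℝ) 1, u s ≤ η + C * ∫ σ in (0 : ℝ)..s, u σ) :
    ∀ s ∈ Icc (0 : ℝ) 1, u s ≤ η * Real.exp (C * s) := by
  have hd : ∀ s, HasDerivAt (fun s => ∫ σ in (0 : ℝ)..s, u σ) (u s) s := fun s =>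
    hu.integral_hasStrictDerivAt 0 s |>.hasDerivAt
  have hpos : ∀ s ∈ Icc (0 : ℝ) 1, 0 ≤ ∫ σ in (0 : ℝ)..s, u σ := fun s hs =>
    intervalIntegral.integral_nonneg hs.1 fun σ _ => hu0 σ
  have key := norm_le_gronwallBound_of_norm_deriv_right_le (δ := 0) (K := C) (ε := η)
    (f := fun s => ∫ σ in (0 : ℝ)..s, u σ) (f' := u) (a := 0) (b := 1)
    (fun s _ => (hd s).continuousAt.continuousWithinAt) (fun s _ => (hd s).hasDerivWithinAt)
    (by simp) (fun s hs => by
      have hs' : s ∈ Icc (0 : ℝ) 1 := ⟨hs.1, hs.2.le⟩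
      rw [Real.norm_of_nonneg (hu0 s), Real.norm_of_nonneg (hpos s hs')]
      linarith [h s hs'])
  intro s hs
  have h1 := key s hs
  rw [Real.norm_of_nonneg (hpos s hs), gronwallBound_of_K_ne_0 hC.ne'] at h1
  simp only [zero_mul, zero_add, sub_zero] at h1
  calc u s ≤ η + C * (η / C * (Real.exp (C * s) - 1)) :=
        (h s hs).trans (by gcongr)
    _ = η * Real.exp (C * s) := by field_simp; ring

section
variable {E : Type*} [NormedAddCommGroup E] [NormedSpace ℝ E]

/-- Existence for `z' = Φ(s, z)` when `Φ` is merely measurable in time. The weight `exp (-2 C s)`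
turns the Picard operator into a contraction of ratio `1 / 2` for the uniform norm on `[0, 1]`. -/
theorem exists_continuous_eq_add_integral [CompleteSpace E] {Φ : ℝ → E → E} {C M : ℝ} (hC : 0 < C)
    (hlip : ∀ s u v, ‖Φ s u - Φ s v‖ ≤ C * ‖u - v‖) (hbd : ∀ s u, ‖Φ s u‖ ≤ M)
    (hmeas : ∀ u : ℝ → E, Continuous u → AEStronglyMeasurable (fun s => Φ s (u s)) volume)
    (c : E) :
    ∃ z : ℝ → E, Continuous z ∧
      ∀ s ∈ Icc (0 : ℝ) 1, z s = c + ∫ σ in (0 : ℝ)..s, Φ σ (z σ) := by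
  classical
  let ext : C(Icc (0 : ℝ) 1, E) → ℝ → E := fun v s =>
    Real.exp (2 * C * s) • v (projIcc 0 1 zero_le_one s)
  have hext : ∀ v, Continuous (ext v) := fun v => by
    have : Continuous fun s : ℝ => v (projIcc 0 1 zero_le_one s) :=
      v.continuous.comp continuous_projIcc
    exact (by fun_prop : Continuous fun s : ℝ => Real.exp (2 * C * s)).smul this
  have hint : ∀ (v) (a b : ℝ), IntervalIntegrable (fun σ => Φ σ (ext v σ)) volume a b := by
    intro v a b
    refine (intervalIntegrable_const (c := M)).mono_fun (hmeas _ (hext v)).restrict ?_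
    exact .of_forall fun s => (hbd s _).trans (le_abs_self M)
  have hcont : ∀ v, Continuous fun s => c + ∫ σ in (0 : ℝ)..s, Φ σ (ext v σ) := fun v =>
    continuous_const.add (intervalIntegral.continuous_primitive (hint v) 0)
  let T : C(Icc (0 : ℝ) 1, E) → C(Icc (0 : ℝ) 1, E) := fun v =>
    ⟨fun s => Real.exp (-(2 * C * (s : ℝ))) • (c + ∫ σ in (0 : ℝ)..s, Φ σ (ext v σ)), by
      have h1 : Continuous fun s : Icc (0 : ℝ) 1 => Real.exp (-(2 * C * (s : ℝ))) := by fun_prop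
      exact h1.smul ((hcont v).comp continuous_subtype_val)⟩
  have hT : ContractingWith (1 / 2) T := by
    refine ⟨by
      rw [← NNReal.coe_lt_coe]; norm_num, LipschitzWith.of_dist_le_mul fun v v' => ?_⟩
    rw [ContinuousMap.dist_le (by positivity)]
    rintro ⟨s, hs⟩
    have hval : ∀ v, T v ⟨s, hs⟩ =
      Real.exp (-(2 * C * s)) • (c + ∫ σ in (0 : ℝ)..s, Φ σ (ext v σ)) := fun _ => rfl
    rw [dist_eq_norm, hval, hval, ← smul_sub, add_sub_add_left_eq_sub,
      ← intervalIntegral.integral_sub (hint v 0 s) (hint v' 0 s), norm_smul,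
      Real.norm_of_nonneg (Real.exp_pos _).le]
    have hI : ‖∫ σ in (0 : ℝ)..s, (Φ σ (ext v σ) - Φ σ (ext v' σ))‖ ≤
        ∫ σ in (0 : ℝ)..s, C * dist v v' * Real.exp (2 * C * σ) := by
      refine intervalIntegral.norm_integral_le_of_norm_le hs.1 (.of_forall fun σ hσ => ?_)
        (Continuous.intervalIntegrable (by fun_prop) _ _)
      refine (hlip _ _ _).trans ?_
      simp only [ext]
      rw [← smul_sub, norm_smul, Real.norm_of_nonneg (Real.exp_pos _).le, ← dist_eq_norm]
      have := ContinuousMap.dist_apply_le_dist (f := v) (g := v') (projIcc 0 1 zero_le_one σ)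
      calc C * (Real.exp (2 * C * σ) * dist (v (projIcc 0 1 zero_le_one σ))
            (v' (projIcc 0 1 zero_le_one σ)))
          ≤ C * (Real.exp (2 * C * σ) * dist v v') := by gcongr
        _ = _ := by ring
    have hE : ∫ σ in (0 : ℝ)..s, C * dist v v' * Real.exp (2 * C * σ) =
        dist v v' / 2 * (Real.exp (2 * C * s) - 1) := by
      rw [intervalIntegral.integral_const_mul,
        intervalIntegral.integral_comp_mul_left (fun x => Real.exp x) (by positivity), integral_exp]
      simp only [mul_zero, Real.exp_zero, smul_eq_mul]
      field_simp
    calc Real.exp (-(2 * C * s)) * ‖∫ σ in (0 : ℝ)..s, (Φ σ (ext v σ) - Φ σ (ext v' σ))‖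
        ≤ Real.exp (-(2 * C * s)) * (dist v v' / 2 * Real.exp (2 * C * s)) := by
          gcongr
          rw [hE] at hI
          refine hI.trans ?_
          gcongr
          linarith
      _ = dist v v' / 2 := by
          rw [Real.exp_neg]; field_simp
      _ = ((1 / 2 : NNReal) : ℝ) * dist v v' := by push_cast; ring
  have hfix : T (hT.fixedPoint T) = hT.fixedPoint T := hT.fixedPoint_isFixedPt
  refine ⟨ext (hT.fixedPoint T), hext _, fun s hs => ?_⟩
  have h2 : (hT.fixedPoint T) ⟨s, hs⟩ = T (hT.fixedPoint T) ⟨s, hs⟩ := by rw [hfix]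
  have h3 : ext (hT.fixedPoint T) s = Real.exp (2 * C * s) • (hT.fixedPoint T) ⟨s, hs⟩ := by
    simp only [ext, projIcc_of_mem zero_le_one hs]
  have h4 : T (hT.fixedPoint T) ⟨s, hs⟩ = Real.exp (-(2 * C * s)) •
      (c + ∫ σ in (0 : ℝ)..s, Φ σ (ext (hT.fixedPoint T) σ)) := rfl
  rw [h3, h2, h4, smul_smul, ← Real.exp_add]
  simp

/-- An absolutely continuous function with a.e. derivative `f'`, bounded, is the integral of
`f'`. -/
theorem AbsolutelyContinuousOnInterval.eq_add_integral_of_ae_hasDerivAt [CompleteSpace E]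
    {f f' : ℝ → E} {B : ℝ} (hf : AbsolutelyContinuousOnInterval f 0 1)
    (hd : ∀ᵐ s ∂volume.restrict (Icc (0 : ℝ) 1), HasDerivAt f (f' s) s)
    (hb : ∀ᵐ s ∂volume.restrict (Icc (0 : ℝ) 1), ‖f' s‖ ≤ B)
    (hm : AEStronglyMeasurable f' (volume.restrict (Icc (0 : ℝ) 1))) :
    ∀ s ∈ Icc (0 : ℝ) 1, f s = f 0 + ∫ σ in (0 : ℝ)..s, f' σ := by
  have hint : IntervalIntegrable f' volume 0 1 := by
    rw [intervalIntegrable_iff_integrableOn_Icc_of_le zero_le_one]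
    exact Integrable.of_bound hm B hb
  have hB : 0 ≤ B := by
    have : (ae (volume.restrict (Icc (0 : ℝ) 1))).NeBot := by
      rw [ae_neBot, Ne, Measure.restrict_eq_zero]; simp
    obtain ⟨s, hs⟩ := hb.exists
    exact (norm_nonneg _).trans hs
  have hLip : LipschitzOnWith B.toNNReal (fun s => ∫ σ in (0 : ℝ)..s, f' σ) (uIcc 0 1) := by
    refine LipschitzOnWith.of_dist_le_mul fun x hx y hy => ?_
    rw [uIcc_of_le zero_le_one] at hx hy
    have hsub : ∀ p ∈ Icc (0:ℝ) 1, IntervalIntegrable f' volume 0 p := fun p hp =>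
      hint.mono_set (by
        rw [uIcc_of_le hp.1, uIcc_of_le zero_le_one]
        exact Icc_subset_Icc_right hp.2)
    rw [dist_eq_norm, intervalIntegral.integral_interval_sub_left (hsub x hx) (hsub y hy),
      Real.dist_eq, Real.coe_toNNReal _ hB]
    refine intervalIntegral.norm_integral_le_of_norm_le_const_ae ?_
    rw [ae_restrict_iff' measurableSet_Icc] at hb
    filter_upwards [hb] with σ hσ hmem
    refine hσ ⟨?_, ?_⟩
    · exact (le_min hy.1 hx.1).trans hmem.1.le
    · exact hmem.2.trans (max_le hy.2 hx.2)
  have hAC := hf.sub hLip.absolutelyContinuousOnInterval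
  obtain ⟨c, hc⟩ := hAC.const_of_ae_hasDerivAt_zero (by
    rw [ae_restrict_iff' measurableSet_Icc] at hd
    filter_upwards [hd, hint.ae_hasDerivAt_integral] with x h1 h2 hx
    have h4 := (h1 (by rwa [uIcc_of_le zero_le_one] at hx)).sub (h2 hx 0 (by simp))
    rwa [sub_self] at h4)
  intro s hs
  rw [uIcc_of_le zero_le_one] at hc
  have h0 := hc 0 (by simp)
  have h1 := hc s hs
  simp only [Pi.sub_apply, intervalIntegral.integral_same, sub_zero] at h0 h1
  rw [h0, ← h1]; abel

theorem ae_comp_affine {p : ℝ → Prop} {a c : ℝ} (hc : c ≠ 0) (h : ∀ᵐ s, p s) :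
    ∀ᵐ s : ℝ, p (a + c * s) := by
  have h1 : ∀ᵐ s : ℝ, p (a + s) :=
    (measurePreserving_add_left volume a).quasiMeasurePreserving.ae h
  have h2 : Measure.QuasiMeasurePreserving (fun s : ℝ => c * s) volume volume := by
    refine ⟨measurable_const_mul c, ?_⟩
    rw [Real.map_volume_mul_left hc]
    exact Measure.smul_absolutelyContinuous
  exact h2.ae h1

/-- A bounded `C¹` map agrees on a given ball with a globally Lipschitz map with the same bound. -/
theorem exists_lipschitz_cutoff [FiniteDimensional ℝ E] {f : E → E → E} {M : ℝ}
    (hf : ContDiff ℝ 1 (Function.uncurry f)) (hM : ∀ a b, ‖f a b‖ ≤ M) (r : ℝ) :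
    ∃ f' : E → E → E, ∃ L : ℝ, 0 < L ∧ (∀ a b, ‖f' a b‖ ≤ M) ∧
      (∀ a b a' b', ‖f' a b - f' a' b'‖ ≤ L * (‖a - a'‖ + ‖b - b'‖)) ∧
      ∀ a b, ‖a‖ ≤ r → ‖b‖ ≤ r → f' a b = f a b := by
  have hR : 0 < max r 1 := lt_of_lt_of_le one_pos (le_max_right _ _)
  let χ : ContDiffBump (0 : E × E) := ⟨max r 1, max r 1 + 1, hR, by linarith⟩
  have hM0 : 0 ≤ M := (norm_nonneg _).trans (hM 0 0)
  let F : E × E → E := fun p => χ p • Function.uncurry f p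
  have hF : ContDiff ℝ 1 F := χ.contDiff.smul hf
  have hcs : HasCompactSupport F := χ.hasCompactSupport.smul_right
  obtain ⟨L, hL⟩ := ContDiff.lipschitzWith_of_hasCompactSupport hcs hF one_ne_zero
  refine ⟨fun a b => F (a, b), L + 1, by positivity, fun a b => ?_, fun a b a' b' => ?_,
    fun a b ha hb => ?_⟩
  · simp only [F, norm_smul, Real.norm_of_nonneg χ.nonneg]
    exact (mul_le_of_le_one_left (norm_nonneg _) χ.le_one).trans (hM a b)
  · have h1 := hL.dist_le_mul (a, b) (a', b')
    rw [dist_eq_norm, dist_eq_norm] at h1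
    refine h1.trans ?_
    have h2 : ‖(a, b) - (a', b')‖ ≤ ‖a - a'‖ + ‖b - b'‖ := by
      rw [Prod.mk_sub_mk, Prod.norm_mk]
      exact max_le_add_of_nonneg (norm_nonneg _) (norm_nonneg _)
    calc (L : ℝ) * ‖(a, b) - (a', b')‖ ≤ L * (‖a - a'‖ + ‖b - b'‖) := by gcongr
      _ ≤ _ := by gcongr; linarith
  · have : χ (a, b) = 1 := by
      apply χ.one_of_mem_closedBall
      rw [mem_closedBall_zero_iff, Prod.norm_mk]
      exact max_le (ha.trans (le_max_left _ _)) (hb.trans (le_max_left _ _))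
    simp [F, this]
end

/-! ### Completed controls -/

/-- Controls of the graph completion, in integrated form. The parameter runs through `[0, 1]`;
`W 0` is the time elapsed in each delay interval, `W i` for `1 ≤ i ≤ N` the mass that the `i`-th
component of the measure has spent, and `W i = 0` for `i > N`. The condition `sum_eq` makes the
parameter proportional to time plus mass. The functions are defined on all of `ℝ`, which makes them
globally Lipschitz; only their values on `[0, 1]` matter. -/
structure IsCompletedControl (N : ℕ) (h K : ℝ) (W : ℕ → ℝ → ℝ) : Prop where
  mono : ∀ i, Monotone (W i)
  zero : ∀ i, W i 0 = 0
  vanish : ∀ i, N < i → ∀ s, W i s = 0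
  sum_eq : ∀ s, ∑ i ∈ Finset.range (N + 1), W i s = s * ∑ i ∈ Finset.range (N + 1), W i 1
  time : W 0 1 = h
  mass : ∑ i ∈ Finset.range N, W (i + 1) 1 ≤ K

namespace IsCompletedControl

variable {N : ℕ} {h K : ℝ} {W : ℕ → ℝ → ℝ} (hW : IsCompletedControl N h K W)
include hW

theorem nonneg_one (i : ℕ) : 0 ≤ W i 1 := by
  rw [← hW.zero i]; exact hW.mono i zero_le_one

theorem total_le : ∑ i ∈ Finset.range (N + 1), W i 1 ≤ h + K := by
  rw [Finset.sum_range_succ', hW.time]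
  linarith [hW.mass]

theorem sub_le (i : ℕ) {s t : ℝ} (hst : s ≤ t) : W i t - W i s ≤ (h + K) * (t - s) := by
  by_cases hi : i < N + 1
  · have h1 : W i t - W i s ≤ ∑ j ∈ Finset.range (N + 1), (W j t - W j s) :=
      Finset.single_le_sum (f := fun j => W j t - W j s)
        (fun j _ => sub_nonneg.2 (hW.mono j hst)) (Finset.mem_range.2 hi)
    rw [Finset.sum_sub_distrib, hW.sum_eq t, hW.sum_eq s, ← sub_mul] at h1
    nlinarith [hW.total_le]
  · rw [hW.vanish i (by omega), hW.vanish i (by omega), sub_zero]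
    have h0 : 0 ≤ ∑ i ∈ Finset.range (N + 1), W i 1 := Finset.sum_nonneg fun i _ => hW.nonneg_one i
    exact mul_nonneg (h0.trans hW.total_le) (sub_nonneg.2 hst)

theorem speed_nonneg : 0 ≤ h + K :=
  (Finset.sum_nonneg fun i _ => hW.nonneg_one i).trans hW.total_le

theorem lipschitz (i : ℕ) : LipschitzWith (h + K).toNNReal (W i) := by
  refine LipschitzWith.of_le_add_mul _ fun s t => ?_
  rw [Real.coe_toNNReal _ hW.speed_nonneg, Real.dist_eq]
  rcases le_total s t with hst | hst
  · have := hW.mono i hst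
    have := mul_nonneg hW.speed_nonneg (abs_nonneg (s - t))
    linarith
  · have := hW.sub_le i hst
    rw [abs_of_nonneg (sub_nonneg.2 hst)]
    linarith

theorem continuous (i : ℕ) : Continuous (W i) := (hW.lipschitz i).continuous

theorem deriv_nonneg (i : ℕ) (s : ℝ) : 0 ≤ deriv (W i) s := (hW.mono i).deriv_nonneg

theorem norm_deriv_le (i : ℕ) (s : ℝ) : ‖deriv (W i) s‖ ≤ h + K := by
  have := norm_deriv_le_of_lipschitz (x₀ := s) (hW.lipschitz i)
  rwa [Real.coe_toNNReal _ hW.speed_nonneg] at this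

theorem integral_deriv (i : ℕ) (a b : ℝ) : ∫ s in a..b, deriv (W i) s = W i b - W i a :=
  ((hW.lipschitz i).lipschitzOnWith.absolutelyContinuousOnInterval).integral_deriv_eq_sub

theorem intervalIntegrable_deriv (i : ℕ) (a b : ℝ) : IntervalIntegrable (deriv (W i)) volume a b :=
  (intervalIntegrable_const (c := h + K)).mono_fun (measurable_deriv _).aestronglyMeasurable
    (.of_forall fun s => (hW.norm_deriv_le i s).trans (le_abs_self _))

theorem ae_differentiableAt : ∀ᵐ s, ∀ i, DifferentiableAt ℝ (W i) s :=
  ae_all_iff.2 fun i => (hW.mono i).ae_differentiableAt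

theorem ae_sum_deriv : ∀ᵐ s, deriv (W 0) s + ∑ i ∈ Finset.range N, deriv (W (i + 1)) s =
    ∑ i ∈ Finset.range (N + 1), W i 1 := by
  filter_upwards [hW.ae_differentiableAt] with s hs
  have h1 : HasDerivAt (fun s => ∑ i ∈ Finset.range (N + 1), W i s)
      (∑ i ∈ Finset.range (N + 1), deriv (W i) s) s :=
    HasDerivAt.fun_sum fun i _ => (hs i).hasDerivAt
  have h2 : HasDerivAt (fun s => ∑ i ∈ Finset.range (N + 1), W i s)
      (∑ i ∈ Finset.range (N + 1), W i 1) s := by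
    have : (fun s => ∑ i ∈ Finset.range (N + 1), W i s) =
      fun s => s * ∑ i ∈ Finset.range (N + 1), W i 1 := funext hW.sum_eq
    rw [this]
    simpa using (hasDerivAt_id s).mul_const (∑ i ∈ Finset.range (N + 1), W i 1)
  rw [← h1.unique h2, Finset.sum_range_succ', add_comm]

end IsCompletedControl

/-- The pure time control `W 0 s = h s`. -/
theorem isCompletedControl_time {N : ℕ} {h K : ℝ} (hh : 0 ≤ h) (hK : 0 ≤ K) :
    IsCompletedControl N h K (fun i s => if i = 0 then h * s else 0) where
  mono i := by
    rcases eq_or_ne i 0 with rfl | hi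
    · exact fun a b hab => by simpa using mul_le_mul_of_nonneg_left hab hh
    · simpa [hi] using monotone_const
  zero i := by simp
  vanish i hi s := by simp [show i ≠ 0 by omega]
  sum_eq s := by simp [mul_comm]
  time := by simp
  mass := by simpa using hK

theorem IsCompletedControl.convexCombo {N : ℕ} {h K : ℝ} {W W' : ℕ → ℝ → ℝ}
    (hW : IsCompletedControl N h K W) (hW' : IsCompletedControl N h K W') {ε : ℝ}
    (hε : ε ∈ Icc (0 : ℝ) 1) :
    IsCompletedControl N h K (fun i s => (1 - ε) * W i s + ε * W' i s) where
  mono i a b hab := add_le_add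
    (mul_le_mul_of_nonneg_left (hW.mono i hab) (by linarith [hε.2]))
    (mul_le_mul_of_nonneg_left (hW'.mono i hab) hε.1)
  zero i := by simp [hW.zero, hW'.zero]
  vanish i hi s := by simp [hW.vanish i hi, hW'.vanish i hi]
  sum_eq s := by
    simp only [Finset.sum_add_distrib, ← Finset.mul_sum]
    rw [hW.sum_eq s, hW'.sum_eq s]; ring
  time := by rw [hW.time, hW'.time]; ring
  mass := by
    simp only [Finset.sum_add_distrib, ← Finset.mul_sum]
    nlinarith [hW.mass, hW'.mass, hε.1, hε.2]

/-- Tychonoff's theorem: the controls form a closed subset of a product of compact intervals. -/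
theorem isCompact_setOf_isCompletedControl (N : ℕ) (h K : ℝ) :
    IsCompact {W | IsCompletedControl N h K W} := by
  have hcpt : IsCompact (Set.pi univ fun _ : ℕ => Set.pi univ fun s : ℝ =>
      Icc (-((h + K) * |s|)) ((h + K) * |s|)) :=
    isCompact_univ_pi fun _ => isCompact_univ_pi fun _ => isCompact_Icc
  refine hcpt.of_isClosed_subset ?_ ?_
  · have hc : ∀ i s, Continuous fun W : ℕ → ℝ → ℝ => W i s := fun i s => by fun_prop
    have : {W | IsCompletedControl N h K W} =
        {W : ℕ → ℝ → ℝ | (∀ i a b, a ≤ b → W i a ≤ W i b) ∧ (∀ i, W i 0 = 0) ∧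
          (∀ i, N < i → ∀ s, W i s = 0) ∧
          (∀ s, ∑ i ∈ Finset.range (N + 1), W i s = s * ∑ i ∈ Finset.range (N + 1), W i 1) ∧
          W 0 1 = h ∧ ∑ i ∈ Finset.range N, W (i + 1) 1 ≤ K} := by
      ext W
      exact ⟨fun hW => ⟨fun i a b hab => hW.mono i hab, hW.zero, hW.vanish, hW.sum_eq, hW.time,
        hW.mass⟩, fun ⟨h1, h2, h3, h4, h5, h6⟩ =>
          ⟨fun i a b hab => h1 i a b hab, h2, h3, h4, h5, h6⟩⟩
    rw [this]
    simp only [ofPred_and, ofPred_forall]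
    refine IsClosed.inter ?_ (IsClosed.inter ?_ (IsClosed.inter ?_ (IsClosed.inter ?_
      (IsClosed.inter ?_ ?_))))
    · exact isClosed_iInter fun i => isClosed_iInter fun a => isClosed_iInter fun b =>
        isClosed_iInter fun _ => isClosed_le (hc i a) (hc i b)
    · exact isClosed_iInter fun i => isClosed_eq (hc i 0) continuous_const
    · exact isClosed_iInter fun i => isClosed_iInter fun _ => isClosed_iInter fun s =>
        isClosed_eq (hc i s) continuous_const
    · exact isClosed_iInter fun s => isClosed_eq (by fun_prop) (by fun_prop)
    · exact isClosed_eq (hc 0 1) continuous_const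
    · exact isClosed_le (by fun_prop) continuous_const
  · intro W hW
    refine fun i _ s _ => ?_
    change W i s ∈ Icc _ _
    rw [mem_Icc, ← abs_le]
    have hW' : IsCompletedControl N h K W := hW
    have := (hW'.lipschitz i).dist_le_mul s 0
    rwa [Real.dist_eq, Real.dist_eq, hW'.zero, sub_zero, sub_zero,
      Real.coe_toNNReal _ hW'.speed_nonneg] at this

/-! ### Completed trajectories -/

namespace DelaySystem

variable {n : ℕ} (D : DelaySystem n)

/-- The initial value of the `(i + 1)`-st component of a completed trajectory: the end value of the
previous component, except for the first one. -/
def start (z : ℕ → ℝ → EuclideanSpace ℝ (Fin n)) (i : ℕ) : EuclideanSpace ℝ (Fin n) :=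
  if i = 0 then D.x₀ else z i 1

/-- The velocity of the `(i + 1)`-st component of a completed trajectory. -/
noncomputable def velocity (W : ℕ → ℝ → ℝ) (z : ℕ → ℝ → EuclideanSpace ℝ (Fin n)) (i : ℕ) (s : ℝ) :
    EuclideanSpace ℝ (Fin n) :=
  deriv (W 0) s • D.f (z (i + 1) s) (z i s) + deriv (W (i + 1)) s • D.g (z (i + 1) s) (z i s)

/-- Trajectories `z 1, …, z N` of the graph completion, one for each delay interval; `z 0` is the
constant history `ξ₀`. -/
structure IsCompletedTraj (W : ℕ → ℝ → ℝ) (z : ℕ → ℝ → EuclideanSpace ℝ (Fin n)) : Prop where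
  history : ∀ s, z 0 s = D.ξ₀
  continuous : ∀ i, Continuous (z i)
  eq_integral : ∀ i < D.N, ∀ s ∈ Icc (0 : ℝ) 1,
    z (i + 1) s = D.start z i + ∫ σ in (0 : ℝ)..s, D.velocity W z i σ

/-- The reachable set of the graph completion. -/
def completedReachableSet (K : ℝ) : Set (EuclideanSpace ℝ (Fin n)) :=
  {y | ∃ W z, IsCompletedControl D.N D.h K W ∧ D.IsCompletedTraj W z ∧ z D.N 1 = y}

variable {D} {M K : ℝ} {W : ℕ → ℝ → ℝ} {z : ℕ → ℝ → EuclideanSpace ℝ (Fin n)}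

theorem norm_velocity_le (hf : ∀ a b, ‖D.f a b‖ ≤ M) (hg : ∀ a b, ‖D.g a b‖ ≤ M)
    (hW : IsCompletedControl D.N D.h K W) (i : ℕ) (s : ℝ) :
    ‖D.velocity W z i s‖ ≤ 2 * (D.h + K) * M := by
  have hM : 0 ≤ M := (norm_nonneg _).trans (hf 0 0)
  have hb : ∀ j (v : EuclideanSpace ℝ (Fin n)), ‖v‖ ≤ M → ‖deriv (W j) s • v‖ ≤ (D.h + K) * M :=
    fun j v hv => by
      rw [norm_smul]
      exact mul_le_mul (hW.norm_deriv_le j s) hv (norm_nonneg _) hW.speed_nonneg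
  calc ‖D.velocity W z i s‖ ≤ (D.h + K) * M + (D.h + K) * M :=
        (norm_add_le _ _).trans (add_le_add (hb _ _ (hf _ _)) (hb _ _ (hg _ _)))
    _ = _ := by ring

theorem measurable_velocity (hf : Continuous (Function.uncurry D.f))
    (hg : Continuous (Function.uncurry D.g)) (hz : ∀ i, Continuous (z i)) (i : ℕ) :
    Measurable (D.velocity W z i) := by
  have h1 : Continuous fun s => D.f (z (i + 1) s) (z i s) := hf.comp ((hz (i + 1)).prodMk (hz i))
  have h2 : Continuous fun s => D.g (z (i + 1) s) (z i s) := hg.comp ((hz (i + 1)).prodMk (hz i))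
  have h3 := fun j => measurable_deriv (W j)
  exact ((h3 0).smul h1.measurable).add ((h3 (i + 1)).smul h2.measurable)

theorem intervalIntegrable_velocity (hf : Continuous (Function.uncurry D.f))
    (hg : Continuous (Function.uncurry D.g)) (hfM : ∀ a b, ‖D.f a b‖ ≤ M)
    (hgM : ∀ a b, ‖D.g a b‖ ≤ M) (hW : IsCompletedControl D.N D.h K W)
    (hz : ∀ i, Continuous (z i)) (i : ℕ) (a b : ℝ) :
    IntervalIntegrable (D.velocity W z i) volume a b :=
  (intervalIntegrable_const (c := 2 * (D.h + K) * M)).mono_fun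
    (measurable_velocity hf hg hz i).aestronglyMeasurable
    (.of_forall fun s => (norm_velocity_le hfM hgM hW i s).trans (le_abs_self _))

/-- An a priori bound that depends on the control only through `K`. -/
theorem IsCompletedTraj.norm_le (hz : D.IsCompletedTraj W z) (hf : ∀ a b, ‖D.f a b‖ ≤ M)
    (hg : ∀ a b, ‖D.g a b‖ ≤ M) (hW : IsCompletedControl D.N D.h K W) :
    ∀ i ≤ D.N, ∀ s ∈ Icc (0 : ℝ) 1,
      ‖z i s‖ ≤ ‖D.ξ₀‖ + ‖D.x₀‖ + i * (2 * (D.h + K) * M) := by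
  have hM : 0 ≤ M := (norm_nonneg _).trans (hf 0 0)
  have hV : 0 ≤ 2 * (D.h + K) * M := mul_nonneg (mul_nonneg zero_le_two hW.speed_nonneg) hM
  intro i
  induction i with
  | zero =>
    intro _ s _
    rw [hz.history]
    simp
  | succ i ih =>
    intro hi s hs
    rw [hz.eq_integral i (by omega) s hs]
    have h1 : ‖D.start z i‖ ≤ ‖D.ξ₀‖ + ‖D.x₀‖ + i * (2 * (D.h + K) * M) := by
      unfold start
      split_ifs with h0
      · subst h0; simp
      · exact ih (by omega) 1 (by simp)
    have h2 : ‖∫ σ in (0 : ℝ)..s, D.velocity W z i σ‖ ≤ 2 * (D.h + K) * M * |s - 0| :=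
      intervalIntegral.norm_integral_le_of_norm_le_const fun σ _ => norm_velocity_le hf hg hW i σ
    rw [sub_zero, abs_of_nonneg hs.1] at h2
    have h3 : 2 * (D.h + K) * M * s ≤ 2 * (D.h + K) * M := mul_le_of_le_one_right hV hs.2
    push_cast
    linarith [norm_add_le (D.start z i) (∫ σ in (0 : ℝ)..s, D.velocity W z i σ)]

theorem IsCompletedTraj.of_eqOn_ball {f' g'} {r : ℝ}
    (hz : D.IsCompletedTraj W z)
    (hf' : ∀ a b, ‖a‖ ≤ r → ‖b‖ ≤ r → f' a b = D.f a b)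
    (hg' : ∀ a b, ‖a‖ ≤ r → ‖b‖ ≤ r → g' a b = D.g a b)
    (hr : ∀ i ≤ D.N, ∀ s ∈ Icc (0 : ℝ) 1, ‖z i s‖ ≤ r) :
    IsCompletedTraj { D with f := f', g := g' } W z where
  history := hz.history
  continuous := hz.continuous
  eq_integral i hi s hs := by
    have hi' : i < D.N := hi
    rw [hz.eq_integral i hi s hs]
    congr 1
    refine intervalIntegral.integral_congr fun σ hσ => ?_
    rw [uIcc_of_le hs.1] at hσ
    have hσ' : σ ∈ Icc (0 : ℝ) 1 := ⟨hσ.1, hσ.2.trans hs.2⟩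
    have h1 := hr (i + 1) hi' σ hσ'
    have h2 := hr i hi'.le σ hσ'
    simp only [velocity, hf' _ _ h1 h2, hg' _ _ h1 h2]

/-- Since trajectories stay in a fixed ball, the vector fields may be replaced by globally Lipschitz
ones. -/
theorem exists_lipschitz_system (hf : ContDiff ℝ 1 (Function.uncurry D.f))
    (hg : ContDiff ℝ 1 (Function.uncurry D.g))
    (hfM : ∀ a b, ‖D.f a b‖ ≤ M) (hgM : ∀ a b, ‖D.g a b‖ ≤ M) (K : ℝ) :
    ∃ f' g', ∃ L : ℝ, 0 < L ∧ (∀ a b, ‖f' a b‖ ≤ M) ∧ (∀ a b, ‖g' a b‖ ≤ M) ∧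
      (∀ a b a' b', ‖f' a b - f' a' b'‖ ≤ L * (‖a - a'‖ + ‖b - b'‖)) ∧
      (∀ a b a' b', ‖g' a b - g' a' b'‖ ≤ L * (‖a - a'‖ + ‖b - b'‖)) ∧
      ∀ W z, IsCompletedControl D.N D.h K W →
        (D.IsCompletedTraj W z ↔ IsCompletedTraj { D with f := f', g := g' } W z) := by
  have hM : 0 ≤ M := (norm_nonneg _).trans (hfM 0 0)
  set r := ‖D.ξ₀‖ + ‖D.x₀‖ + D.N * (2 * (D.h + K) * M) with hr
  obtain ⟨f', L₁, hL₁, h1, h2, h3⟩ := exists_lipschitz_cutoff hf hfM r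
  obtain ⟨g', L₂, hL₂, h4, h5, h6⟩ := exists_lipschitz_cutoff hg hgM r
  have hrad : ∀ {W : ℕ → ℝ → ℝ}, IsCompletedControl D.N D.h K W → ∀ i ≤ D.N,
      ‖D.ξ₀‖ + ‖D.x₀‖ + i * (2 * (D.h + K) * M) ≤ r := fun {W} hW i hi => by
    have hV : 0 ≤ 2 * (D.h + K) * M := mul_nonneg (mul_nonneg zero_le_two hW.speed_nonneg) hM
    have : (i : ℝ) ≤ D.N := by exact_mod_cast hi
    rw [hr]; gcongr
  refine ⟨f', g', max L₁ L₂, lt_max_of_lt_left hL₁, h1, h4, fun a b a' b' => ?_,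
    fun a b a' b' => ?_, fun W z hW => ⟨fun hz => ?_, fun hz => ?_⟩⟩
  · exact (h2 a b a' b').trans (by gcongr; exact le_max_left _ _)
  · exact (h5 a b a' b').trans (by gcongr; exact le_max_right _ _)
  · exact hz.of_eqOn_ball h3 h6 fun i hi s hs =>
      (hz.norm_le hfM hgM hW i hi s hs).trans (hrad hW i hi)
  · exact IsCompletedTraj.of_eqOn_ball (D := { D with f := f', g := g' }) (f' := D.f) (g' := D.g)
      (r := r) hz (fun a b ha hb => (h3 a b ha hb).symm) (fun a b ha hb => (h6 a b ha hb).symm)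
      fun i hi s hs =>
      (hz.norm_le h1 h4 hW i hi s hs).trans (hrad hW i hi)

theorem continuous_of_lipschitz {f : EuclideanSpace ℝ (Fin n) → EuclideanSpace ℝ (Fin n) →
      EuclideanSpace ℝ (Fin n)} {L : ℝ} (hL : 0 < L)
    (hf : ∀ a b a' b', ‖f a b - f a' b'‖ ≤ L * (‖a - a'‖ + ‖b - b'‖)) :
    Continuous (Function.uncurry f) := by
  refine (LipschitzWith.of_dist_le_mul (K := (2 * L).toNNReal) fun p q => ?_).continuous
  rw [dist_eq_norm, dist_eq_norm, Real.coe_toNNReal _ (by positivity)]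
  refine (hf p.1 p.2 q.1 q.2).trans ?_
  have h1 : ‖p.1 - q.1‖ ≤ ‖p - q‖ := norm_fst_le (p - q)
  have h2 : ‖p.2 - q.2‖ ≤ ‖p - q‖ := norm_snd_le (p - q)
  calc L * (‖p.1 - q.1‖ + ‖p.2 - q.2‖) ≤ L * (‖p - q‖ + ‖p - q‖) := by gcongr
    _ = _ := by ring

theorem exists_isCompletedTraj_of_lipschitz {L : ℝ} (hL : 0 < L)
    (hf : ∀ a b a' b', ‖D.f a b - D.f a' b'‖ ≤ L * (‖a - a'‖ + ‖b - b'‖))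
    (hg : ∀ a b a' b', ‖D.g a b - D.g a' b'‖ ≤ L * (‖a - a'‖ + ‖b - b'‖))
    (hfM : ∀ a b, ‖D.f a b‖ ≤ M) (hgM : ∀ a b, ‖D.g a b‖ ≤ M)
    (hW : IsCompletedControl D.N D.h K W) (hS : 0 < D.h + K) : ∃ z, D.IsCompletedTraj W z := by
  have hstep : ∀ (i : ℕ) (y : {u : ℝ → EuclideanSpace ℝ (Fin n) // Continuous u}),
      ∃ z : {u : ℝ → EuclideanSpace ℝ (Fin n) // Continuous u}, ∀ s ∈ Icc (0 : ℝ) 1,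
        z.1 s = (if i = 0 then D.x₀ else y.1 1) + ∫ σ in (0 : ℝ)..s,
          (deriv (W 0) σ • D.f (z.1 σ) (y.1 σ) + deriv (W (i + 1)) σ • D.g (z.1 σ) (y.1 σ)) := by
    intro i y
    obtain ⟨z, hz, hz'⟩ := exists_continuous_eq_add_integral
      (Φ := fun σ u => deriv (W 0) σ • D.f u (y.1 σ) + deriv (W (i + 1)) σ • D.g u (y.1 σ))
      (C := 2 * (D.h + K) * L) (M := 2 * (D.h + K) * M) (by positivity)
      (fun s u v => by
        rw [add_sub_add_comm, ← smul_sub, ← smul_sub]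
        refine (norm_add_le _ _).trans ?_
        have hb : ∀ j (p : EuclideanSpace ℝ (Fin n)), ‖p‖ ≤ L * ‖u - v‖ →
            ‖deriv (W j) s • p‖ ≤ (D.h + K) * (L * ‖u - v‖) := fun j p hp => by
          rw [norm_smul]
          exact mul_le_mul (hW.norm_deriv_le j s) hp (norm_nonneg _) hS.le
        have h1 := hb 0 _ (by simpa using hf u (y.1 s) v (y.1 s))
        have h2 := hb (i + 1) _ (by simpa using hg u (y.1 s) v (y.1 s))
        linarith)
      (fun s u => norm_velocity_le (D := D) (z := fun j _ => if j = i + 1 then u else y.1 s)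
        hfM hgM hW i s |>.trans' (by simp [velocity]))
      (fun u hu => by
        have h1 : Continuous fun s => D.f (u s) (y.1 s) :=
          (continuous_of_lipschitz hL hf).comp (hu.prodMk y.2)
        have h2 : Continuous fun s => D.g (u s) (y.1 s) :=
          (continuous_of_lipschitz hL hg).comp (hu.prodMk y.2)
        have h3 := fun j => measurable_deriv (W j)
        exact (((h3 0).smul h1.measurable).add
          ((h3 (i + 1)).smul h2.measurable)).aestronglyMeasurable)
      (if i = 0 then D.x₀ else y.1 1)
    exact ⟨⟨z, hz⟩, hz'⟩
  choose next hnext using hstep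
  let z : ℕ → {u : ℝ → EuclideanSpace ℝ (Fin n) // Continuous u} := fun i =>
    Nat.rec ⟨fun _ => D.ξ₀, continuous_const⟩ next i
  exact ⟨fun i => (z i).1, fun s => rfl, fun i => (z i).2, fun i _ s hs => hnext i (z i) s hs⟩

/-- Uniformly Lipschitz controls that converge pointwise converge weakly. -/
theorem eventually_norm_integral_deriv_sub_le {N : ℕ} {h : ℝ} {W₀ : ℕ → ℝ → ℝ}
    (hW₀ : IsCompletedControl N h K W₀) {φ : ℝ → EuclideanSpace ℝ (Fin n)} (hφ : Continuous φ)
    (i : ℕ) {ε : ℝ} (hε : 0 < ε) :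
    ∀ᶠ W in 𝓝 W₀, IsCompletedControl N h K W → ∀ s ∈ Icc (0 : ℝ) 1,
      ‖∫ σ in (0 : ℝ)..s, (deriv (W i) σ - deriv (W₀ i) σ) • φ σ‖ ≤ ε := by
  set C := h + K with hC
  have hC0 : 0 ≤ C := hW₀.speed_nonneg
  obtain ⟨B, hB⟩ := isCompact_Icc.exists_bound_of_continuousOn (s := Icc (0 : ℝ) 1)
    hφ.continuousOn
  have hB0 : 0 ≤ B := (norm_nonneg _).trans (hB 0 (by simp))
  have huc := isCompact_Icc.uniformContinuousOn_of_continuous (s := Icc (0 : ℝ) 1) hφ.continuousOn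
  rw [Metric.uniformContinuousOn_iff_le] at huc
  obtain ⟨δ, hδ, huc⟩ := huc (ε / (6 * (C + 1))) (by positivity)
  -- approximate `φ` by its values on a grid of mesh `1 / m`; on each cell the integral of the
  -- derivatives is a difference of values of the controls at the grid points
  obtain ⟨m, hm⟩ := exists_nat_gt (max (1 / δ) (6 * C * B / ε))
  have hm0 : (0 : ℝ) < m := lt_of_lt_of_le (by positivity) ((le_max_left _ _).trans hm.le)
  have hmδ : 1 / m ≤ δ := by
    rw [div_le_iff₀ hm0]
    have := ((le_max_left _ _).trans_lt hm).le
    rw [div_le_iff₀ hδ] at this; linarith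
  have hmB : 2 * C * B / m ≤ ε / 3 := by
    rw [div_le_iff₀ hm0]
    have := ((le_max_right _ _).trans_lt hm).le
    rw [div_le_iff₀ hε] at this; linarith
  have hev : ∀ᶠ W in 𝓝 W₀, ∀ k ∈ Finset.range (m + 1),
      |W i (k / m) - W₀ i (k / m)| ≤ ε / (6 * m * (B + 1)) := by
    refine (Filter.eventually_all_finset _).2 fun k _ => ?_
    have hc : Continuous fun W : ℕ → ℝ → ℝ => |W i (k / m) - W₀ i (k / m)| := by fun_prop
    have := hc.tendsto W₀
    simp only [sub_self, abs_zero] at this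
    exact this.eventually_le_const (by positivity)
  filter_upwards [hev] with W hWk hW s hs
  have hd : ∀ σ, ‖deriv (W i) σ - deriv (W₀ i) σ‖ ≤ 2 * C := fun σ =>
    (norm_sub_le _ _).trans (by linarith [hW.norm_deriv_le i σ, hW₀.norm_deriv_le i σ])
  have hint : ∀ a b, IntervalIntegrable (fun σ => (deriv (W i) σ - deriv (W₀ i) σ) • φ σ)
      volume a b := fun a b =>
    ((hW.intervalIntegrable_deriv i a b).sub
      (hW₀.intervalIntegrable_deriv i a b)).smul_continuousOn hφ.continuousOn
  have hpiece : ∀ k < m, ‖∫ σ in ((k : ℝ) / m)..((k + 1 : ℕ) : ℝ) / m,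
      (deriv (W i) σ - deriv (W₀ i) σ) • φ σ‖ ≤
        2 * (ε / (6 * m * (B + 1))) * B + 2 * C * (ε / (6 * (C + 1))) * (1 / m) := by
    intro k hk
    have hkm : (k : ℝ) + 1 ≤ m := by exact_mod_cast hk
    have hle : (k : ℝ) / m ≤ ((k + 1 : ℕ) : ℝ) / m := by push_cast; gcongr; linarith
    have hlen : ((k + 1 : ℕ) : ℝ) / m - (k : ℝ) / m = 1 / m := by push_cast; field_simp; ring
    have hk0 : (0 : ℝ) ≤ (k : ℝ) / m := by positivity
    have hk1 : ((k + 1 : ℕ) : ℝ) / m ≤ 1 := by rw [div_le_one hm0]; push_cast; exact hkm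
    have hsplit : ∫ σ in ((k : ℝ) / m)..((k + 1 : ℕ) : ℝ) / m,
          (deriv (W i) σ - deriv (W₀ i) σ) • φ σ =
        (∫ σ in ((k : ℝ) / m)..((k + 1 : ℕ) : ℝ) / m,
          (deriv (W i) σ - deriv (W₀ i) σ) • φ (k / m)) +
        ∫ σ in ((k : ℝ) / m)..((k + 1 : ℕ) : ℝ) / m,
          (deriv (W i) σ - deriv (W₀ i) σ) • (φ σ - φ (k / m)) := by
      rw [← intervalIntegral.integral_add]
      · simp only [← smul_add, add_sub_cancel]
      · exact ((hW.intervalIntegrable_deriv i _ _).sub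
          (hW₀.intervalIntegrable_deriv i _ _)).smul_continuousOn continuousOn_const
      · exact ((hW.intervalIntegrable_deriv i _ _).sub
          (hW₀.intervalIntegrable_deriv i _ _)).smul_continuousOn
            (hφ.sub continuous_const).continuousOn
    rw [hsplit]
    refine (norm_add_le _ _).trans (add_le_add ?_ ?_)
    · rw [intervalIntegral.integral_smul_const, intervalIntegral.integral_sub
        (hW.intervalIntegrable_deriv i _ _) (hW₀.intervalIntegrable_deriv i _ _),
        hW.integral_deriv, hW₀.integral_deriv, norm_smul]
      have e1 := abs_le.1 (hWk k (Finset.mem_range.2 (by omega)))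
      have e2 := abs_le.1 (hWk (k + 1) (Finset.mem_range.2 (by omega)))
      refine mul_le_mul ?_ (hB _ ⟨hk0, hle.trans hk1⟩) (norm_nonneg _) (by positivity)
      rw [Real.norm_eq_abs, abs_le]
      constructor <;> linarith [e1.1, e1.2, e2.1, e2.2]
    · refine (intervalIntegral.norm_integral_le_of_norm_le_const
        (C := 2 * C * (ε / (6 * (C + 1)))) fun σ hσ => ?_).trans ?_
      · rw [uIoc_of_le hle] at hσ
        rw [norm_smul]
        refine mul_le_mul (hd σ) ?_ (norm_nonneg _) (by positivity)
        rw [← dist_eq_norm]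
        refine huc σ ⟨hk0.trans hσ.1.le, hσ.2.trans hk1⟩ _ ⟨hk0, hle.trans hk1⟩ ?_
        rw [Real.dist_eq, abs_of_nonneg (sub_nonneg.2 hσ.1.le)]
        linarith [hσ.2]
      · rw [hlen, abs_of_nonneg (by positivity)]
  -- full cells up to `k / m`, and a rest shorter than `1 / m`
  set k := ⌊s * m⌋₊ with hk
  have hks : (k : ℝ) ≤ s * m := Nat.floor_le (mul_nonneg hs.1 hm0.le)
  have hks' : s * m < k + 1 := Nat.lt_floor_add_one _
  have hkm : k ≤ m := by
    have : (k : ℝ) ≤ m := hks.trans (mul_le_of_le_one_left hm0.le hs.2)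
    exact_mod_cast this
  have hkdiv : (k : ℝ) / m ≤ s := by rwa [div_le_iff₀ hm0]
  have hsum := intervalIntegral.sum_integral_adjacent_intervals (n := k)
    (a := fun j : ℕ => (j : ℝ) / m) (fun j _ => hint _ _)
  simp only [Nat.cast_zero, zero_div] at hsum
  rw [← intervalIntegral.integral_add_adjacent_intervals (hint 0 (k / m)) (hint (k / m) s), ← hsum]
  have hlast : ‖∫ σ in ((k : ℝ) / m)..s, (deriv (W i) σ - deriv (W₀ i) σ) • φ σ‖ ≤ ε / 3 := by
    refine (intervalIntegral.norm_integral_le_of_norm_le_const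
      (C := 2 * C * B) fun σ hσ => ?_).trans ?_
    · rw [uIoc_of_le hkdiv] at hσ
      rw [norm_smul]
      have hk0 : (0 : ℝ) ≤ (k : ℝ) / m := by positivity
      exact mul_le_mul (hd σ) (hB σ ⟨hk0.trans hσ.1.le, hσ.2.trans hs.2⟩) (norm_nonneg _)
        (by positivity)
    · rw [abs_of_nonneg (sub_nonneg.2 hkdiv)]
      refine le_trans ?_ hmB
      have : s - k / m ≤ 1 / m := by
        rw [sub_le_iff_le_add, ← add_div, le_div_iff₀ hm0]; linarith
      calc 2 * C * B * (s - k / m) ≤ 2 * C * B * (1 / m) := by gcongr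
        _ = _ := by ring
  have hfirst : ‖∑ j ∈ Finset.range k, ∫ σ in ((j : ℝ) / m)..((j + 1 : ℕ) : ℝ) / m,
      (deriv (W i) σ - deriv (W₀ i) σ) • φ σ‖ ≤ 2 * (ε / 3) := by
    refine (norm_sum_le _ _).trans ((Finset.sum_le_sum fun j hj =>
      hpiece j ((Finset.mem_range.1 hj).trans_le hkm)).trans ?_)
    rw [Finset.sum_const, Finset.card_range, nsmul_eq_mul]
    have e1 : 2 * (ε / (6 * m * (B + 1))) * B ≤ ε / 3 * (1 / m) := by
      have : 2 * (ε / (6 * m * (B + 1))) * B = ε / 3 * (1 / m) * (B / (B + 1)) := by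
        field_simp; ring
      rw [this]
      exact mul_le_of_le_one_right (by positivity) ((div_le_one (by positivity)).2 (by linarith))
    have e2 : 2 * C * (ε / (6 * (C + 1))) * (1 / m) ≤ ε / 3 * (1 / m) := by
      have : 2 * C * (ε / (6 * (C + 1))) * (1 / m) = ε / 3 * (1 / m) * (C / (C + 1)) := by
        field_simp; ring
      rw [this]
      exact mul_le_of_le_one_right (by positivity) ((div_le_one (by positivity)).2 (by linarith))
    calc (k : ℝ) * (2 * (ε / (6 * m * (B + 1))) * B + 2 * C * (ε / (6 * (C + 1))) * (1 / m))
        ≤ m * (ε / 3 * (1 / m) + ε / 3 * (1 / m)) := by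
          have : (k : ℝ) ≤ m := by exact_mod_cast hkm
          gcongr
      _ = 2 * (ε / 3) := by field_simp; ring
  linarith [norm_add_le (∑ j ∈ Finset.range k, ∫ σ in ((j : ℝ) / m)..((j + 1 : ℕ) : ℝ) / m,
      (deriv (W i) σ - deriv (W₀ i) σ) • φ σ)
      (∫ σ in ((k : ℝ) / m)..s, (deriv (W i) σ - deriv (W₀ i) σ) • φ σ)]

end DelaySystem

/-! ### Continuous dependence and compactness -/

namespace DelaySystem
variable {n : ℕ} {D : DelaySystem n} {M K : ℝ}

/-- Continuous dependence on the control, for globally Lipschitz vector fields. -/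
theorem eventually_norm_traj_sub_le_of_lipschitz {L : ℝ} (hL : 0 < L)
    (hf : ∀ a b a' b', ‖D.f a b - D.f a' b'‖ ≤ L * (‖a - a'‖ + ‖b - b'‖))
    (hg : ∀ a b a' b', ‖D.g a b - D.g a' b'‖ ≤ L * (‖a - a'‖ + ‖b - b'‖))
    (hfM : ∀ a b, ‖D.f a b‖ ≤ M) (hgM : ∀ a b, ‖D.g a b‖ ≤ M) (hS : 0 < D.h + K)
    {W₀ : ℕ → ℝ → ℝ} {z₀ : ℕ → ℝ → EuclideanSpace ℝ (Fin n)}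
    (hW₀ : IsCompletedControl D.N D.h K W₀) (hz₀ : D.IsCompletedTraj W₀ z₀) :
    ∀ i ≤ D.N, ∀ ε > 0, ∀ᶠ W in 𝓝 W₀, IsCompletedControl D.N D.h K W →
      ∀ z, D.IsCompletedTraj W z → ∀ s ∈ Icc (0 : ℝ) 1, ‖z i s - z₀ i s‖ ≤ ε := by
  have hfc := continuous_of_lipschitz hL hf
  have hgc := continuous_of_lipschitz hL hg
  intro i
  induction i with
  | zero =>
    intro _ ε hε
    refine .of_forall fun W _ z hz s _ => ?_
    rw [hz.history, hz₀.history, sub_self, norm_zero]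
    exact hε.le
  | succ i ih =>
    intro hi ε hε
    set C := 2 * (D.h + K) * L with hC
    have hC0 : 0 < C := by positivity
    -- the start, the two weak differences and the previous component contribute `η, η, η, C η`
    set η := ε / ((3 + C) * Real.exp C) with hη
    have hη0 : 0 < η := by positivity
    have hφf : Continuous fun s => D.f (z₀ (i + 1) s) (z₀ i s) :=
      hfc.comp ((hz₀.continuous _).prodMk (hz₀.continuous _))
    have hφg : Continuous fun s => D.g (z₀ (i + 1) s) (z₀ i s) :=
      hgc.comp ((hz₀.continuous _).prodMk (hz₀.continuous _))
    filter_upwards [ih (by omega) η hη0, eventually_norm_integral_deriv_sub_le hW₀ hφf 0 hη0,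
      eventually_norm_integral_deriv_sub_le hW₀ hφg (i + 1) hη0] with W h1 h2 h3 hW z hz
    have hstart : ‖D.start z i - D.start z₀ i‖ ≤ η := by
      unfold start
      split_ifs with h0
      · simpa using hη0.le
      · exact h1 hW z hz 1 (by simp)
    have hu : Continuous fun s => ‖z (i + 1) s - z₀ (i + 1) s‖ :=
      ((hz.continuous _).sub (hz₀.continuous _)).norm
    have hgr := le_mul_exp_of_le_add_mul_integral (η := (3 + C) * η) hu hC0
      (fun s => norm_nonneg _) (fun s hs => by
        have hi1 := intervalIntegrable_velocity hfc hgc hfM hgM hW hz.continuous i 0 s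
        have hi2 := intervalIntegrable_velocity hfc hgc hfM hgM hW₀ hz₀.continuous i 0 s
        have hi3 : IntervalIntegrable (fun σ => (deriv (W 0) σ - deriv (W₀ 0) σ) •
            D.f (z₀ (i + 1) σ) (z₀ i σ)) volume 0 s :=
          ((hW.intervalIntegrable_deriv 0 _ _).sub
            (hW₀.intervalIntegrable_deriv 0 _ _)).smul_continuousOn hφf.continuousOn
        have hi4 : IntervalIntegrable (fun σ => (deriv (W (i + 1)) σ - deriv (W₀ (i + 1)) σ) •
            D.g (z₀ (i + 1) σ) (z₀ i σ)) volume 0 s :=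
          ((hW.intervalIntegrable_deriv (i + 1) _ _).sub
            (hW₀.intervalIntegrable_deriv (i + 1) _ _)).smul_continuousOn hφg.continuousOn
        have hsplit : z (i + 1) s - z₀ (i + 1) s = (D.start z i - D.start z₀ i) +
            (∫ σ in (0 : ℝ)..s, (deriv (W 0) σ - deriv (W₀ 0) σ) •
              D.f (z₀ (i + 1) σ) (z₀ i σ)) +
            (∫ σ in (0 : ℝ)..s, (deriv (W (i + 1)) σ - deriv (W₀ (i + 1)) σ) •
              D.g (z₀ (i + 1) σ) (z₀ i σ)) +
            ∫ σ in (0 : ℝ)..s, (D.velocity W z i σ - D.velocity W₀ z₀ i σ -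
              (deriv (W 0) σ - deriv (W₀ 0) σ) • D.f (z₀ (i + 1) σ) (z₀ i σ) -
              (deriv (W (i + 1)) σ - deriv (W₀ (i + 1)) σ) •
              D.g (z₀ (i + 1) σ) (z₀ i σ)) := by
          rw [intervalIntegral.integral_sub ((hi1.sub hi2).sub hi3) hi4,
            intervalIntegral.integral_sub (hi1.sub hi2) hi3,
            intervalIntegral.integral_sub hi1 hi2, hz.eq_integral i (by omega) s hs,
            hz₀.eq_integral i (by omega) s hs]
          abel
        have hrest : ‖∫ σ in (0 : ℝ)..s, (D.velocity W z i σ - D.velocity W₀ z₀ i σ -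
              (deriv (W 0) σ - deriv (W₀ 0) σ) • D.f (z₀ (i + 1) σ) (z₀ i σ) -
              (deriv (W (i + 1)) σ - deriv (W₀ (i + 1)) σ) •
              D.g (z₀ (i + 1) σ) (z₀ i σ))‖ ≤
            ∫ σ in (0 : ℝ)..s, (C * η + C * ‖z (i + 1) σ - z₀ (i + 1) σ‖) := by
          refine intervalIntegral.norm_integral_le_of_norm_le hs.1 (.of_forall fun σ hσ => ?_)
            (Continuous.intervalIntegrable (by fun_prop) _ _)
          have hσ' : σ ∈ Icc (0 : ℝ) 1 := ⟨hσ.1.le, hσ.2.trans hs.2⟩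
          have e : D.velocity W z i σ - D.velocity W₀ z₀ i σ -
              (deriv (W 0) σ - deriv (W₀ 0) σ) • D.f (z₀ (i + 1) σ) (z₀ i σ) -
              (deriv (W (i + 1)) σ - deriv (W₀ (i + 1)) σ) • D.g (z₀ (i + 1) σ) (z₀ i σ) =
              deriv (W 0) σ • (D.f (z (i + 1) σ) (z i σ) - D.f (z₀ (i + 1) σ) (z₀ i σ)) +
              deriv (W (i + 1)) σ •
                (D.g (z (i + 1) σ) (z i σ) - D.g (z₀ (i + 1) σ) (z₀ i σ)) := by
            simp only [velocity, smul_sub, sub_smul]; abel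
          have hb : ∀ j (p : EuclideanSpace ℝ (Fin n)),
              ‖p‖ ≤ L * (‖z (i + 1) σ - z₀ (i + 1) σ‖ + ‖z i σ - z₀ i σ‖) →
              ‖deriv (W j) σ • p‖ ≤ (D.h + K) * (L * (‖z (i + 1) σ - z₀ (i + 1) σ‖ + η)) :=
            fun j p hp => by
              rw [norm_smul]
              have h4 := h1 hW z hz σ hσ'
              exact mul_le_mul (hW.norm_deriv_le j σ) (hp.trans (by gcongr)) (norm_nonneg _) hS.le
          rw [e]
          refine (norm_add_le _ _).trans ((add_le_add (hb 0 _ (hf _ _ _ _))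
            (hb (i + 1) _ (hg _ _ _ _))).trans (le_of_eq ?_))
          rw [hC]; ring
        rw [intervalIntegral.integral_add (by simp)
            (Continuous.intervalIntegrable (by fun_prop) _ _),
          intervalIntegral.integral_const, intervalIntegral.integral_const_mul, sub_zero,
          smul_eq_mul] at hrest
        have hsC : s * (C * η) ≤ C * η := mul_le_of_le_one_left (by positivity) hs.2
        rw [hsplit]
        refine (norm_add_le _ _).trans ?_
        have := norm_add₃_le (a := D.start z i - D.start z₀ i)
          (b := ∫ σ in (0 : ℝ)..s, (deriv (W 0) σ - deriv (W₀ 0) σ) •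
              D.f (z₀ (i + 1) σ) (z₀ i σ))
          (c := ∫ σ in (0 : ℝ)..s, (deriv (W (i + 1)) σ - deriv (W₀ (i + 1)) σ) •
              D.g (z₀ (i + 1) σ) (z₀ i σ))
        linarith [h2 hW s hs, h3 hW s hs])
    intro s hs
    refine (hgr s hs).trans ?_
    calc (3 + C) * η * Real.exp (C * s) ≤ (3 + C) * η * Real.exp C := by
          gcongr; exact mul_le_of_le_one_right hC0.le hs.2
      _ = ε := by rw [hη]; field_simp

section
variable (hf : ContDiff ℝ 1 (Function.uncurry D.f)) (hg : ContDiff ℝ 1 (Function.uncurry D.g))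
  (hfM : ∀ a b, ‖D.f a b‖ ≤ M) (hgM : ∀ a b, ‖D.g a b‖ ≤ M) (hS : 0 < D.h + K)
include hf hg hfM hgM hS

theorem exists_isCompletedTraj {W : ℕ → ℝ → ℝ} (hW : IsCompletedControl D.N D.h K W) :
    ∃ z, D.IsCompletedTraj W z := by
  obtain ⟨f', g', L, hL, h1, h2, h3, h4, h5⟩ := exists_lipschitz_system hf hg hfM hgM K
  obtain ⟨z, hz⟩ := exists_isCompletedTraj_of_lipschitz (D := { D with f := f', g := g' })
    hL h3 h4 h1 h2 hW hS
  exact ⟨z, (h5 W z hW).2 hz⟩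

/-- Continuous dependence of the end point on the control. -/
theorem eventually_norm_traj_sub_le
    {W₀ : ℕ → ℝ → ℝ} {z₀ : ℕ → ℝ → EuclideanSpace ℝ (Fin n)}
    (hW₀ : IsCompletedControl D.N D.h K W₀) (hz₀ : D.IsCompletedTraj W₀ z₀) {ε : ℝ} (hε : 0 < ε) :
    ∀ᶠ W in 𝓝 W₀, IsCompletedControl D.N D.h K W →
      ∀ z, D.IsCompletedTraj W z → ‖z D.N 1 - z₀ D.N 1‖ ≤ ε := by
  obtain ⟨f', g', L, hL, h1, h2, h3, h4, h5⟩ := exists_lipschitz_system hf hg hfM hgM K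
  filter_upwards [eventually_norm_traj_sub_le_of_lipschitz (D := { D with f := f', g := g' })
    hL h3 h4 h1 h2 hS hW₀ ((h5 W₀ z₀ hW₀).1 hz₀) D.N le_rfl ε hε] with W h6 hW z hz
  exact h6 hW z ((h5 W z hW).1 hz) 1 (by simp)

theorem isCompact_completedReachableSet : IsCompact (D.completedReachableSet K) := by
  choose! Z hZ using fun W hW => exists_isCompletedTraj (W := W) hf hg hfM hgM hS hW
  have hcont : ContinuousOn (fun W => Z W D.N 1) {W | IsCompletedControl D.N D.h K W} := by
    intro W₀ hW₀
    rw [ContinuousWithinAt, Metric.tendsto_nhds]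
    intro ε hε
    filter_upwards [nhdsWithin_le_nhds (eventually_norm_traj_sub_le hf hg hfM hgM hS hW₀
      (hZ W₀ hW₀) (half_pos hε)), self_mem_nhdsWithin] with W h1 hW
    rw [dist_eq_norm]
    exact (h1 hW _ (hZ W hW)).trans_lt (half_lt_self hε)
  have himage : D.completedReachableSet K =
      (fun W => Z W D.N 1) '' {W | IsCompletedControl D.N D.h K W} := by
    ext y
    constructor
    · rintro ⟨W, z, hW, hz, rfl⟩
      refine ⟨W, hW, ?_⟩
      -- trajectories are unique, by continuous dependence at the constant family
      refine eq_of_forall_dist_le fun ε hε => ?_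
      rw [dist_eq_norm]
      exact (eventually_norm_traj_sub_le hf hg hfM hgM hS hW hz hε).self_of_nhds hW _ (hZ W hW)
    · rintro ⟨W, hW, rfl⟩
      exact ⟨W, Z W, hW, hZ W hW, rfl⟩
  rw [himage]
  exact (isCompact_setOf_isCompletedControl D.N D.h K).image_of_continuousOn hcont

theorem completedReachableSet_nonempty (hh : 0 ≤ D.h) (hK : 0 ≤ K) :
    (D.completedReachableSet K).Nonempty := by
  obtain ⟨z, hz⟩ := exists_isCompletedTraj hf hg hfM hgM hS
    (isCompletedControl_time (N := D.N) hh hK)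
  exact ⟨_, _, z, isCompletedControl_time hh hK, hz, rfl⟩

/-- Mixing a little of the pure time control into a control makes its time component strictly
increasing and hardly moves the end point. -/
theorem exists_strictMono_near (hh : 0 < D.h) (hK : 0 ≤ K) {y : EuclideanSpace ℝ (Fin n)}
    (hy : y ∈ D.completedReachableSet K) {η : ℝ} (hη : 0 < η) :
    ∃ W z, IsCompletedControl D.N D.h K W ∧ D.IsCompletedTraj W z ∧
      (∃ c > 0, ∀ s t, s ≤ t → c * (t - s) ≤ W 0 t - W 0 s) ∧ ‖z D.N 1 - y‖ ≤ η := by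
  obtain ⟨W, z, hW, hz, rfl⟩ := hy
  set W' : ℕ → ℝ → ℝ := fun i s => if i = 0 then D.h * s else 0 with hW'
  have hW'c : IsCompletedControl D.N D.h K W' := isCompletedControl_time hh.le hK
  have hlim : Tendsto (fun ε : ℝ => (fun i s => (1 - ε) * W i s + ε * W' i s : ℕ → ℝ → ℝ))
      (𝓝[>] 0) (𝓝 W) := by
    refine tendsto_nhdsWithin_of_tendsto_nhds ?_
    have hc : Continuous fun ε : ℝ =>
        (fun i s => (1 - ε) * W i s + ε * W' i s : ℕ → ℝ → ℝ) := by fun_prop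
    have := hc.tendsto 0
    simpa using this
  have hev := hlim.eventually (eventually_norm_traj_sub_le hf hg hfM hgM hS hW hz hη)
  obtain ⟨ε, h1, h2⟩ := (hev.and (Ioc_mem_nhdsGT one_pos)).exists
  have hc := hW.convexCombo hW'c ⟨h2.1.le, h2.2⟩
  obtain ⟨z', hz'⟩ := exists_isCompletedTraj hf hg hfM hgM hS hc
  refine ⟨_, z', hc, hz', ⟨ε * D.h, mul_pos h2.1 hh, fun s t hst => ?_⟩, h1 hc z' hz'⟩
  have h3 := mul_nonneg (sub_nonneg.2 h2.2) (sub_nonneg.2 (hW.mono 0 hst))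
  simp only [hW', if_true]
  linarith
end
end DelaySystem

/-! ### Fibers of a time change -/

/-- A time change of `[0, 1]` onto `[0, h]`. -/
structure IsTimeChange (h : ℝ) (R : ℝ → ℝ) : Prop where
  mono : Monotone R
  continuous : Continuous R
  zero : R 0 = 0
  one : R 1 = h

theorem IsCompletedControl.isTimeChange {N : ℕ} {h K : ℝ} {W : ℕ → ℝ → ℝ}
    (hW : IsCompletedControl N h K W) : IsTimeChange h (W 0) :=
  ⟨hW.mono 0, hW.continuous 0, hW.zero 0, hW.time⟩

/-- The left end point of the fiber of `R` over `r` in `[0, 1]`. -/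
noncomputable def fiberLeft (R : ℝ → ℝ) (r : ℝ) : ℝ := sInf {s ∈ Icc (0 : ℝ) 1 | R s = r}

/-- The right end point of the fiber of `R` over `r` in `[0, 1]`. -/
noncomputable def fiberRight (R : ℝ → ℝ) (r : ℝ) : ℝ := sSup {s ∈ Icc (0 : ℝ) 1 | R s = r}

namespace IsTimeChange

variable {h : ℝ} {R : ℝ → ℝ} (hR : IsTimeChange h R)
include hR

theorem nonneg : 0 ≤ h := by
  rw [← hR.zero, ← hR.one]; exact hR.mono zero_le_one

theorem mapsTo {s : ℝ} (hs : s ∈ Icc (0 : ℝ) 1) : R s ∈ Icc 0 h :=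
  ⟨hR.zero ▸ hR.mono hs.1, hR.one ▸ hR.mono hs.2⟩

theorem isCompact_fiber (r : ℝ) : IsCompact {s ∈ Icc (0 : ℝ) 1 | R s = r} :=
  isCompact_Icc.inter_right (isClosed_eq hR.continuous continuous_const)

theorem fiber_nonempty {r : ℝ} (hr : r ∈ Icc 0 h) : {s ∈ Icc (0 : ℝ) 1 | R s = r}.Nonempty := by
  have := intermediate_value_Icc zero_le_one (hR.continuous.continuousOn (s := Icc 0 1))
  rw [hR.zero, hR.one] at this
  exact this hr

theorem fiberLeft_mem {r : ℝ} (hr : r ∈ Icc 0 h) :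
    fiberLeft R r ∈ {s ∈ Icc (0 : ℝ) 1 | R s = r} :=
  (hR.isCompact_fiber r).sInf_mem (hR.fiber_nonempty hr)

theorem fiberRight_mem {r : ℝ} (hr : r ∈ Icc 0 h) :
    fiberRight R r ∈ {s ∈ Icc (0 : ℝ) 1 | R s = r} :=
  (hR.isCompact_fiber r).sSup_mem (hR.fiber_nonempty hr)

theorem apply_fiberLeft {r : ℝ} (hr : r ∈ Icc 0 h) : R (fiberLeft R r) = r :=
  (hR.fiberLeft_mem hr).2

theorem apply_fiberRight {r : ℝ} (hr : r ∈ Icc 0 h) : R (fiberRight R r) = r :=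
  (hR.fiberRight_mem hr).2

theorem fiberLeft_le {s : ℝ} (hs : s ∈ Icc (0 : ℝ) 1) : fiberLeft R (R s) ≤ s :=
  csInf_le (hR.isCompact_fiber _).bddBelow ⟨hs, rfl⟩

theorem le_fiberRight {s : ℝ} (hs : s ∈ Icc (0 : ℝ) 1) : s ≤ fiberRight R (R s) :=
  le_csSup (hR.isCompact_fiber _).bddAbove ⟨hs, rfl⟩

theorem fiberLeft_le_fiberRight {r : ℝ} (hr : r ∈ Icc 0 h) : fiberLeft R r ≤ fiberRight R r := by
  have := hR.fiberLeft_le (hR.fiberRight_mem hr).1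
  rwa [hR.apply_fiberRight hr] at this

theorem apply_le_iff {r s : ℝ} (hr : r ∈ Icc 0 h) (hs : s ∈ Icc (0 : ℝ) 1) :
    R s ≤ r ↔ s ≤ fiberRight R r := by
  refine ⟨fun hsr => ?_, fun hsr => (hR.mono hsr).trans (hR.apply_fiberRight hr).le⟩
  by_contra! hlt
  have h1 := hR.mono hlt.le
  rw [hR.apply_fiberRight hr] at h1
  have h2 := hR.le_fiberRight hs
  rw [le_antisymm hsr h1] at h2
  exact absurd h2 (not_le.2 hlt)

theorem le_apply_iff {r s : ℝ} (hr : r ∈ Icc 0 h) (hs : s ∈ Icc (0 : ℝ) 1) :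
    r ≤ R s ↔ fiberLeft R r ≤ s := by
  refine ⟨fun hsr => ?_, fun hsr => (hR.apply_fiberLeft hr).symm.le.trans (hR.mono hsr)⟩
  by_contra! hlt
  have h1 := hR.mono hlt.le
  rw [hR.apply_fiberLeft hr] at h1
  have h2 := hR.fiberLeft_le hs
  rw [le_antisymm h1 hsr] at h2
  exact absurd h2 (not_le.2 hlt)

theorem apply_eq_iff {r s : ℝ} (hr : r ∈ Icc 0 h) (hs : s ∈ Icc (0 : ℝ) 1) :
    R s = r ↔ s ∈ Icc (fiberLeft R r) (fiberRight R r) := by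
  rw [mem_Icc, ← hR.apply_le_iff hr hs, ← hR.le_apply_iff hr hs, le_antisymm_iff, and_comm]

theorem apply_of_mem_fiber {r s : ℝ} (hr : r ∈ Icc 0 h)
    (hs : s ∈ Icc (fiberLeft R r) (fiberRight R r)) : R s = r :=
  (hR.apply_eq_iff hr ⟨(hR.fiberLeft_mem hr).1.1.trans hs.1,
    hs.2.trans (hR.fiberRight_mem hr).1.2⟩).2 hs

theorem fiberRight_lt_fiberLeft {r r' : ℝ} (hr : r ∈ Icc 0 h) (hr' : r' ∈ Icc 0 h) (hlt : r < r') :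
    fiberRight R r < fiberLeft R r' := by
  by_contra! hle
  have := hR.mono hle
  rw [hR.apply_fiberLeft hr', hR.apply_fiberRight hr] at this
  linarith

theorem fiberRight_monotoneOn : MonotoneOn (fiberRight R) (Icc 0 h) := by
  intro r hr r' hr' hle
  rcases hle.eq_or_lt with rfl | hlt
  · exact le_rfl
  · exact (hR.fiberRight_lt_fiberLeft hr hr' hlt).le.trans (hR.fiberLeft_le_fiberRight hr')

theorem fiberLeft_zero : fiberLeft R 0 = 0 := by
  have h0 : (0 : ℝ) ∈ Icc 0 h := ⟨le_rfl, hR.nonneg⟩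
  refine le_antisymm ?_ (hR.fiberLeft_mem h0).1.1
  have := hR.fiberLeft_le (s := 0) (by simp)
  rwa [hR.zero] at this

theorem fiberRight_one : fiberRight R h = 1 := by
  have h0 : h ∈ Icc 0 h := ⟨hR.nonneg, le_rfl⟩
  refine le_antisymm (hR.fiberRight_mem h0).1.2 ?_
  have := hR.le_fiberRight (s := 1) (by simp)
  rwa [hR.one] at this

theorem fiberLeft_pos {r : ℝ} (hr : r ∈ Ioc 0 h) : 0 < fiberLeft R r := by
  have hr' : r ∈ Icc 0 h := ⟨hr.1.le, hr.2⟩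
  refine (hR.fiberLeft_mem hr').1.1.lt_of_ne fun h0 => ?_
  have := hR.apply_fiberLeft hr'
  rw [← h0, hR.zero] at this
  exact hr.1.ne this

/-- Fibers over times increasing to `r` accumulate at the left end of the fiber over `r`. -/
theorem tendsto_fiberRight {r : ℝ} (hr : r ∈ Ioc 0 h) :
    Tendsto (fiberRight R) (𝓝[<] r) (𝓝 (fiberLeft R r)) := by
  have hr' : r ∈ Icc 0 h := ⟨hr.1.le, hr.2⟩
  rw [tendsto_order]
  constructor
  · intro s hs
    set s' := max s 0
    have hs' : s' < fiberLeft R r := max_lt hs (hR.fiberLeft_pos hr)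
    have hs'I : s' ∈ Icc (0 : ℝ) 1 :=
      ⟨le_max_right _ _, hs'.le.trans (hR.fiberLeft_mem hr').1.2⟩
    have hlt : R s' < r := by
      by_contra! hle
      exact absurd ((hR.le_apply_iff hr' hs'I).1 hle) (not_le.2 hs')
    filter_upwards [Ioo_mem_nhdsLT hlt] with ρ hρ
    have hρI : ρ ∈ Icc 0 h := ⟨(hR.mapsTo hs'I).1.trans hρ.1.le, hρ.2.le.trans hr.2⟩
    by_contra! hle
    have := (hR.apply_fiberRight hρI).symm.le.trans (hR.mono (hle.trans (le_max_left s 0)))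
    exact absurd hρ.1 (not_lt.2 this)
  · intro s hs
    filter_upwards [Ioo_mem_nhdsLT hr.1] with ρ hρ
    exact (hR.fiberRight_lt_fiberLeft ⟨hρ.1.le, hρ.2.le.trans hr.2⟩ hr' hρ.2).trans hs

/-- Fibers over distinct times are disjoint, so only countably many have interior points. -/
theorem countable_nontrivial_fibers :
    {r ∈ Icc 0 h | fiberLeft R r < fiberRight R r}.Countable := by
  refine Set.PairwiseDisjoint.countable_of_isOpen
    (s := fun r => Ioo (fiberLeft R r) (fiberRight R r)) ?_ (fun _ _ => isOpen_Ioo)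
    fun r hr => nonempty_Ioo.2 hr.2
  intro r hr r' hr' hne
  wlog hlt : r < r' generalizing r r'
  · exact (this hr' hr hne.symm (lt_of_le_of_ne (not_lt.1 hlt) hne.symm)).symm
  exact Set.disjoint_left.2 fun s hs hs' =>
    (hs.2.trans (hR.fiberRight_lt_fiberLeft hr.1 hr'.1 hlt)).not_gt hs'.1

theorem Ioc_inter_preimage_Iic {r : ℝ} (hr : r ∈ Icc 0 h) :
    Ioc 0 1 ∩ R ⁻¹' Iic r = Ioc 0 (fiberRight R r) := by
  ext s
  constructor
  · rintro ⟨hs, hsr⟩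
    exact ⟨hs.1, (hR.apply_le_iff hr ⟨hs.1.le, hs.2⟩).1 hsr⟩
  · intro hs
    have hs1 : s ≤ 1 := hs.2.trans (hR.fiberRight_mem hr).1.2
    exact ⟨⟨hs.1, hs1⟩, (hR.apply_le_iff hr ⟨hs.1.le, hs1⟩).2 hs.2⟩

theorem Ioc_inter_preimage_Ioc {r : ℝ} (hr : r ∈ Icc 0 h) :
    Ioc 0 1 ∩ R ⁻¹' Ioc 0 r = Ioc (fiberRight R 0) (fiberRight R r) := by
  have h0 : (0 : ℝ) ∈ Icc 0 h := ⟨le_rfl, hR.nonneg⟩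
  ext s
  constructor
  · rintro ⟨hs, hsr⟩
    have hs' : s ∈ Icc (0 : ℝ) 1 := ⟨hs.1.le, hs.2⟩
    refine ⟨?_, (hR.apply_le_iff hr hs').1 hsr.2⟩
    by_contra! hle
    exact absurd hsr.1 (not_lt.2 ((hR.apply_le_iff h0 hs').2 hle))
  · intro hs
    have hs1 : s ≤ 1 := hs.2.trans (hR.fiberRight_mem hr).1.2
    have hs0 : 0 < s := (hR.fiberRight_mem h0).1.1.trans_lt hs.1
    refine ⟨⟨hs0, hs1⟩, ?_, (hR.apply_le_iff hr ⟨hs0.le, hs1⟩).2 hs.2⟩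
    by_contra! hle
    exact absurd hs.1 (not_lt.2 ((hR.apply_le_iff h0 ⟨hs0.le, hs1⟩).1 hle))

theorem Ioc_inter_preimage_singleton {r : ℝ} (hr : r ∈ Ioc 0 h) :
    Ioc 0 1 ∩ R ⁻¹' {r} = Icc (fiberLeft R r) (fiberRight R r) := by
  have hr' : r ∈ Icc 0 h := ⟨hr.1.le, hr.2⟩
  ext s
  constructor
  · rintro ⟨hs, hsr⟩
    exact (hR.apply_eq_iff hr' ⟨hs.1.le, hs.2⟩).1 hsr
  · intro hs
    exact ⟨⟨(hR.fiberLeft_pos hr).trans_le hs.1, hs.2.trans (hR.fiberRight_mem hr').1.2⟩,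
      hR.apply_of_mem_fiber hr' hs⟩

end IsTimeChange

/-! ### Images of measures under a time change -/

/-- The image under the time change `R` of the measure with density `v` on `(0, 1]`. -/
noncomputable def pushDensity (R v : ℝ → ℝ) : Measure ℝ :=
  ((volume.restrict (Ioc 0 1)).withDensity fun s => ENNReal.ofReal (v s)).map R

section
variable {h : ℝ} {R v : ℝ → ℝ} {B : ℝ}

theorem pushDensity_apply (hR : Measurable R) {A : Set ℝ} (hA : MeasurableSet A) :
    pushDensity R v A = ∫⁻ s in Ioc 0 1 ∩ R ⁻¹' A, ENNReal.ofReal (v s) := by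
  rw [pushDensity, Measure.map_apply hR hA, withDensity_apply _ (hR hA),
    Measure.restrict_restrict (hR hA), inter_comm]

theorem intervalIntegrable_of_bounded (hv : Measurable v) (hv0 : ∀ s, 0 ≤ v s)
    (hvB : ∀ s, v s ≤ B) (p q : ℝ) : IntervalIntegrable v volume p q :=
  (intervalIntegrable_const (c := B)).mono_fun hv.aestronglyMeasurable
    (.of_forall fun s => by
      simp only [Real.norm_of_nonneg (hv0 s)]; exact (hvB s).trans (le_abs_self _))

/-- The measure of a set whose preimage is an interval, up to a null set. -/
theorem pushDensity_apply_of_ae_eq (hR : Measurable R) (hv : Measurable v) (hv0 : ∀ s, 0 ≤ v s)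
    (hvB : ∀ s, v s ≤ B) {A : Set ℝ} (hA : MeasurableSet A) {p q : ℝ} (hpq : p ≤ q)
    (heq : (Ioc 0 1 ∩ R ⁻¹' A : Set ℝ) =ᵐ[volume] Ioc p q) :
    pushDensity R v A = ENNReal.ofReal (∫ s in p..q, v s) := by
  rw [pushDensity_apply hR hA, setLIntegral_congr heq, intervalIntegral.integral_of_le hpq,
    ofReal_integral_eq_lintegral_ofReal (intervalIntegrable_of_bounded hv hv0 hvB p q).1
      (.of_forall hv0)]

theorem isFiniteMeasure_pushDensity (hR : Measurable R) (hv : Measurable v) (hv0 : ∀ s, 0 ≤ v s)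
    (hvB : ∀ s, v s ≤ B) : IsFiniteMeasure (pushDensity R v) := by
  refine ⟨?_⟩
  rw [pushDensity_apply_of_ae_eq hR hv hv0 hvB MeasurableSet.univ zero_le_one
    (by rw [preimage_univ, inter_univ]; exact .rfl)]
  exact ENNReal.ofReal_lt_top

theorem pushDensity_Iic (hR : IsTimeChange h R) (hv : Measurable v) (hv0 : ∀ s, 0 ≤ v s)
    (hvB : ∀ s, v s ≤ B) {r : ℝ} (hr : r ∈ Icc 0 h) :
    pushDensity R v (Iic r) = ENNReal.ofReal (∫ s in (0 : ℝ)..fiberRight R r, v s) :=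
  pushDensity_apply_of_ae_eq hR.continuous.measurable hv hv0 hvB measurableSet_Iic
    (hR.fiberRight_mem hr).1.1 (hR.Ioc_inter_preimage_Iic hr ▸ .rfl)

theorem pushDensity_univ (hR : IsTimeChange h R) (hv : Measurable v) (hv0 : ∀ s, 0 ≤ v s)
    (hvB : ∀ s, v s ≤ B) :
    pushDensity R v univ = ENNReal.ofReal (∫ s in (0 : ℝ)..1, v s) :=
  pushDensity_apply_of_ae_eq hR.continuous.measurable hv hv0 hvB MeasurableSet.univ zero_le_one
    (by rw [preimage_univ, inter_univ]; exact .rfl)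

theorem pushDensity_singleton (hR : IsTimeChange h R) (hv : Measurable v) (hv0 : ∀ s, 0 ≤ v s)
    (hvB : ∀ s, v s ≤ B) {r : ℝ} (hr : r ∈ Icc 0 h) :
    pushDensity R v {r} = ENNReal.ofReal (∫ s in fiberLeft R r..fiberRight R r, v s) := by
  refine pushDensity_apply_of_ae_eq hR.continuous.measurable hv hv0 hvB (measurableSet_singleton r)
    (hR.fiberLeft_le_fiberRight hr) ?_
  rcases hr.1.eq_or_lt with rfl | hpos
  · have : Ioc 0 1 ∩ R ⁻¹' {0} = Ioc 0 (fiberRight R 0) := by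
      rw [← hR.Ioc_inter_preimage_Iic hr]
      ext s
      refine and_congr_right fun hs => ?_
      have := (hR.mapsTo ⟨hs.1.le, hs.2⟩).1
      simp only [mem_preimage, mem_singleton_iff, mem_Iic]
      exact ⟨fun h => h.le, fun h => le_antisymm h this⟩
    rw [this, hR.fiberLeft_zero]; exact .rfl
  · rw [hR.Ioc_inter_preimage_singleton ⟨hpos, hr.2⟩]
    exact Ioc_ae_eq_Icc.symm

theorem pushDensity_compl_Icc (hR : IsTimeChange h R) : pushDensity R v (Icc 0 h)ᶜ = 0 := by
  rw [pushDensity_apply hR.continuous.measurable measurableSet_Icc.compl]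
  have : Ioc 0 1 ∩ R ⁻¹' (Icc 0 h)ᶜ = ∅ := by
    ext s
    simp only [mem_inter_iff, mem_empty_iff_false, iff_false]
    exact fun hs => hs.2 (hR.mapsTo ⟨hs.1.1.le, hs.1.2⟩)
  rw [this, Measure.restrict_empty, lintegral_zero_measure]

/-- A finite measure on `[0, h]` is determined by its distribution function there. -/
theorem ext_of_Iic_of_carried {μ ν : Measure ℝ} [IsFiniteMeasure μ] (hh : 0 ≤ h)
    (hμ : μ (Icc 0 h)ᶜ = 0) (hν : ν (Icc 0 h)ᶜ = 0)
    (heq : ∀ r ∈ Icc 0 h, μ (Iic r) = ν (Iic r)) : μ = ν := by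
  refine Measure.ext_of_Iic μ ν fun r => ?_
  rcases lt_or_ge r 0 with hr | hr
  · have hsub : Iic r ⊆ (Icc 0 h)ᶜ := fun x hx hx' => (hx'.1.trans hx).not_gt hr
    rw [measure_mono_null hsub hμ, measure_mono_null hsub hν]
  · rcases le_or_gt r h with hrh | hrh
    · exact heq r ⟨hr, hrh⟩
    · have hu : ∀ κ : Measure ℝ, κ (Icc 0 h)ᶜ = 0 → κ (Iic r) = κ (Iic h) := by
        intro κ hκ
        refine le_antisymm ?_ (measure_mono (Iic_subset_Iic.2 hrh.le))
        have hsub : Iic r ⊆ Iic h ∪ (Icc 0 h)ᶜ := by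
          intro x _
          by_cases hx : x ≤ h
          · exact Or.inl hx
          · exact Or.inr fun hx' => hx hx'.2
        calc κ (Iic r) ≤ κ (Iic h ∪ (Icc 0 h)ᶜ) := measure_mono hsub
          _ ≤ κ (Iic h) + κ (Icc 0 h)ᶜ := measure_union_le _ _
          _ = κ (Iic h) := by rw [hκ, add_zero]
      rw [hu μ hμ, hu ν hν]
      exact heq h ⟨hh, le_rfl⟩

variable {E : Type*} [NormedAddCommGroup E] [NormedSpace ℝ E]

/-- Change of variables along a time change. An integral in the parameter splits into the part over
trivial fibers, which becomes an integral against the non-atomic part of the image measure, and the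
integrals over the other fibers, which become a sum over the atoms. -/
theorem integral_eq_continuousPart_add_tsum (hR : IsTimeChange h R) (hv : Measurable v)
    (hv0 : ∀ s, 0 ≤ v s) (hvB : ∀ s, v s ≤ B) {ρ : ℝ} (hρ : ρ ∈ Icc 0 h) {C : Set ℝ}
    (hC : C.Countable) (hCfib : ∀ r ∈ Ioc 0 ρ, r ∉ C → fiberLeft R r = fiberRight R r)
    {F H : ℝ → E} {BF : ℝ} (hFB : ∀ s, ‖F s‖ ≤ BF)
    (hFm : ∀ r ∈ Ioc 0 ρ,
      AEStronglyMeasurable F (volume.restrict (Icc (fiberLeft R r) (fiberRight R r))))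
    (hHm : AEStronglyMeasurable H ((pushDensity R v).restrict (Ioc 0 ρ \ C)))
    (hFH : ∀ s ∈ Ioc (0 : ℝ) 1, R s ∈ Ioc 0 ρ \ C → F s = H (R s)) :
    IntegrableOn (fun s => v s • F s) (Ioc (fiberRight R 0) (fiberRight R ρ)) ∧
    ∫ s in fiberRight R 0..fiberRight R ρ, v s • F s =
      ∫ r in Ioc 0 ρ, H r ∂(continuousPart (pushDensity R v)) +
      ∑' r : Ioc (0 : ℝ) ρ, ∫ s in fiberLeft R r..fiberRight R r, v s • F s := by
  have h0 : (0 : ℝ) ∈ Icc 0 h := ⟨le_rfl, hR.nonneg⟩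
  have hIoc : ∀ r ∈ Ioc 0 ρ, r ∈ Ioc 0 h := fun r hr => ⟨hr.1, hr.2.trans hρ.2⟩
  have hRm := hR.continuous.measurable
  set U := Ioc (fiberRight R 0) (fiberRight R ρ) with hU
  have hUeq : Ioc 0 1 ∩ R ⁻¹' Ioc 0 ρ = U := hR.Ioc_inter_preimage_Ioc hρ
  -- the parameter interval is the preimage of the times outside `C` plus the fibers over `C`
  set C' := C ∩ Ioc 0 ρ with hC'
  have hC'c : C'.Countable := hC.mono inter_subset_left
  have : Countable C' := hC'c.to_subtype
  have hC'm : MeasurableSet C' := hC'c.measurableSet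
  set E₀ := Ioc 0 1 ∩ R ⁻¹' (Ioc 0 ρ \ C) with hE₀
  have hIm : MeasurableSet (Ioc 0 ρ \ C) := measurableSet_Ioc.diff hC.measurableSet
  have hE₀m : MeasurableSet E₀ := measurableSet_Ioc.inter (hRm hIm)
  set P : C' → Set ℝ := fun r => Icc (fiberLeft R r) (fiberRight R r) with hP
  have hUunion : U = E₀ ∪ ⋃ r, P r := by
    rw [← hUeq]
    ext s
    constructor
    · rintro ⟨hs, hsr⟩
      by_cases hsC : R s ∈ C
      · refine Or.inr (mem_iUnion.2 ⟨⟨R s, hsC, hsr⟩, ?_⟩)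
        exact (hR.apply_eq_iff ⟨hsr.1.le, hsr.2.trans hρ.2⟩ ⟨hs.1.le, hs.2⟩).1 rfl
      · exact Or.inl ⟨hs, hsr, hsC⟩
    · rintro (⟨hs, hsr⟩ | hs)
      · exact ⟨hs, hsr.1⟩
      · obtain ⟨r, hr⟩ := mem_iUnion.1 hs
        have h1 : s ∈ Ioc 0 1 ∩ R ⁻¹' {r.1} := by
          rw [hR.Ioc_inter_preimage_singleton (hIoc r r.2.2)]; exact hr
        refine ⟨h1.1, ?_⟩
        have h2 : R s = r := h1.2
        rw [mem_preimage, h2]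
        exact r.2.2
  have hdisj : Disjoint E₀ (⋃ r, P r) := by
    rw [Set.disjoint_left]
    intro s hs hs'
    obtain ⟨r, hr⟩ := mem_iUnion.1 hs'
    have h2 : R s = r := hR.apply_of_mem_fiber ⟨r.2.2.1.le, r.2.2.2.trans hρ.2⟩ hr
    exact hs.2.2 (h2 ▸ r.2.1)
  have hPdisj : Pairwise (Function.onFun Disjoint P) := by
    intro r r' hne
    refine Set.disjoint_left.2 fun s hs hs' => hne (Subtype.ext ?_)
    rw [← hR.apply_of_mem_fiber ⟨r.2.2.1.le, r.2.2.2.trans hρ.2⟩ hs,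
      hR.apply_of_mem_fiber ⟨r'.2.2.1.le, r'.2.2.2.trans hρ.2⟩ hs']
  have hPm : ∀ r, MeasurableSet (P r) := fun r => measurableSet_Icc
  -- the part over trivial fibers
  have hrestr : ((volume.restrict (Ioc 0 1)).withDensity fun s => ENNReal.ofReal (v s)).restrict
      (R ⁻¹' (Ioc 0 ρ \ C)) =
      (volume.restrict E₀).withDensity fun s => ENNReal.ofReal (v s) := by
    rw [restrict_withDensity (hRm hIm), Measure.restrict_restrict (hRm hIm), inter_comm]
  have hmap : ((volume.restrict E₀).withDensity fun s => ENNReal.ofReal (v s)).map R =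
      (pushDensity R v).restrict (Ioc 0 ρ \ C) := by
    rw [pushDensity, Measure.restrict_map hRm hIm, hrestr]
  have hHR : AEStronglyMeasurable (fun s => v s • H (R s)) (volume.restrict E₀) := by
    rw [← hmap] at hHm
    have h1 := hHm.comp_measurable hRm
    have h1 := (aestronglyMeasurable_withDensity_iff hv.real_toNNReal).1 h1
    refine h1.congr (.of_forall fun s => ?_)
    simp only [Function.comp]
    rw [Real.coe_toNNReal _ (hv0 s)]
  have hE₀congr : EqOn (fun s => v s • F s) (fun s => v s • H (R s)) E₀ := fun s hs => by
    simp only [hFH s hs.1 hs.2]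
  have hFE₀ : AEStronglyMeasurable (fun s => v s • F s) (volume.restrict E₀) :=
    hHR.congr ((ae_restrict_iff' hE₀m).2 (.of_forall fun s hs => (hE₀congr hs).symm))
  have hFU : AEStronglyMeasurable (fun s => v s • F s) (volume.restrict U) := by
    rw [hUunion, aestronglyMeasurable_union_iff, aestronglyMeasurable_iUnion_iff]
    exact ⟨hFE₀, fun r => hv.aestronglyMeasurable.smul (hFm r r.2.2)⟩
  have hint : IntegrableOn (fun s => v s • F s) U := by
    refine IntegrableOn.of_bound (by simp [hU]) hFU (B * BF) (.of_forall fun s => ?_)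
    rw [norm_smul, Real.norm_of_nonneg (hv0 s)]
    exact mul_le_mul (hvB s) (hFB s) (norm_nonneg _) ((hv0 s).trans (hvB s))
  refine ⟨hint, ?_⟩
  have hle : fiberRight R 0 ≤ fiberRight R ρ := hR.fiberRight_monotoneOn h0 hρ hρ.1
  have hintU := hint
  rw [hUunion] at hintU
  have e1 : ∫ s in E₀, v s • F s = ∫ r in Ioc 0 ρ, H r ∂(continuousPart (pushDensity R v)) := by
    rw [setIntegral_congr_fun hE₀m hE₀congr, continuousPart,
      Measure.restrict_restrict measurableSet_Ioc]
    have hae : (Ioc 0 ρ \ C : Set ℝ) =ᵐ[pushDensity R v]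
        (Ioc 0 ρ ∩ {t | pushDensity R v {t} = 0} : Set ℝ) := by
      have hnull : pushDensity R v (C ∩ {t | pushDensity R v {t} = 0}) = 0 := by
        rw [← biUnion_of_singleton (C ∩ {t | pushDensity R v {t} = 0}),
          measure_biUnion_null_iff (hC.mono inter_subset_left)]
        exact fun t ht => ht.2
      rw [ae_eq_set]
      constructor
      · convert measure_empty (μ := pushDensity R v)
        rw [sdiff_eq_empty]
        rintro t ⟨ht, htC⟩
        refine ⟨ht, ?_⟩
        change pushDensity R v {t} = 0
        rw [pushDensity_singleton hR hv hv0 hvB ⟨ht.1.le, ht.2.trans hρ.2⟩, hCfib t ht htC]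
        simp
      · refine measure_mono_null ?_ hnull
        rintro t ⟨ht, htC⟩
        refine ⟨?_, ht.2⟩
        by_contra hc
        exact htC ⟨ht.1, hc⟩
    rw [← setIntegral_congr_set hae, ← hmap,
      integral_map hRm.aemeasurable (by rw [hmap]; exact hHm),
      integral_withDensity_eq_integral_toReal_smul hv.ennreal_ofReal
        (.of_forall fun _ => ENNReal.ofReal_lt_top)]
    refine integral_congr_ae (.of_forall fun s => ?_)
    simp only [ENNReal.toReal_ofReal (hv0 s)]
  have e2 : ∫ s in ⋃ r, P r, v s • F s =
      ∑' r : Ioc (0 : ℝ) ρ, ∫ s in fiberLeft R r..fiberRight R r, v s • F s := by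
    rw [integral_iUnion hPm hPdisj (hintU.mono_set subset_union_right)]
    set φ : ℝ → E := fun r => ∫ s in fiberLeft R r..fiberRight R r, v s • F s with hφ
    have e3 : ∀ r : C', ∫ s in P r, v s • F s = φ r := fun r => by
      simp only [hP, hφ]
      rw [integral_Icc_eq_integral_Ioc, intervalIntegral.integral_of_le
        (hR.fiberLeft_le_fiberRight ⟨r.2.2.1.le, r.2.2.2.trans hρ.2⟩)]
    simp_rw [e3]
    rw [tsum_subtype C' φ, tsum_subtype (Ioc 0 ρ) φ]
    congr 1
    ext r
    by_cases hr : r ∈ Ioc 0 ρ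
    · by_cases hrC : r ∈ C
      · rw [indicator_of_mem (show r ∈ C' from ⟨hrC, hr⟩), indicator_of_mem hr]
      · rw [indicator_of_notMem (fun h => hrC h.1), indicator_of_mem hr]
        simp only [hφ]
        rw [hCfib r hr hrC, intervalIntegral.integral_same]
    · rw [indicator_of_notMem (fun h => hr h.2), indicator_of_notMem hr]
  rw [intervalIntegral.integral_of_le hle, ← hU, hUunion,
    setIntegral_union hdisj (MeasurableSet.iUnion hPm) (hintU.mono_set subset_union_left)
    (hintU.mono_set subset_union_right), e1, e2]

end

/-! ### Bounded variation and the non-atomic part -/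

theorem eVariationOn_le_of_edist_le {E F : Type*} [PseudoEMetricSpace E] [PseudoEMetricSpace F]
    {x : ℝ → E} {y : ℝ → F} {S : Set ℝ}
    (hxy : ∀ s ∈ S, ∀ t ∈ S, s ≤ t → edist (x t) (x s) ≤ edist (y t) (y s)) :
    eVariationOn x S ≤ eVariationOn y S :=
  iSup_mono fun p => Finset.sum_le_sum fun i _ =>
    hxy _ (p.2.2.2 i) _ (p.2.2.2 (i + 1)) (p.2.2.1 (Nat.le_succ i))

/-- A function that is Lipschitz in a bounded monotone parameter inside an interval has bounded
variation on the closed interval, whatever its values at the end points. -/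
theorem boundedVariationOn_Icc_of_comp_monotoneOn {E : Type*} [NormedAddCommGroup E]
    {x y : ℝ → E} {β : ℝ → ℝ} {p q : ℝ} {L : NNReal} (hy : LipschitzOnWith L y (Icc 0 1))
    (hβ : MonotoneOn β (Ioo p q)) (hmaps : MapsTo β (Ioo p q) (Icc 0 1))
    (hx : ∀ t ∈ Ioo p q, x t = y (β t)) : BoundedVariationOn x (Icc p q) := by
  obtain ⟨A, hA⟩ := isCompact_Icc.exists_bound_of_continuousOn hy.continuousOn
  have hA0 : 0 ≤ A := (norm_nonneg _).trans (hA 0 (by simp))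
  -- a real function whose increments dominate those of `x`, with large enough end jumps
  set G : ℝ → ℝ := fun t => if t ≤ p then 0 else if t < q then ‖x p‖ + A + L * β t else
    ‖x p‖ + A + L + (‖x q‖ + A) with hG
  have key : ∀ s ∈ Icc p q, ∀ t ∈ Icc p q, s ≤ t → dist (x t) (x s) ≤ G t - G s := by
    intro s hs t ht hst
    have hb : ∀ t ∈ Ioo p q, 0 ≤ L * β t ∧ L * β t ≤ L ∧ ‖x t‖ ≤ A := fun t ht =>
      ⟨mul_nonneg L.2 (hmaps ht).1, mul_le_of_le_one_right L.2 (hmaps ht).2,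
        (hx t ht) ▸ hA _ (hmaps ht)⟩
    have hL : (0 : ℝ) ≤ L := L.2
    rw [dist_eq_norm]
    have htri := norm_sub_le (x t) (x s)
    have hxp := norm_nonneg (x p)
    have hxq := norm_nonneg (x q)
    rcases hs.1.eq_or_lt with rfl | hps
    · rcases hst.eq_or_lt with rfl | hlt
      · simp
      · rcases ht.2.lt_or_eq with htq | rfl
        · have := hb t ⟨hlt, htq⟩
          simp only [hG, le_refl, if_true, not_le.2 hlt, if_false, htq]
          linarith [this.1, this.2.2]
        · simp only [hG, le_refl, if_true, not_le.2 hlt, if_false, lt_irrefl]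
          linarith
    · have hpt := hps.trans_le hst
      rcases ht.2.lt_or_eq with htq | rfl
      · have hsq := hst.trans_lt htq
        simp only [hG, not_le.2 hps, not_le.2 hpt, if_false, htq, hsq, if_true]
        rw [hx t ⟨hpt, htq⟩, hx s ⟨hps, hsq⟩, ← dist_eq_norm]
        refine (hy.dist_le_mul _ (hmaps ⟨hpt, htq⟩) _ (hmaps ⟨hps, hsq⟩)).trans ?_
        rw [Real.dist_eq, abs_of_nonneg (sub_nonneg.2 (hβ ⟨hps, hsq⟩ ⟨hpt, htq⟩ hst))]
        linarith
      · rcases hs.2.lt_or_eq with hsq | rfl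
        · have := hb s ⟨hps, hsq⟩
          simp only [hG, not_le.2 hps, not_le.2 hpt, if_false, hsq, lt_irrefl, if_true]
          linarith [this.2.1, this.2.2]
        · simp
  have hGmono : MonotoneOn G (Icc p q) := fun s hs t ht hst =>
    sub_nonneg.1 (dist_nonneg.trans (key s hs t ht hst))
  rcases le_or_gt p q with hpq | hpq
  · refine ne_top_of_le_ne_top ?_ (eVariationOn_le_of_edist_le (y := G) fun s hs t ht hst => ?_)
    · have := (hGmono.eVariationOn_eq (left_mem_Icc.2 hpq) (right_mem_Icc.2 hpq)).le
      rw [inter_self] at this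
      exact ne_top_of_le_ne_top ENNReal.ofReal_ne_top this
    · rw [edist_dist, edist_dist]
      refine ENNReal.ofReal_le_ofReal ((key s hs t ht hst).trans ?_)
      rw [Real.dist_eq]
      exact le_abs_self _
  · rw [Icc_eq_empty (not_le.2 hpq)]
    exact BoundedVariationOn.of_subsingleton subsingleton_empty

theorem continuousPart_volume_restrict (A : Set ℝ) :
    continuousPart (volume.restrict A) = volume.restrict A := by
  have : {t : ℝ | volume.restrict A {t} = 0} = univ :=
    eq_univ_of_forall fun t =>
      le_antisymm ((Measure.restrict_apply_le _ _).trans (by simp)) zero_le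
  rw [continuousPart, this, Measure.restrict_univ]

/-- Restriction to the non-atomic part commutes with translation. -/
theorem setIntegral_continuousPart_shift {E : Type*} [NormedAddCommGroup E] [NormedSpace ℝ E]
    {μ m : Measure ℝ} {c h ρ : ℝ}
    (hμ : μ.restrict (Ioo c (c + h)) = (m.restrict (Ioo 0 h)).map (· + c))
    (hρ : ρ ∈ Ioo 0 h) (G : ℝ → E) :
    ∫ t in Icc c (c + ρ), G t ∂(continuousPart μ) =
      ∫ r in Ioc 0 ρ, G (r + c) ∂(continuousPart m) := by
  have hemb : MeasurableEmbedding fun r : ℝ => r + c := measurableEmbedding_addRight c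
  have hpre : (fun r : ℝ => r + c) ⁻¹' Ioo c (c + h) = Ioo 0 h := by
    ext r; simp only [mem_preimage, mem_Ioo]; constructor <;> rintro ⟨h1, h2⟩ <;> constructor <;>
      linarith
  have hatom : ∀ r ∈ Ioo 0 h, μ {r + c} = m {r} := by
    intro r hr
    have hr' : r + c ∈ Ioo c (c + h) := by rw [← hpre] at hr; exact hr
    have h1 : μ {r + c} = μ.restrict (Ioo c (c + h)) {r + c} := by
      rw [Measure.restrict_apply (measurableSet_singleton _),
        inter_eq_left.2 (singleton_subset_iff.2 hr')]
    rw [h1, hμ, hemb.map_apply, Measure.restrict_apply' measurableSet_Ioo]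
    congr 1
    ext y
    simp only [mem_inter_iff, mem_preimage, mem_singleton_iff, add_left_inj]
    exact ⟨fun h => h.1, fun h => ⟨h, h ▸ hr⟩⟩
  set S := Ioc c (c + ρ) ∩ {t | μ {t} = 0} with hS
  have hSsub : S ⊆ Ioo c (c + h) := fun t ht => ⟨ht.1.1, ht.1.2.trans_lt (by linarith [hρ.2])⟩
  have hSpre : (fun r : ℝ => r + c) ⁻¹' S = Ioc 0 ρ ∩ {t | m {t} = 0} := by
    ext r
    have hI : r + c ∈ Ioc c (c + ρ) ↔ r ∈ Ioc 0 ρ := by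
      simp only [mem_Ioc]; constructor <;> rintro ⟨h1, h2⟩ <;> constructor <;> linarith
    simp only [hS, mem_preimage, mem_inter_iff, hI]
    refine and_congr_right fun hr => ?_
    change μ {r + c} = 0 ↔ m {r} = 0
    rw [hatom r ⟨hr.1, hr.2.trans_lt hρ.2⟩]
  -- `c` is either an atom, hence excluded, or null
  have h1 : (Icc c (c + ρ) ∩ {t | μ {t} = 0} : Set ℝ) =ᵐ[μ] S := by
    rw [ae_eq_set]
    constructor
    · by_cases hc : μ {c} = 0
      · refine measure_mono_null (fun t ht => ?_) hc
        by_contra hne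
        exact ht.2 ⟨⟨lt_of_le_of_ne ht.1.1.1 (Ne.symm hne), ht.1.1.2⟩, ht.1.2⟩
      · convert measure_empty (μ := μ)
        rw [sdiff_eq_empty]
        intro t ht
        refine ⟨⟨lt_of_le_of_ne ht.1.1 ?_, ht.1.2⟩, ht.2⟩
        rintro rfl
        exact hc ht.2
    · convert measure_empty (μ := μ)
      rw [sdiff_eq_empty]
      exact fun t ht => ⟨⟨ht.1.1.le, ht.1.2⟩, ht.2⟩
  rw [continuousPart, continuousPart, Measure.restrict_restrict measurableSet_Icc,
    Measure.restrict_restrict measurableSet_Ioc, setIntegral_congr_set h1,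
    ← Measure.restrict_restrict_of_subset hSsub, hμ, hemb.restrict_map, hSpre,
    hemb.integral_map, Measure.restrict_restrict_of_subset]
  exact fun r hr => ⟨hr.1.1, hr.1.2.trans_lt hρ.2⟩

/-! ### The measures of a completed control -/

section
variable {N : ℕ} {h K : ℝ} {W : ℕ → ℝ → ℝ} (hW : IsCompletedControl N h K W)
include hW

theorem IsCompletedControl.deriv_time_eq_zero {r s : ℝ} (hr : r ∈ Icc 0 h)
    (hs : s ∈ Ioo (fiberLeft (W 0) r) (fiberRight (W 0) r)) : deriv (W 0) s = 0 := by
  have : W 0 =ᶠ[𝓝 s] fun _ => r := by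
    filter_upwards [Ioo_mem_nhds hs.1 hs.2] with t ht
    exact hW.isTimeChange.apply_of_mem_fiber hr ⟨ht.1.le, ht.2.le⟩
  rw [this.deriv_eq, deriv_const]

/-- The derivative of the time component is carried to Lebesgue measure. -/
theorem IsCompletedControl.pushDensity_time :
    pushDensity (W 0) (deriv (W 0)) = volume.restrict (Icc 0 h) := by
  have hR := hW.isTimeChange
  have hB : ∀ s, deriv (W 0) s ≤ h + K := fun s => (le_abs_self _).trans (hW.norm_deriv_le 0 s)
  have := isFiniteMeasure_pushDensity hR.continuous.measurable (measurable_deriv (W 0))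
    (hW.deriv_nonneg 0) hB
  refine ext_of_Iic_of_carried hR.nonneg (pushDensity_compl_Icc hR)
    (by rw [Measure.restrict_apply measurableSet_Icc.compl]; simp) fun r hr => ?_
  rw [pushDensity_Iic hR (measurable_deriv (W 0)) (hW.deriv_nonneg 0) hB hr, hW.integral_deriv,
    hW.zero, hR.apply_fiberRight hr, Measure.restrict_apply measurableSet_Iic]
  have : Iic r ∩ Icc 0 h = Icc 0 r := by
    ext x; exact ⟨fun hx => ⟨hx.2.1, hx.1⟩, fun hx => ⟨hx.2, hx.1, hx.2.trans hr.2⟩⟩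
  rw [this, Real.volume_Icc]

theorem IsCompletedControl.isFiniteMeasure_pushDensity (i : ℕ) :
    IsFiniteMeasure (pushDensity (W 0) (deriv (W i))) :=
  _root_.isFiniteMeasure_pushDensity (hW.continuous 0).measurable (measurable_deriv (W i))
    (hW.deriv_nonneg i) fun s => (le_abs_self _).trans (hW.norm_deriv_le i s)

theorem IsCompletedControl.pushDensity_singleton (i : ℕ) {r : ℝ} (hr : r ∈ Icc 0 h) :
    (pushDensity (W 0) (deriv (W i))).real {r} =
      W i (fiberRight (W 0) r) - W i (fiberLeft (W 0) r) := by
  rw [Measure.real, _root_.pushDensity_singleton hW.isTimeChange (measurable_deriv (W i))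
    (hW.deriv_nonneg i) (fun s => (le_abs_self _).trans (hW.norm_deriv_le i s)) hr,
    hW.integral_deriv, ENNReal.toReal_ofReal]
  exact sub_nonneg.2 (hW.mono i (hW.isTimeChange.fiberLeft_le_fiberRight hr))

theorem IsCompletedControl.pushDensity_univ (i : ℕ) :
    (pushDensity (W 0) (deriv (W i))).real univ = W i 1 := by
  rw [Measure.real, _root_.pushDensity_univ hW.isTimeChange (measurable_deriv (W i))
    (hW.deriv_nonneg i) (fun s => (le_abs_self _).trans (hW.norm_deriv_le i s)),
    hW.integral_deriv, hW.zero, sub_zero, ENNReal.toReal_ofReal (hW.nonneg_one i)]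

theorem IsCompletedControl.pushDensity_Iic (i : ℕ) {r : ℝ} (hr : r ∈ Icc 0 h) :
    pushDensity (W 0) (deriv (W i)) (Iic r) = ENNReal.ofReal (W i (fiberRight (W 0) r)) := by
  rw [_root_.pushDensity_Iic hW.isTimeChange (measurable_deriv (W i))
    (hW.deriv_nonneg i) (fun s => (le_abs_self _).trans (hW.norm_deriv_le i s)) hr,
    hW.integral_deriv, hW.zero, sub_zero]

/-- The velocity of the graph completion, integrated over the parameters that correspond to the
times in `(0, ρ]`, in terms of the original time: drift, non-atomic part, and jumps. -/
theorem IsCompletedControl.integral_velocity_eq {E : Type*} [NormedAddCommGroup E]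
    [NormedSpace ℝ E] (i : ℕ) {ρ : ℝ} (hρ : ρ ∈ Icc 0 h) {C : Set ℝ}
    (hC : C.Countable)
    (hCfib : ∀ r ∈ Ioc 0 ρ, r ∉ C → fiberLeft (W 0) r = fiberRight (W 0) r)
    {Ff Fg Hf Hg : ℝ → E} {M : ℝ} (hFf : ∀ s, ‖Ff s‖ ≤ M) (hFg : ∀ s, ‖Fg s‖ ≤ M)
    (hFfm : ∀ r ∈ Ioc 0 ρ, AEStronglyMeasurable Ff
      (volume.restrict (Icc (fiberLeft (W 0) r) (fiberRight (W 0) r))))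
    (hFgm : ∀ r ∈ Ioc 0 ρ, AEStronglyMeasurable Fg
      (volume.restrict (Icc (fiberLeft (W 0) r) (fiberRight (W 0) r))))
    (hHf : ∀ κ : Measure ℝ, AEStronglyMeasurable Hf (κ.restrict (Ioc 0 ρ \ C)))
    (hHg : ∀ κ : Measure ℝ, AEStronglyMeasurable Hg (κ.restrict (Ioc 0 ρ \ C)))
    (hf : ∀ s ∈ Ioc (0 : ℝ) 1, W 0 s ∈ Ioc 0 ρ \ C → Ff s = Hf (W 0 s))
    (hg : ∀ s ∈ Ioc (0 : ℝ) 1, W 0 s ∈ Ioc 0 ρ \ C → Fg s = Hg (W 0 s)) :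
    IntegrableOn (fun s => deriv (W 0) s • Ff s + deriv (W i) s • Fg s)
        (Ioc (fiberRight (W 0) 0) (fiberRight (W 0) ρ)) ∧
      ∫ s in fiberRight (W 0) 0..fiberRight (W 0) ρ, (deriv (W 0) s • Ff s + deriv (W i) s • Fg s) =
      (∫ r in (0 : ℝ)..ρ, Hf r) +
      (∫ r in Ioc 0 ρ, Hg r ∂(continuousPart (pushDensity (W 0) (deriv (W i))))) +
      ∑' r : Ioc (0 : ℝ) ρ, ∫ s in fiberLeft (W 0) r..fiberRight (W 0) r,
        deriv (W i) s • Fg s := by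
  have hR := hW.isTimeChange
  have h0 : (0 : ℝ) ∈ Icc 0 h := ⟨le_rfl, hR.nonneg⟩
  have hB : ∀ j s, deriv (W j) s ≤ h + K := fun j s =>
    (le_abs_self _).trans (hW.norm_deriv_le j s)
  obtain ⟨hi1, he1⟩ := integral_eq_continuousPart_add_tsum hR (measurable_deriv (W 0))
    (hW.deriv_nonneg 0) (hB 0) hρ hC hCfib hFf hFfm (hHf _) hf
  obtain ⟨hi2, he2⟩ := integral_eq_continuousPart_add_tsum hR (measurable_deriv (W i))
    (hW.deriv_nonneg i) (hB i) hρ hC hCfib hFg hFgm (hHg _) hg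
  have hle := hR.fiberRight_monotoneOn h0 hρ hρ.1
  have hsub : Ioc 0 ρ ⊆ Icc 0 h := fun r hr => ⟨hr.1.le, hr.2.trans hρ.2⟩
  refine ⟨hi1.add hi2, ?_⟩
  rw [intervalIntegral.integral_add ((intervalIntegrable_iff_integrableOn_Ioc_of_le hle).2 hi1)
    ((intervalIntegrable_iff_integrableOn_Ioc_of_le hle).2 hi2), he1, he2]
  have hz : ∀ r : Ioc (0 : ℝ) ρ, ∫ s in fiberLeft (W 0) r..fiberRight (W 0) r,
      deriv (W 0) s • Ff s = 0 := fun r => by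
    have hrI : (r : ℝ) ∈ Icc 0 h := ⟨r.2.1.le, r.2.2.trans hρ.2⟩
    refine intervalIntegral.integral_zero_ae ?_
    have hne : ∀ᵐ s : ℝ, s ≠ fiberRight (W 0) r := by simp [ae_iff, measure_singleton]
    filter_upwards [hne] with s hs hs'
    rw [uIoc_of_le (hR.fiberLeft_le_fiberRight hrI)] at hs'
    rw [hW.deriv_time_eq_zero hrI ⟨hs'.1, lt_of_le_of_ne hs'.2 hs⟩, zero_smul]
  simp only [hz, tsum_zero, add_zero]
  rw [hW.pushDensity_time, continuousPart_volume_restrict,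
    Measure.restrict_restrict measurableSet_Ioc, inter_eq_left.2 hsub,
    intervalIntegral.integral_of_le hρ.1]
  abel
end

/-! ### The impulsive control of a completed control -/

noncomputable section
namespace DelaySystem
variable {n : ℕ} (D : DelaySystem n)

/-- The state trajectory of a completed trajectory: at time `i h + r` it is the value of the
`(i + 1)`-st component at the right end of the fiber over `r`. -/
def stateOf (R : ℝ → ℝ) (z : ℕ → ℝ → EuclideanSpace ℝ (Fin n)) (t : ℝ) :
    EuclideanSpace ℝ (Fin n) :=
  if t < 0 then D.ξ₀ else if t = 0 then D.x₀ else if D.T ≤ t then z D.N 1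
  else z (⌊t / D.h⌋₊ + 1) (fiberRight R (t - ⌊t / D.h⌋₊ * D.h))

/-- The measure of a completed control, assembled from its components. -/
def measureOf (W : ℕ → ℝ → ℝ) : Measure ℝ :=
  ∑ i ∈ Finset.range D.N, (pushDensity (W 0) (deriv (W (i + 1)))).map (· + (i : ℝ) * D.h)

/-- The controls attached to the atoms: the velocity of a completed control on the fiber over `r`,
which is rescaled to `[0, 1]`. -/
def atomControl (W : ℕ → ℝ → ℝ) (r : ℝ) (i : ℕ) (s : ℝ) : ℝ :=
  if i = 0 then 0 else (fiberRight (W 0) r - fiberLeft (W 0) r) *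
    deriv (W i) (fiberLeft (W 0) r + (fiberRight (W 0) r - fiberLeft (W 0) r) * s)

/-- The attached functions: a completed trajectory on the fiber over `r`, rescaled to `[0, 1]`. -/
def atomState (R : ℝ → ℝ) (z : ℕ → ℝ → EuclideanSpace ℝ (Fin n)) (r : ℝ) (i : ℕ) (s : ℝ) :
    EuclideanSpace ℝ (Fin n) :=
  if i = 0 then (if r = D.h ∧ s = 1 then D.x₀ else D.ξ₀)
  else z i (fiberLeft R r + (fiberRight R r - fiberLeft R r) * s)

variable {D} {K M : ℝ} {W : ℕ → ℝ → ℝ} {z : ℕ → ℝ → EuclideanSpace ℝ (Fin n)}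

theorem stateOf_of_neg {R : ℝ → ℝ} {t : ℝ} (ht : t < 0) : D.stateOf R z t = D.ξ₀ := by
  simp [stateOf, ht]

theorem stateOf_zero {R : ℝ → ℝ} : D.stateOf R z 0 = D.x₀ := by
  simp [stateOf]

theorem stateOf_T {R : ℝ → ℝ} (hT : 0 < D.T) : D.stateOf R z D.T = z D.N 1 := by
  simp [stateOf, hT.not_gt, hT.ne']

theorem stateOf_add {R : ℝ → ℝ} (hh : 0 < D.h) {i : ℕ} (hi : i < D.N) {r : ℝ}
    (hr : r ∈ Ico 0 D.h) (h0 : 0 < r + i * D.h) :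
    D.stateOf R z (r + i * D.h) = z (i + 1) (fiberRight R r) := by
  have hfl : ⌊(r + i * D.h) / D.h⌋₊ = i := by
    rw [Nat.floor_eq_iff (by positivity), le_div_iff₀ hh, div_lt_iff₀ hh]
    constructor <;> nlinarith [hr.1, hr.2]
  have hT : ¬ D.T ≤ r + i * D.h := by
    rw [not_le, T]
    have : (i : ℝ) + 1 ≤ D.N := by exact_mod_cast hi
    nlinarith [hr.2]
  rw [stateOf, if_neg h0.not_gt, if_neg h0.ne', if_neg hT, hfl, add_sub_cancel_right]

theorem stateOf_delay (hz : D.IsCompletedTraj W z) (hh : 0 < D.h) {i : ℕ} (hi : i < D.N) {r : ℝ}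
    (hr : r ∈ Ioo 0 D.h) :
    D.stateOf (W 0) z (r + i * D.h - D.h) = z i (fiberRight (W 0) r) := by
  rcases i with _ | i
  · rw [hz.history, stateOf_of_neg]
    simpa using hr.2
  · have : r + ((i + 1 : ℕ) : ℝ) * D.h - D.h = r + i * D.h := by push_cast; ring
    rw [this, stateOf_add hh (by omega) ⟨hr.1.le, hr.2⟩]
    have := hr.1
    positivity

theorem measurable_atomControl (r : ℝ) (i : ℕ) : Measurable (atomControl W r i) := by
  rcases eq_or_ne i 0 with rfl | hi
  · have : atomControl W r 0 = fun _ => 0 := by ext; simp [atomControl]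
    rw [this]; exact measurable_const
  · have : atomControl W r i = fun s => (fiberRight (W 0) r - fiberLeft (W 0) r) *
        deriv (W i) (fiberLeft (W 0) r + (fiberRight (W 0) r - fiberLeft (W 0) r) * s) := by
      ext; simp [atomControl, hi]
    rw [this]
    exact ((measurable_deriv (W i)).comp (by fun_prop)).const_mul _

theorem measureOf_apply {A : Set ℝ} (hA : MeasurableSet A) : D.measureOf W A =
    ∑ i ∈ Finset.range D.N,
      pushDensity (W 0) (deriv (W (i + 1))) ((· + (i : ℝ) * D.h) ⁻¹' A) := by
  rw [measureOf, Measure.finsetSum_apply]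
  exact Finset.sum_congr rfl fun i _ => Measure.map_apply (measurable_add_const _) hA

section control
variable (hW : IsCompletedControl D.N D.h K W)
include hW

theorem intervalIntegral_atomControl {r : ℝ} {i : ℕ} (hi : i ≠ 0) :
    ∫ s in (0 : ℝ)..1, atomControl W r i s =
      W i (fiberRight (W 0) r) - W i (fiberLeft (W 0) r) := by
  simp only [atomControl, if_neg hi]
  rw [intervalIntegral.integral_const_mul, intervalIntegral.mul_integral_comp_add_mul,
    hW.integral_deriv]
  simp

theorem atomControl_nonneg {r : ℝ} (hr : r ∈ Icc 0 D.h) (i : ℕ) (s : ℝ) :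
    0 ≤ atomControl W r i s := by
  unfold atomControl
  split_ifs
  · exact le_rfl
  · exact mul_nonneg (sub_nonneg.2 (hW.isTimeChange.fiberLeft_le_fiberRight hr))
      (hW.deriv_nonneg _ _)

theorem intervalIntegrable_atomControl {r : ℝ} (hr : r ∈ Icc 0 D.h) (i : ℕ) :
    IntervalIntegrable (atomControl W r i) volume 0 1 := by
  refine (intervalIntegrable_const (c := 1 * (D.h + K))).mono_fun
    (measurable_atomControl r i).aestronglyMeasurable (.of_forall fun s => ?_)
  refine le_trans ?_ (le_abs_self _)
  unfold atomControl
  split_ifs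
  · simpa using hW.speed_nonneg
  · have h1 := hW.isTimeChange.fiberLeft_le_fiberRight hr
    have h2 := (hW.isTimeChange.fiberLeft_mem hr).1.1
    have h3 := (hW.isTimeChange.fiberRight_mem hr).1.2
    beta_reduce
    rw [norm_mul]
    refine mul_le_mul ?_ (hW.norm_deriv_le _ _) (norm_nonneg _) zero_le_one
    rw [Real.norm_of_nonneg (sub_nonneg.2 h1)]
    linarith

/-- On a fiber time stands still, so the parameter is proportional to the spent mass alone. -/
theorem ae_sum_atomControl {r : ℝ} (hr : r ∈ Icc 0 D.h) :
    ∀ᵐ s ∂(volume.restrict (Icc (0 : ℝ) 1)), ∑ i ∈ Finset.Icc 1 D.N, atomControl W r i s =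
      ∑ i ∈ Finset.Icc 1 D.N, ∫ s' in (0 : ℝ)..1, atomControl W r i s' := by
  set a := fiberLeft (W 0) r with ha
  set b := fiberRight (W 0) r with hb
  have hab : a ≤ b := hW.isTimeChange.fiberLeft_le_fiberRight hr
  have hW0 : ∀ s ∈ Icc a b, W 0 s = r := fun s hs => hW.isTimeChange.apply_of_mem_fiber hr hs
  have hIcc : ∀ φ : ℕ → ℝ, ∑ i ∈ Finset.Icc 1 D.N, φ i = ∑ i ∈ Finset.range D.N, φ (i + 1) :=
    fun φ => by
      rw [Finset.range_eq_Ico, Finset.sum_Ico_add' φ 0 D.N 1]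
      rfl
  have hint : ∑ i ∈ Finset.Icc 1 D.N, ∫ s' in (0 : ℝ)..1, atomControl W r i s' =
      (b - a) * ∑ i ∈ Finset.range (D.N + 1), W i 1 := by
    rw [hIcc]
    simp_rw [intervalIntegral_atomControl hW (Nat.succ_ne_zero _)]
    rw [Finset.sum_sub_distrib]
    have e1 := hW.sum_eq b
    have e2 := hW.sum_eq a
    rw [Finset.sum_range_succ', hW0 b ⟨hab, le_rfl⟩] at e1
    rw [Finset.sum_range_succ', hW0 a ⟨le_rfl, hab⟩] at e2
    linarith
  rw [hint]
  rcases hab.eq_or_lt with hab' | hlt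
  · refine .of_forall fun s => ?_
    rw [hIcc]
    simp [atomControl, ← ha, ← hb, hab']
  · have h0 : ∀ᵐ s : ℝ, s ≠ 0 := by simp [ae_iff, measure_singleton]
    have h1 : ∀ᵐ s : ℝ, s ≠ 1 := by simp [ae_iff, measure_singleton]
    rw [ae_restrict_iff' measurableSet_Icc]
    filter_upwards [ae_comp_affine (a := a) (sub_pos.2 hlt).ne' hW.ae_sum_deriv, h0, h1]
      with s hs hs0 hs1 hmem
    have hpos : 0 < s := lt_of_le_of_ne hmem.1 (Ne.symm hs0)
    have hlt1 : s < 1 := lt_of_le_of_ne hmem.2 hs1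
    have hin : a + (b - a) * s ∈ Ioo a b := by
      constructor <;> nlinarith
    rw [hW.deriv_time_eq_zero hr hin, zero_add] at hs
    rw [hIcc, ← hs, Finset.mul_sum]
    simp [atomControl, ← ha, ← hb]

theorem measureOf_restrict_Ioo (hh : 0 < D.h) {i : ℕ} (hi : i < D.N) :
    (D.measureOf W).restrict (Ioo (i * D.h) (i * D.h + D.h)) =
      ((pushDensity (W 0) (deriv (W (i + 1)))).restrict (Ioo 0 D.h)).map (· + (i : ℝ) * D.h) := by
  ext A hA
  rw [Measure.restrict_apply hA, measureOf_apply (hA.inter measurableSet_Ioo),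
    Finset.sum_eq_single i]
  · rw [Measure.map_apply (measurable_add_const _) hA,
      Measure.restrict_apply (measurable_add_const _ hA)]
    congr 1
    ext r
    simp only [mem_preimage, mem_inter_iff, mem_Ioo]
    refine and_congr_right fun _ => ?_
    constructor <;> rintro ⟨h1, h2⟩ <;> constructor <;> linarith
  · intro j _ hji
    refine measure_mono_null ?_ (pushDensity_compl_Icc hW.isTimeChange)
    rintro r ⟨-, hr1, hr2⟩ ⟨h1, h2⟩
    rcases lt_or_gt_of_ne hji with hlt | hlt
    · have : (j : ℝ) + 1 ≤ i := by exact_mod_cast hlt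
      nlinarith
    · have : (i : ℝ) + 1 ≤ j := by exact_mod_cast hlt
      nlinarith
  · exact fun hni => absurd (Finset.mem_range.2 hi) hni

theorem measureOf_real_univ :
    (D.measureOf W).real univ = ∑ i ∈ Finset.range D.N, W (i + 1) 1 := by
  rw [Measure.real, measureOf_apply MeasurableSet.univ, ENNReal.toReal_sum]
  · exact Finset.sum_congr rfl fun i _ => hW.pushDensity_univ (i + 1)
  · intro i _
    have := hW.isFiniteMeasure_pushDensity (i + 1)
    exact measure_ne_top _ _

theorem isFiniteMeasure_measureOf : IsFiniteMeasure (D.measureOf W) := by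
  refine ⟨?_⟩
  rw [measureOf_apply MeasurableSet.univ, ENNReal.sum_lt_top]
  intro i _
  have := hW.isFiniteMeasure_pushDensity (i + 1)
  exact measure_lt_top _ _

theorem measureOf_compl_Icc (hh : 0 < D.h) : D.measureOf W (Icc 0 D.T)ᶜ = 0 := by
  rw [measureOf_apply measurableSet_Icc.compl]
  refine Finset.sum_eq_zero fun i hi => measure_mono_null ?_ (pushDensity_compl_Icc hW.isTimeChange)
  intro r hr hr'
  have : (i : ℝ) + 1 ≤ D.N := by exact_mod_cast Finset.mem_range.1 hi
  refine hr ⟨?_, ?_⟩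
  · have := hr'.1
    positivity
  · rw [T]; nlinarith [hr'.2]

theorem measureOf_real_singleton (t : ℝ) : (D.measureOf W).real {t} =
    ∑ i ∈ Finset.range D.N, (pushDensity (W 0) (deriv (W (i + 1)))).real {t - i * D.h} := by
  rw [Measure.real, measureOf_apply (measurableSet_singleton t), ENNReal.toReal_sum]
  · refine Finset.sum_congr rfl fun i _ => ?_
    rw [Measure.real]
    congr 2
    ext r
    simp only [mem_preimage, mem_singleton_iff]
    exact ⟨fun h => by linarith, fun h => by linarith⟩
  · intro i _
    have := hW.isFiniteMeasure_pushDensity (i + 1)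
    exact measure_ne_top _ _

theorem pushDensity_real_singleton_of_notMem {i : ℕ} {r : ℝ} (hr : r ∉ Icc 0 D.h) :
    (pushDensity (W 0) (deriv (W i))).real {r} = 0 := by
  rw [Measure.real, measure_mono_null (singleton_subset_iff.2 hr)
    (pushDensity_compl_Icc hW.isTimeChange), ENNReal.toReal_zero]

theorem measureOf_real_inner (hh : 0 < D.h) {i : ℕ} (hi : i < D.N) {r : ℝ} (hr : r ∈ Ioo 0 D.h) :
    (D.measureOf W).real {r + i * D.h} = (pushDensity (W 0) (deriv (W (i + 1)))).real {r} := by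
  rw [measureOf_real_singleton hW, Finset.sum_eq_single i]
  · simp
  · intro j _ hji
    refine pushDensity_real_singleton_of_notMem hW ?_
    rintro ⟨h1, h2⟩
    rcases lt_or_gt_of_ne hji with hlt | hlt
    · have : (j : ℝ) + 1 ≤ i := by exact_mod_cast hlt
      nlinarith [hr.1]
    · have : (i : ℝ) + 1 ≤ j := by exact_mod_cast hlt
      nlinarith [hr.2]
  · exact fun hni => absurd (Finset.mem_range.2 hi) hni

/-- The atom at a node `i h` collects the fiber over `h` of one delay interval and the fiber over
`0` of the next. -/
theorem measureOf_real_node (hh : 0 < D.h) {i : ℕ} (hi : i ≤ D.N) :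
    (D.measureOf W).real {i * D.h} =
      (if i = 0 then 0 else (pushDensity (W 0) (deriv (W i))).real {D.h}) +
      (pushDensity (W 0) (deriv (W (i + 1)))).real {0} := by
  have hlast : D.N ≤ i → (pushDensity (W 0) (deriv (W (i + 1)))).real {0} = 0 := fun hNi => by
    rw [hW.pushDensity_singleton _ ⟨le_rfl, hh.le⟩, hW.vanish _ (by omega), hW.vanish _ (by omega),
      sub_zero]
  have hterm : ∀ j ∈ Finset.range D.N,
      (pushDensity (W 0) (deriv (W (j + 1)))).real {i * D.h - j * D.h} =
      (if j + 1 = i then (pushDensity (W 0) (deriv (W i))).real {D.h} else 0) +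
      if j = i then (pushDensity (W 0) (deriv (W (i + 1)))).real {0} else 0 := by
    intro j _
    rcases eq_or_ne j i with rfl | hji
    · simp
    rcases eq_or_ne (j + 1) i with rfl | hji'
    · simp only [if_true, Nat.cast_add, Nat.cast_one, if_neg hji, add_zero]
      congr 2; ring
    rw [if_neg hji, if_neg hji', add_zero]
    refine pushDensity_real_singleton_of_notMem hW ?_
    rintro ⟨h1, h2⟩
    rcases lt_or_gt_of_ne hji with hlt | hlt
    · have : (j : ℝ) + 1 + 1 ≤ i := by exact_mod_cast (show j + 1 + 1 ≤ i by omega)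
      nlinarith
    · have : (i : ℝ) + 1 ≤ j := by exact_mod_cast hlt
      nlinarith
  rw [measureOf_real_singleton hW, Finset.sum_congr rfl hterm, Finset.sum_add_distrib,
    Finset.sum_ite_eq' (Finset.range D.N) i]
  congr 1
  · rcases i with _ | i
    · simp
    · simp only [Nat.add_right_cancel_iff, Nat.succ_ne_zero, if_false]
      rw [Finset.sum_ite_eq' (Finset.range D.N) i, if_pos (Finset.mem_range.2 hi)]
  · split_ifs with hmem
    · rfl
    · exact (hlast (by simpa using hmem)).symm

/-- The fibers of a completed control, rescaled to `[0, 1]`, form the controls of an impulsive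
control. -/
theorem isImpulsiveControl_of_completed (hh : 0 < D.h) :
    D.IsImpulsiveControl (D.measureOf W) (atomControl W) where
  finite := isFiniteMeasure_measureOf hW
  carried := measureOf_compl_Icc hW hh
  measurable r _ i _ := (measurable_atomControl r i).aemeasurable
  nonneg r hr i _ s _ := atomControl_nonneg hW hr i s
  conv_zero s _ := by simp [atomControl]
  conv_last s _ := by
    have : W (D.N + 1) = fun _ => 0 := funext (hW.vanish _ (by omega))
    simp [atomControl, this]
  sum_eq r hr := ae_sum_atomControl hW hr
  atom_inner r hr i hi := by
    obtain ⟨j, rfl⟩ : ∃ j, i = j + 1 := ⟨i - 1, by have := (Finset.mem_Icc.1 hi).1; omega⟩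
    have hj : j < D.N := (Finset.mem_Icc.1 hi).2
    rw [intervalIntegral_atomControl hW (Nat.succ_ne_zero j)]
    push_cast
    rw [add_sub_cancel_right, measureOf_real_inner hW hh hj hr,
      hW.pushDensity_singleton _ ⟨hr.1.le, hr.2.le⟩]
  atom_node i hi := by
    have hi' : i ≤ D.N := (Finset.mem_Icc.1 hi).2
    have h0 : (0 : ℝ) ∈ Icc 0 D.h := ⟨le_rfl, hh.le⟩
    have h1 : D.h ∈ Icc 0 D.h := ⟨hh.le, le_rfl⟩
    rw [intervalIntegral.integral_add (intervalIntegrable_atomControl hW h1 i)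
      (intervalIntegrable_atomControl hW h0 (i + 1)), measureOf_real_node hW hh hi',
      intervalIntegral_atomControl hW (Nat.succ_ne_zero i), hW.pushDensity_singleton _ h0]
    congr 1
    split_ifs with hi0
    · subst hi0; simp [atomControl]
    · rw [intervalIntegral_atomControl hW hi0, hW.pushDensity_singleton _ h1]

end control
end DelaySystem
end

/-! ### The process of a completed trajectory -/

noncomputable section
namespace DelaySystem
variable {n : ℕ} {D : DelaySystem n} {K M : ℝ} {W : ℕ → ℝ → ℝ}
  {z : ℕ → ℝ → EuclideanSpace ℝ (Fin n)}

/-- As time increases to `r`, the fibers accumulate at the left end of the fiber over `r`. -/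
theorem leftLim_stateOf (hW : IsCompletedControl D.N D.h K W) (hz : D.IsCompletedTraj W z)
    (hh : 0 < D.h) {i : ℕ} (hi : i < D.N) {r : ℝ} (hr : r ∈ Ioc 0 D.h) :
    Function.leftLim (D.stateOf (W 0) z) (r + i * D.h) = z (i + 1) (fiberLeft (W 0) r) := by
  refine leftLim_eq_of_tendsto ?_
  have h1 : Tendsto (fun t => z (i + 1) (fiberRight (W 0) (t - i * D.h))) (𝓝[<] (r + i * D.h))
      (𝓝 (z (i + 1) (fiberLeft (W 0) r))) := by
    refine ((hz.continuous (i + 1)).tendsto _).comp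
      ((hW.isTimeChange.tendsto_fiberRight hr).comp ?_)
    refine tendsto_nhdsWithin_iff.2 ⟨?_, ?_⟩
    · refine tendsto_nhdsWithin_of_tendsto_nhds ?_
      have : Continuous fun t : ℝ => t - i * D.h := by fun_prop
      have := this.tendsto (r + i * D.h)
      simpa using this
    · filter_upwards [self_mem_nhdsWithin] with t ht
      have ht' : t < r + i * D.h := ht
      change t - i * D.h < r
      linarith
  refine h1.congr' ?_
  have hlt : i * D.h < r + i * D.h := by linarith [hr.1]
  filter_upwards [Ioo_mem_nhdsLT hlt] with t ht
  have e : t = (t - i * D.h) + i * D.h := by ring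
  have h0 : (0 : ℝ) ≤ i * D.h := by positivity
  conv_rhs => rw [e]
  rw [stateOf_add hh hi ⟨by linarith [ht.1], by linarith [ht.2, hr.2]⟩]
  linarith [ht.1]

section trajectory
variable (hf : Continuous (Function.uncurry D.f)) (hg : Continuous (Function.uncurry D.g))
  (hfM : ∀ a b, ‖D.f a b‖ ≤ M) (hgM : ∀ a b, ‖D.g a b‖ ≤ M)
  (hW : IsCompletedControl D.N D.h K W) (hz : D.IsCompletedTraj W z)
include hf hg hfM hgM hW hz

theorem IsCompletedTraj.sub_eq_integral {i : ℕ} (hi : i < D.N) {s t : ℝ}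
    (hs : s ∈ Icc (0 : ℝ) 1) (ht : t ∈ Icc (0 : ℝ) 1) :
    z (i + 1) t - z (i + 1) s = ∫ σ in s..t, D.velocity W z i σ := by
  rw [hz.eq_integral i hi t ht, hz.eq_integral i hi s hs, add_sub_add_left_eq_sub,
    intervalIntegral.integral_interval_sub_left]
  · exact intervalIntegrable_velocity hf hg hfM hgM hW hz.continuous i 0 t
  · exact intervalIntegrable_velocity hf hg hfM hgM hW hz.continuous i 0 s

theorem IsCompletedTraj.lipschitzOnWith {i : ℕ} (hi : i < D.N) :
    LipschitzOnWith (2 * (D.h + K) * M).toNNReal (z (i + 1)) (Icc 0 1) := by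
  have hM : 0 ≤ M := (norm_nonneg _).trans (hfM 0 0)
  refine LipschitzOnWith.of_dist_le_mul fun s hs t ht => ?_
  rw [dist_eq_norm, hz.sub_eq_integral hf hg hfM hgM hW hi ht hs, Real.dist_eq,
    Real.coe_toNNReal _ (mul_nonneg (mul_nonneg zero_le_two hW.speed_nonneg) hM)]
  exact intervalIntegral.norm_integral_le_of_norm_le_const fun σ _ =>
    norm_velocity_le hfM hgM hW i σ

theorem IsCompletedTraj.ae_hasDerivAt {i : ℕ} (hi : i < D.N) :
    ∀ᵐ s, s ∈ Ioo (0 : ℝ) 1 → HasDerivAt (z (i + 1)) (D.velocity W z i s) s := by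
  have hint := intervalIntegrable_velocity hf hg hfM hgM hW hz.continuous i 0 1
  filter_upwards [hint.ae_hasDerivAt_integral] with s hs hmem
  rw [uIcc_of_le zero_le_one] at hs
  have h1 := (hs ⟨hmem.1.le, hmem.2.le⟩ 0 (by simp)).const_add (D.start z i)
  refine h1.congr_of_eventuallyEq ?_
  filter_upwards [Ioo_mem_nhds hmem.1 hmem.2] with t ht
  exact hz.eq_integral i hi t ⟨ht.1.le, ht.2.le⟩

theorem boundedVariationOn_stateOf (hh : 0 < D.h) :
    BoundedVariationOn (D.stateOf (W 0) z) (Icc (-D.h) D.T) := by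
  have hmono : Monotone fun j : ℕ => ((j : ℝ) - 1) * D.h := fun a b hab => by
    have : (a : ℝ) ≤ b := by exact_mod_cast hab
    exact mul_le_mul_of_nonneg_right (by linarith) hh.le
  have hsum := eVariationOn.sum' (D.stateOf (W 0) z) hmono (n := D.N + 1)
  have e0 : (((0 : ℕ) : ℝ) - 1) * D.h = -D.h := by simp
  have e1 : (((D.N + 1 : ℕ) : ℝ) - 1) * D.h = D.T := by push_cast; rw [T]; ring
  rw [e0, e1] at hsum
  rw [BoundedVariationOn, ← hsum, ENNReal.sum_ne_top]
  intro j hj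
  rcases j with _ | i
  · refine boundedVariationOn_Icc_of_comp_monotoneOn (y := fun _ => D.ξ₀) (L := 0)
      (β := fun _ => 0) (LipschitzWith.const _).lipschitzOnWith monotoneOn_const
      (fun _ _ => by simp) fun t ht => ?_
    rw [stateOf_of_neg]
    simpa using ht.2
  · have hi : i < D.N := by simpa using hj
    have e2 : (((i + 1 : ℕ) : ℝ) - 1) * D.h = i * D.h := by push_cast; ring
    have e3 : (((i + 1 + 1 : ℕ) : ℝ) - 1) * D.h = i * D.h + D.h := by push_cast; ring
    rw [e2, e3]
    have hmem : ∀ t ∈ Ioo (i * D.h) (i * D.h + D.h), t - i * D.h ∈ Ioo 0 D.h := fun t ht =>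
      ⟨by linarith [ht.1], by linarith [ht.2]⟩
    refine boundedVariationOn_Icc_of_comp_monotoneOn
      (hz.lipschitzOnWith hf hg hfM hgM hW hi)
      (β := fun t => fiberRight (W 0) (t - i * D.h)) ?_ ?_ ?_
    · intro s hs t ht hst
      exact hW.isTimeChange.fiberRight_monotoneOn ⟨(hmem s hs).1.le, (hmem s hs).2.le⟩
        ⟨(hmem t ht).1.le, (hmem t ht).2.le⟩ (by linarith)
    · intro t ht
      exact (hW.isTimeChange.fiberRight_mem ⟨(hmem t ht).1.le, (hmem t ht).2.le⟩).1
    · intro t ht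
      have h0 : (0 : ℝ) ≤ i * D.h := by positivity
      have := stateOf_add (R := W 0) (z := z) hh hi ⟨(hmem t ht).1.le, (hmem t ht).2⟩
        (by linarith [ht.1])
      rwa [sub_add_cancel] at this

/-- On a fiber the velocity has no drift term, so that a completed trajectory solves the equation of
the attached functions there. -/
theorem isAttached_atomState (hh : 0 < D.h) :
    D.IsAttached (D.stateOf (W 0) z) (atomControl W) (D.atomState (W 0) z) := by
  have hR := hW.isTimeChange
  have hpred : ∀ i ∈ Finset.Icc 1 D.N, ∃ j < D.N, i = j + 1 := fun i hi => by
    have := Finset.mem_Icc.1 hi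
    exact ⟨i - 1, by omega, by omega⟩
  refine ⟨?_, ?_, ?_, ?_, ?_, ?_⟩
  · intro r hr s hs hlt
    have : ¬ (r = D.h ∧ s = 1) := by
      rintro ⟨rfl, rfl⟩
      simp at hlt
    simp [atomState, this]
  · simp [atomState]
  · intro r hr i hi
    obtain ⟨j, hj, rfl⟩ := hpred i hi
    have hab := hR.fiberLeft_le_fiberRight hr
    have ha := (hR.fiberLeft_mem hr).1.1
    have hb := (hR.fiberRight_mem hr).1.2
    have h1 : LipschitzOnWith (2 * (D.h + K) * M).toNNReal (D.atomState (W 0) z r (j + 1))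
        (uIcc 0 1) := by
      refine LipschitzOnWith.of_dist_le_mul fun s hs t ht => ?_
      rw [uIcc_of_le zero_le_one] at hs ht
      have hmem : ∀ s ∈ Icc (0 : ℝ) 1, fiberLeft (W 0) r +
          (fiberRight (W 0) r - fiberLeft (W 0) r) * s ∈ Icc (0 : ℝ) 1 := fun s hs => by
        constructor <;> nlinarith [hs.1, hs.2]
      simp only [atomState, Nat.succ_ne_zero, if_false]
      refine ((hz.lipschitzOnWith hf hg hfM hgM hW hj).dist_le_mul _ (hmem s hs) _
        (hmem t ht)).trans ?_
      gcongr
      rw [Real.dist_eq, Real.dist_eq, add_sub_add_left_eq_sub, ← mul_sub, abs_mul]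
      refine mul_le_of_le_one_left (abs_nonneg _) ?_
      rw [abs_of_nonneg (sub_nonneg.2 hab)]
      linarith
    exact h1.absolutelyContinuousOnInterval
  · intro r hr i hi
    obtain ⟨j, hj, rfl⟩ := hpred i hi
    rw [Nat.add_sub_cancel]
    set a := fiberLeft (W 0) r with ha
    set b := fiberRight (W 0) r with hb
    have hab : a ≤ b := hR.fiberLeft_le_fiberRight hr
    have ha0 : 0 ≤ a := (hR.fiberLeft_mem hr).1.1
    have hb1 : b ≤ 1 := (hR.fiberRight_mem hr).1.2
    have hfun : D.atomState (W 0) z r (j + 1) = fun s => z (j + 1) (a + (b - a) * s) := by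
      ext1 s; simp [atomState, ← ha, ← hb]
    rcases hab.eq_or_lt with hab' | hlt
    · refine .of_forall fun s => ?_
      have : D.atomState (W 0) z r (j + 1) = fun _ => z (j + 1) a := by
        rw [hfun]; ext1 s; rw [hab', sub_self, zero_mul, add_zero]
      rw [this]
      have hc : atomControl W r (j + 1) s = 0 := by
        simp [atomControl, ← ha, ← hb, hab']
      rw [hc, zero_smul]
      exact hasDerivAt_const _ _
    · have h0 : ∀ᵐ s : ℝ, s ≠ 0 := by simp [ae_iff, measure_singleton]
      have h1 : ∀ᵐ s : ℝ, s ≠ 1 := by simp [ae_iff, measure_singleton]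
      rw [ae_restrict_iff' measurableSet_Icc]
      filter_upwards [ae_comp_affine (a := a) (sub_pos.2 hlt).ne'
        (hz.ae_hasDerivAt hf hg hfM hgM hW hj), h0, h1] with s hs hs0 hs1 hmem
      have hpos : 0 < s := lt_of_le_of_ne hmem.1 (Ne.symm hs0)
      have hlt1 : s < 1 := lt_of_le_of_ne hmem.2 hs1
      have hin : a + (b - a) * s ∈ Ioo a b := by constructor <;> nlinarith
      have hd := hs ⟨ha0.trans_lt hin.1, hin.2.trans_le hb1⟩
      have haff : HasDerivAt (fun s : ℝ => a + (b - a) * s) (b - a) s := by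
        simpa using ((hasDerivAt_id s).const_mul (b - a)).const_add a
      have hcomp := hd.scomp s haff
      have hprev : D.atomState (W 0) z r j s = z j (a + (b - a) * s) := by
        rcases eq_or_ne j 0 with rfl | hj0
        · simp [atomState, hz.history, hs1]
        · simp [atomState, hj0, ← ha, ← hb]
      rw [hfun, hprev]
      refine hcomp.congr_deriv ?_
      simp only [velocity, hW.deriv_time_eq_zero hr hin, zero_smul, zero_add, atomControl,
        Nat.succ_ne_zero, if_false, ← ha, ← hb, smul_smul]
  · intro r hr i hi
    obtain ⟨j, hj, rfl⟩ := hpred i hi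
    have e : (((j + 1 : ℕ) : ℝ) - 1) * D.h = j * D.h := by push_cast; ring
    rw [e, leftLim_stateOf hW hz hh hj hr]
    simp [atomState]
  · intro i hi
    obtain ⟨j, hj, rfl⟩ := hpred i hi
    rw [Nat.add_sub_cancel]
    have e1 : D.atomState (W 0) z 0 (j + 1) 0 = z (j + 1) 0 := by
      simp [atomState, hR.fiberLeft_zero]
    rw [e1, hz.eq_integral j hj 0 (by simp), intervalIntegral.integral_same, add_zero, start]
    split_ifs with hj0
    · simp [atomState, hj0]
    · simp [atomState, hj0, hR.fiberRight_one]

/-- Completed trajectories give extended processes. The equation of the process is the integral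
equation of the trajectory, transformed by `IsCompletedControl.integral_velocity_eq`. -/
theorem isExtendedProc_of_completed (hh : 0 < D.h) (hN : 0 < D.N) :
    D.IsExtendedProc (D.stateOf (W 0) z) (D.measureOf W) (atomControl W) := by
  have hR := hW.isTimeChange
  have hM : 0 ≤ M := (norm_nonneg _).trans (hfM 0 0)
  have hTpos : 0 < D.T := by
    have : (0 : ℝ) < D.N := by exact_mod_cast hN
    exact mul_pos this hh
  have h0 : (0 : ℝ) ∈ Icc 0 D.h := ⟨le_rfl, hh.le⟩
  refine ⟨boundedVariationOn_stateOf hf hg hfM hgM hW hz hh, isImpulsiveControl_of_completed hW hh,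
    fun t ht => stateOf_of_neg ht.2, stateOf_zero, D.atomState (W 0) z,
    isAttached_atomState hf hg hfM hgM hW hz hh, ?_, ?_, ?_⟩
  · intro i hi
    have hi2 := Finset.mem_Icc.1 hi
    obtain ⟨j, rfl⟩ : ∃ j, i = j + 1 := ⟨i - 1, by omega⟩
    have e : (((j + 1 : ℕ) : ℝ) - 1) * D.h = 0 + j * D.h := by push_cast; ring
    have hj : (0 : ℝ) < j := by exact_mod_cast (show 0 < j by omega)
    rw [e, stateOf_add hh (by omega) ⟨le_rfl, hh⟩ (by positivity)]
    simp [atomState]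
  · intro i hi t ht
    have hi2 := Finset.mem_Icc.1 hi
    obtain ⟨j, rfl⟩ : ∃ j, i = j + 1 := ⟨i - 1, by omega⟩
    have hj : j < D.N := by omega
    have e : (((j + 1 : ℕ) : ℝ) - 1) * D.h = j * D.h := by push_cast; ring
    have e' : ((j + 1 : ℕ) : ℝ) * D.h = j * D.h + D.h := by push_cast; ring
    rw [e, e'] at ht
    rw [e]
    obtain ⟨ρ, rfl⟩ : ∃ ρ, t = ρ + j * D.h := ⟨t - j * D.h, by ring⟩
    have hρ : ρ ∈ Ioo 0 D.h := ⟨by linarith [ht.1], by linarith [ht.2]⟩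
    have hρI : ρ ∈ Icc 0 D.h := ⟨hρ.1.le, hρ.2.le⟩
    have hj0 : (0 : ℝ) ≤ j * D.h := by positivity
    have hx : ∀ r ∈ Ioc 0 ρ, D.stateOf (W 0) z (r + j * D.h) = z (j + 1) (fiberRight (W 0) r) :=
      fun r hr => stateOf_add hh hj ⟨hr.1.le, hr.2.trans_lt hρ.2⟩ (by linarith [hr.1])
    have hxd : ∀ r ∈ Ioc 0 ρ, D.stateOf (W 0) z (r + j * D.h - D.h) =
        z j (fiberRight (W 0) r) :=
      fun r hr => stateOf_delay hz hh hj ⟨hr.1, hr.2.trans_lt hρ.2⟩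
    set C := {r ∈ Icc 0 D.h | fiberLeft (W 0) r < fiberRight (W 0) r} with hC
    have hbm : ∀ κ : Measure ℝ, AEMeasurable (fiberRight (W 0)) (κ.restrict (Ioc 0 ρ \ C)) :=
      fun κ => (aemeasurable_restrict_of_monotoneOn measurableSet_Ioc
        (hR.fiberRight_monotoneOn.mono fun r hr => ⟨hr.1.le, hr.2.trans hρ.2.le⟩)).mono_set
        sdiff_subset
    have hcf : Continuous fun s => D.f (z (j + 1) s) (z j s) :=
      hf.comp ((hz.continuous (j + 1)).prodMk (hz.continuous j))
    have hcg : Continuous fun s => D.g (z (j + 1) s) (z j s) :=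
      hg.comp ((hz.continuous (j + 1)).prodMk (hz.continuous j))
    have hb : ∀ s ∈ Ioc (0 : ℝ) 1, W 0 s ∈ Ioc 0 ρ \ C → fiberRight (W 0) (W 0 s) = s := by
      rintro s hs ⟨hsr, hsC⟩
      have hsI : s ∈ Icc (0 : ℝ) 1 := ⟨hs.1.le, hs.2⟩
      have h1 := hR.fiberLeft_le hsI
      have h2 := hR.le_fiberRight hsI
      by_contra hne
      exact hsC ⟨hR.mapsTo hsI, h1.trans_lt (lt_of_le_of_ne h2 (Ne.symm hne))⟩
    obtain ⟨-, hmain⟩ := hW.integral_velocity_eq (j + 1) hρI (C := C)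
      hR.countable_nontrivial_fibers
      (fun r hr hrC => by
        have hrI : r ∈ Icc 0 D.h := ⟨hr.1.le, hr.2.trans hρ.2.le⟩
        by_contra hne
        exact hrC ⟨hrI, lt_of_le_of_ne (hR.fiberLeft_le_fiberRight hrI) hne⟩)
      (Ff := fun s => D.f (z (j + 1) s) (z j s)) (Fg := fun s => D.g (z (j + 1) s) (z j s))
      (Hf := fun r => D.f (z (j + 1) (fiberRight (W 0) r)) (z j (fiberRight (W 0) r)))
      (Hg := fun r => D.g (z (j + 1) (fiberRight (W 0) r)) (z j (fiberRight (W 0) r)))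
      (fun s => hfM _ _) (fun s => hgM _ _)
      (fun _ _ => hcf.aestronglyMeasurable) (fun _ _ => hcg.aestronglyMeasurable)
      (fun κ => (hcf.measurable.comp_aemeasurable (hbm κ)).aestronglyMeasurable)
      (fun κ => (hcg.measurable.comp_aemeasurable (hbm κ)).aestronglyMeasurable)
      (fun s hs hsr => by simp only [hb s hs hsr]) (fun s hs hsr => by simp only [hb s hs hsr])
    have hstate : D.stateOf (W 0) z (ρ + j * D.h) =
        z (j + 1) (fiberRight (W 0) 0) + ∫ s in fiberRight (W 0) 0..fiberRight (W 0) ρ,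
          D.velocity W z j s := by
      rw [hx ρ ⟨hρ.1, le_rfl⟩, ← hz.sub_eq_integral hf hg hfM hgM hW hj (hR.fiberRight_mem h0).1
        (hR.fiberRight_mem hρI).1]
      abel
    have ezero : D.atomState (W 0) z 0 (j + 1) 1 = z (j + 1) (fiberRight (W 0) 0) := by
      simp [atomState]
    have efint : ∫ t' in (j * D.h : ℝ)..(ρ + j * D.h),
        D.f (D.stateOf (W 0) z t') (D.stateOf (W 0) z (t' - D.h)) =
        ∫ r in (0 : ℝ)..ρ,
          D.f (z (j + 1) (fiberRight (W 0) r)) (z j (fiberRight (W 0) r)) := by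
      have := intervalIntegral.integral_comp_add_right (a := 0) (b := ρ)
        (fun t' => D.f (D.stateOf (W 0) z t') (D.stateOf (W 0) z (t' - D.h))) (j * D.h)
      rw [zero_add] at this
      rw [← this, intervalIntegral.integral_of_le hρ.1.le, intervalIntegral.integral_of_le hρ.1.le]
      refine setIntegral_congr_fun measurableSet_Ioc fun r hr => ?_
      simp only [hx r hr, hxd r hr]
    have egint : ∫ t' in Icc (j * D.h : ℝ) (ρ + j * D.h),
        D.g (D.stateOf (W 0) z t') (D.stateOf (W 0) z (t' - D.h))
          ∂(continuousPart (D.measureOf W)) =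
        ∫ r in Ioc 0 ρ, D.g (z (j + 1) (fiberRight (W 0) r)) (z j (fiberRight (W 0) r))
          ∂(continuousPart (pushDensity (W 0) (deriv (W (j + 1))))) := by
      rw [add_comm ρ, setIntegral_continuousPart_shift (measureOf_restrict_Ioo hW hh hj) hρ]
      refine setIntegral_congr_fun measurableSet_Ioc fun r hr => ?_
      simp only [hx r hr, hxd r hr]
    have esum : ∑' r : Ioc (0 : ℝ) (ρ + j * D.h - j * D.h),
        (D.atomState (W 0) z r (j + 1) 1 -
          Function.leftLim (D.stateOf (W 0) z) ((r : ℝ) + j * D.h)) =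
        ∑' r : Ioc (0 : ℝ) ρ, ∫ s in fiberLeft (W 0) r..fiberRight (W 0) r,
          deriv (W (j + 1)) s • D.g (z (j + 1) s) (z j s) := by
      rw [add_sub_cancel_right]
      refine tsum_congr fun r => ?_
      have hrh : (r : ℝ) ≤ D.h := r.2.2.trans hρ.2.le
      have hrI : (r : ℝ) ∈ Icc 0 D.h := ⟨r.2.1.le, hrh⟩
      rw [leftLim_stateOf hW hz hh hj ⟨r.2.1, hrh⟩]
      have e1 : D.atomState (W 0) z r (j + 1) 1 = z (j + 1) (fiberRight (W 0) r) := by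
        simp [atomState]
      rw [e1, hz.sub_eq_integral hf hg hfM hgM hW hj (hR.fiberLeft_mem hrI).1
        (hR.fiberRight_mem hrI).1]
      refine intervalIntegral.integral_congr_ae ?_
      have hne : ∀ᵐ s : ℝ, s ≠ fiberRight (W 0) r := by simp [ae_iff, measure_singleton]
      filter_upwards [hne] with s hs hs'
      rw [uIoc_of_le (hR.fiberLeft_le_fiberRight hrI)] at hs'
      rw [velocity, hW.deriv_time_eq_zero hrI ⟨hs'.1, lt_of_le_of_ne hs'.2 hs⟩, zero_smul, zero_add]
    rw [ezero, efint, egint, esum, hstate, add_assoc, add_assoc, add_right_inj, ← add_assoc]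
    exact hmain
  · rw [stateOf_T hTpos]
    simp [atomState, hN.ne', hR.fiberRight_one]

theorem completedTraj_end_mem_extended (hh : 0 < D.h) (hN : 0 < D.N) :
    z D.N 1 ∈ D.extendedReachableSet K := by
  have hTpos : 0 < D.T := by
    have : (0 : ℝ) < D.N := by exact_mod_cast hN
    exact mul_pos this hh
  refine ⟨_, _, _, isExtendedProc_of_completed hf hg hfM hgM hW hz hh hN, ?_, stateOf_T hTpos⟩
  rw [measureOf_real_univ hW]
  exact hW.mass

/-- If time runs at positive speed along a completed control, then its measure has a density. -/
theorem completedTraj_end_mem_strict (hh : 0 < D.h) (hN : 0 < D.N) {c : ℝ} (hc : 0 < c)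
    (hspeed : ∀ s t, s ≤ t → c * (t - s) ≤ W 0 t - W 0 s) :
    z D.N 1 ∈ D.strictReachableSet K := by
  have hTpos : 0 < D.T := by
    have : (0 : ℝ) < D.N := by exact_mod_cast hN
    exact mul_pos this hh
  have hRm := (hW.continuous 0).measurable
  have hfin := isFiniteMeasure_measureOf hW
  have hderiv : ∀ᵐ s, c ≤ deriv (W 0) s := by
    filter_upwards [hW.ae_differentiableAt] with s hs
    have hmono : Monotone fun t => W 0 t - c * t := fun p q hpq => by
      have := hspeed p q hpq
      simp only; linarith
    have hd : HasDerivAt (fun t => W 0 t - c * t) (deriv (W 0) s - c) s := by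
      simpa using (hs 0).hasDerivAt.fun_sub ((hasDerivAt_id s).const_mul c)
    have := hmono.deriv_nonneg (x := s)
    rw [hd.deriv] at this
    linarith
  -- `c` times the measure of the preimage of a set is at most the measure of the set
  have hpush : ∀ i, pushDensity (W 0) (deriv (W i)) ≪ volume := by
    intro i
    refine Measure.AbsolutelyContinuous.mk fun A hA hA0 => ?_
    have h1 : pushDensity (W 0) (deriv (W 0)) A = 0 := by
      rw [hW.pushDensity_time]
      exact Measure.restrict_le_self.absolutelyContinuous hA0
    have h2 : ENNReal.ofReal c * volume (Ioc 0 1 ∩ W 0 ⁻¹' A) ≤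
        pushDensity (W 0) (deriv (W 0)) A := by
      rw [pushDensity_apply hRm hA, ← setLIntegral_const]
      refine lintegral_mono_ae (ae_restrict_of_ae ?_)
      filter_upwards [hderiv] with s hs using ENNReal.ofReal_le_ofReal hs
    rw [h1, nonpos_iff_eq_zero, mul_eq_zero] at h2
    have h3 : volume (Ioc 0 1 ∩ W 0 ⁻¹' A) = 0 :=
      h2.resolve_left (ENNReal.ofReal_pos.2 hc).ne'
    rw [pushDensity_apply hRm hA, Measure.restrict_eq_zero.2 h3, lintegral_zero_measure]
  have hac : D.measureOf W ≪ volume := by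
    refine Measure.AbsolutelyContinuous.mk fun A hA hA0 => ?_
    rw [measureOf_apply hA]
    refine Finset.sum_eq_zero fun i _ => hpush _ ?_
    rwa [measure_preimage_add_right]
  set u : ℝ → ℝ := fun t => ((D.measureOf W).rnDeriv volume t).toReal with hu
  have hdens : D.densityMeasure u = D.measureOf W := by
    have h1 : volume.withDensity ((D.measureOf W).rnDeriv volume) = D.measureOf W :=
      Measure.withDensity_rnDeriv_eq _ _ hac
    have h2 : volume.withDensity (fun t => ENNReal.ofReal (u t)) = D.measureOf W := by
      refine Eq.trans (withDensity_congr_ae ?_) h1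
      filter_upwards [Measure.rnDeriv_lt_top (D.measureOf W) volume] with t ht
      exact ENNReal.ofReal_toReal ht.ne
    rw [densityMeasure, ← restrict_withDensity measurableSet_Icc, h2,
      Measure.restrict_eq_self_of_ae_mem]
    rw [ae_iff]
    exact measureOf_compl_Icc hW hh
  have huint : Integrable u volume := Measure.integrable_toReal_rnDeriv
  refine ⟨_, u, ⟨fun t _ => ENNReal.toReal_nonneg, huint.integrableOn, atomControl W, ?_⟩, ?_,
    stateOf_T hTpos (R := W 0)⟩
  · rw [hdens]
    exact isExtendedProc_of_completed hf hg hfM hgM hW hz hh hN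
  · rw [intervalIntegral.integral_of_le hTpos.le, ← integral_Icc_eq_integral_Ioc]
    have h1 : (D.densityMeasure u).real univ = ∫ t in Icc 0 D.T, u t := by
      rw [Measure.real, densityMeasure, withDensity_apply _ MeasurableSet.univ,
        Measure.restrict_univ, ← ofReal_integral_eq_lintegral_ofReal huint.integrableOn
        (.of_forall fun t => ENNReal.toReal_nonneg), ENNReal.toReal_ofReal]
      exact integral_nonneg fun t => ENNReal.toReal_nonneg
    rw [← h1, hdens, measureOf_real_univ hW]
    exact hW.mass

end trajectory
end DelaySystem
end

/-! ### Completing a family of measures -/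

theorem tendsto_measureReal_Iic_sub (ν : Measure ℝ) [IsFiniteMeasure ν] (r : ℝ) :
    Tendsto (fun k : ℕ => ν.real (Iic (r - 1 / ((k : ℝ) + 1)))) atTop (𝓝 (ν.real (Iio r))) := by
  have hU : ⋃ k : ℕ, Iic (r - 1 / ((k : ℝ) + 1)) = Iio r := by
    ext y
    simp only [mem_iUnion, mem_Iic, mem_Iio]
    constructor
    · rintro ⟨k, hk⟩
      have : 0 < 1 / ((k : ℝ) + 1) := by positivity
      linarith
    · intro hy
      obtain ⟨k, hk⟩ := exists_nat_one_div_lt (sub_pos.2 hy)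
      exact ⟨k, by linarith⟩
  have hmono : Monotone fun k : ℕ => Iic (r - 1 / ((k : ℝ) + 1)) := fun k l hkl => by
    refine Iic_subset_Iic.2 ?_
    have := Nat.one_div_le_one_div (α := ℝ) hkl
    linarith
  have := tendsto_measure_iUnion_atTop (μ := ν) hmono
  rw [hU] at this
  exact (ENNReal.tendsto_toReal (measure_ne_top ν _)).comp this

theorem tendsto_measureReal_Iio_add (ν : Measure ℝ) [IsFiniteMeasure ν] (r : ℝ) :
    Tendsto (fun k : ℕ => ν.real (Iio (r + 1 / ((k : ℝ) + 1)))) atTop (𝓝 (ν.real (Iic r))) := by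
  have hU : ⋂ k : ℕ, Iio (r + 1 / ((k : ℝ) + 1)) = Iic r := by
    ext y
    simp only [mem_iInter, mem_Iic, mem_Iio]
    constructor
    · intro hy
      by_contra! hlt
      obtain ⟨k, hk⟩ := exists_nat_one_div_lt (sub_pos.2 hlt)
      linarith [hy k]
    · intro hy k
      have : 0 < 1 / ((k : ℝ) + 1) := by positivity
      linarith
  have hanti : Antitone fun k : ℕ => Iio (r + 1 / ((k : ℝ) + 1)) := fun k l hkl => by
    refine Iio_subset_Iio ?_
    have := Nat.one_div_le_one_div (α := ℝ) hkl
    linarith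
  have := tendsto_measure_iInter_atTop (μ := ν)
    (fun k : ℕ => (measurableSet_Iio (a := r + 1 / ((k : ℝ) + 1))).nullMeasurableSet) hanti
    ⟨0, measure_ne_top ν _⟩
  rw [hU] at this
  exact (ENNReal.tendsto_toReal (measure_ne_top ν _)).comp this

/-- The function `r ↦ r + ν (-∞, r]`, with its jumps filled in, takes all values between its
extreme ones. -/
theorem exists_add_measureReal_Iio_le {ν : Measure ℝ} [IsFiniteMeasure ν] {h : ℝ} (hh : 0 ≤ h)
    (h0 : ν.real (Iio 0) = 0) {s : ℝ} (hs0 : 0 ≤ s) (hsh : s ≤ h + ν.real (Iic h)) :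
    ∃ r ∈ Icc 0 h, r + ν.real (Iio r) ≤ s ∧ s ≤ r + ν.real (Iic r) := by
  set A := {r ∈ Icc 0 h | s ≤ r + ν.real (Iic r)} with hA
  have hne : A.Nonempty := ⟨h, ⟨hh, le_rfl⟩, hsh⟩
  have hbdd : BddBelow A := ⟨0, fun r hr => hr.1.1⟩
  set r := sInf A with hr
  have hr0 : 0 ≤ r := le_csInf hne fun r hr => hr.1.1
  have hrh : r ≤ h := csInf_le hbdd ⟨⟨hh, le_rfl⟩, hsh⟩
  refine ⟨r, ⟨hr0, hrh⟩, ?_, ?_⟩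
  · rcases hr0.eq_or_lt with hr0' | hpos
    · rw [← hr0', h0, add_zero]; exact hs0
    · have hlim : Tendsto (fun k : ℕ => (r - 1 / ((k : ℝ) + 1)) +
          ν.real (Iic (r - 1 / ((k : ℝ) + 1)))) atTop (𝓝 (r - 0 + ν.real (Iio r))) :=
        (tendsto_const_nhds.sub tendsto_one_div_add_atTop_nhds_zero_nat).add
          (tendsto_measureReal_Iic_sub ν r)
      rw [sub_zero] at hlim
      refine le_of_tendsto hlim ?_
      have hev : ∀ᶠ k : ℕ in atTop, 1 / ((k : ℝ) + 1) < r :=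
        tendsto_one_div_add_atTop_nhds_zero_nat.eventually_lt_const hpos
      filter_upwards [hev] with k hk
      have hk0 : 0 < 1 / ((k : ℝ) + 1) := by positivity
      by_contra! hlt
      have : r ≤ r - 1 / ((k : ℝ) + 1) :=
        csInf_le hbdd ⟨⟨by linarith, by linarith⟩, hlt.le⟩
      linarith
  · have hlim : Tendsto (fun k : ℕ => (r + 1 / ((k : ℝ) + 1)) +
        ν.real (Iio (r + 1 / ((k : ℝ) + 1)))) atTop (𝓝 (r + 0 + ν.real (Iic r))) :=
      (tendsto_const_nhds.add tendsto_one_div_add_atTop_nhds_zero_nat).add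
        (tendsto_measureReal_Iio_add ν r)
    rw [add_zero] at hlim
    refine ge_of_tendsto hlim (.of_forall fun k => ?_)
    have hk0 : 0 < 1 / ((k : ℝ) + 1) := by positivity
    obtain ⟨r', hr', hlt⟩ := exists_lt_of_csInf_lt hne
      (show sInf A < r + 1 / ((k : ℝ) + 1) by linarith)
    exact hr'.2.trans (add_le_add hlt.le (measureReal_mono (Iic_subset_Iio.2 hlt)))

/-- The linear continuation `s ↦ s u(1)` outside `[0, 1]`. -/
noncomputable def extendLinear (u : ℝ → ℝ) (s : ℝ) : ℝ := by
  classical exact if s ∈ Icc (0 : ℝ) 1 then u s else s * u 1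

theorem extendLinear_of_mem {u : ℝ → ℝ} {s : ℝ} (hs : s ∈ Icc (0 : ℝ) 1) :
    extendLinear u s = u s := if_pos hs

theorem monotone_extendLinear {u : ℝ → ℝ} (hu : MonotoneOn u (Icc 0 1)) (h0 : u 0 = 0) :
    Monotone (extendLinear u) := by
  have hb : ∀ s ∈ Icc (0 : ℝ) 1, 0 ≤ u s ∧ u s ≤ u 1 := fun s hs =>
    ⟨h0 ▸ hu (by simp) hs hs.1, hu hs (by simp) hs.2⟩
  have h1 : 0 ≤ u 1 := (hb 1 (by simp)).1
  intro s t hst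
  unfold extendLinear
  split_ifs with hs ht ht
  · exact hu hs ht hst
  · have : 1 < t := by
      by_contra! hle
      exact ht ⟨hs.1.trans hst, hle⟩
    nlinarith [(hb s hs).2]
  · have : s < 0 := by
      by_contra! hle
      exact hs ⟨hle, hst.trans ht.2⟩
    nlinarith [(hb t ht).1]
  · exact mul_le_mul_of_nonneg_right hst h1

/-- Graph completion of a family of measures `m 0, …, m (N - 1)` on `[0, h]`. The parameter runs
through elapsed time plus spent mass; an atom at `r` is spent at the rates `v r 0, …, v r (N - 1)`
while time stands still. -/
theorem exists_isCompletedControl_of_measures {N : ℕ} {h K : ℝ} (hh : 0 < h) (m : ℕ → Measure ℝ)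
    [∀ i, IsFiniteMeasure (m i)] (hm : ∀ i < N, m i (Icc 0 h)ᶜ = 0)
    (hK : ∑ i ∈ Finset.range N, (m i).real univ ≤ K) (v : ℝ → ℕ → ℝ → ℝ)
    (hv0 : ∀ r ∈ Icc 0 h, ∀ i < N, ∀ s ∈ Icc (0 : ℝ) 1, 0 ≤ v r i s)
    (hvi : ∀ r ∈ Icc 0 h, ∀ i < N, IntervalIntegrable (v r i) volume 0 1)
    (hvm : ∀ r ∈ Icc 0 h, ∀ i < N, ∫ s in (0 : ℝ)..1, v r i s = (m i).real {r})
    (hsum : ∀ r ∈ Icc 0 h, ∀ᵐ s ∂(volume.restrict (Icc (0 : ℝ) 1)),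
      ∑ i ∈ Finset.range N, v r i s = ∑ i ∈ Finset.range N, (m i).real {r}) :
    ∃ W, IsCompletedControl N h K W ∧
      (∀ i < N, pushDensity (W 0) (deriv (W (i + 1))) = m i) ∧
      ∀ r ∈ Icc 0 h, ∀ i < N, ∀ s ∈ Icc (fiberLeft (W 0) r) (fiberRight (W 0) r),
        W (i + 1) s = W (i + 1) (fiberLeft (W 0) r) +
          ∫ σ in (0 : ℝ)..(s - fiberLeft (W 0) r) / (fiberRight (W 0) r - fiberLeft (W 0) r),
            v r i σ := by
  set ν : Measure ℝ := ∑ i ∈ Finset.range N, m i with hν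
  have hνreal : ∀ A, ν.real A = ∑ i ∈ Finset.range N, (m i).real A := fun A => by
    rw [Measure.real, hν, Measure.finsetSum_apply, ENNReal.toReal_sum fun i _ => measure_ne_top _ _]
    rfl
  have : IsFiniteMeasure ν := ⟨by
    rw [hν, Measure.finsetSum_apply]
    exact ENNReal.sum_lt_top.2 fun i _ => measure_lt_top _ _⟩
  have hmIio : ∀ i < N, (m i).real (Iio 0) = 0 := fun i hi => by
    rw [Measure.real, measure_mono_null (fun y hy => ?_) (hm i hi), ENNReal.toReal_zero]
    exact fun hy' => hy'.1.not_gt hy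
  have hmIic : ∀ i < N, (m i).real (Iic h) = (m i).real univ := fun i hi => by
    refine le_antisymm (measureReal_mono (subset_univ _)) ?_
    have hsub : (univ : Set ℝ) ⊆ Iic h ∪ (Icc 0 h)ᶜ := by
      intro y _
      by_cases hy : y ≤ h
      · exact Or.inl hy
      · exact Or.inr fun hy' => hy hy'.2
    have h1 := (measureReal_mono (μ := m i) hsub).trans (measureReal_union_le _ _)
    have h2 : (m i).real (Icc 0 h)ᶜ = 0 := by rw [Measure.real, hm i hi, ENNReal.toReal_zero]
    linarith
  have hνIio : ν.real (Iio 0) = 0 := by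
    rw [hνreal]; exact Finset.sum_eq_zero fun i hi => hmIio i (Finset.mem_range.1 hi)
  have hνIic : ν.real (Iic h) = ν.real univ := by
    rw [hνreal, hνreal]
    exact Finset.sum_congr rfl fun i hi => hmIic i (Finset.mem_range.1 hi)
  set S := h + ν.real univ with hS
  have hS0 : 0 < S := add_pos_of_pos_of_nonneg hh measureReal_nonneg
  -- the fiber over `r` will be `[a r, b r]`
  set a : ℝ → ℝ := fun r => (r + ν.real (Iio r)) / S with ha
  set b : ℝ → ℝ := fun r => (r + ν.real (Iic r)) / S with hb
  have hjump : ∀ (κ : Measure ℝ) [IsFiniteMeasure κ] (r : ℝ),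
      κ.real (Iic r) = κ.real (Iio r) + κ.real {r} := fun κ _ r => by
    rw [← Iio_union_right, measureReal_union (by simp) (measurableSet_singleton r)]
  have hab : ∀ r, a r ≤ b r := fun r => by
    have : ν.real (Iio r) ≤ ν.real (Iic r) := measureReal_mono Iio_subset_Iic_self
    exact div_le_div_of_nonneg_right (by linarith) hS0.le
  have hba : ∀ r r', r < r' → b r < a r' := fun r r' hlt => by
    simp only [ha, hb]
    have : ν.real (Iic r) ≤ ν.real (Iio r') := measureReal_mono (Iic_subset_Iio.2 hlt)
    exact div_lt_div_of_pos_right (by linarith) hS0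
  have ha0 : a 0 = 0 := by simp [ha, hνIio]
  have hbh : b h = 1 := by simp only [hb, hνIic]; exact div_self hS0.ne'
  have hR : ∀ s ∈ Icc (0 : ℝ) 1, ∃ r ∈ Icc 0 h, a r ≤ s ∧ s ≤ b r := fun s hs => by
    obtain ⟨r, hr, h1, h2⟩ := exists_add_measureReal_Iio_le (ν := ν) hh.le hνIio
      (s := s * S) (mul_nonneg hs.1 hS0.le)
      (by rw [hνIic]; exact mul_le_of_le_one_left hS0.le hs.2)
    exact ⟨r, hr, (div_le_iff₀ hS0).2 h1, (le_div_iff₀ hS0).2 h2⟩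
  choose! R hRmem hRa hRb using hR
  have hRuniq : ∀ s ∈ Icc (0 : ℝ) 1, ∀ r, a r ≤ s → s ≤ b r → R s = r := fun s hs r h1 h2 => by
    rcases lt_trichotomy (R s) r with hlt | heq | hlt
    · exact absurd ((hba _ _ hlt).trans_le (h1.trans (hRb s hs))) (lt_irrefl _)
    · exact heq
    · exact absurd ((hba _ _ hlt).trans_le ((hRa s hs).trans h2)) (lt_irrefl _)
  have hRmono : ∀ s ∈ Icc (0 : ℝ) 1, ∀ t ∈ Icc (0 : ℝ) 1, s ≤ t → R s ≤ R t := by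
    intro s hs t ht hst
    by_contra! hlt
    exact absurd (((hRb t ht).trans_lt (hba _ _ hlt)).trans_le (hRa s hs)) (not_lt.2 hst)
  have ha_mem : ∀ r ∈ Icc 0 h, 0 ≤ a r := fun r hr =>
    div_nonneg (add_nonneg hr.1 measureReal_nonneg) hS0.le
  have hb_mem : ∀ r ∈ Icc 0 h, b r ≤ 1 := fun r hr => by
    rw [← hbh]
    have : ν.real (Iic r) ≤ ν.real (Iic h) := measureReal_mono (Iic_subset_Iic.2 hr.2)
    exact div_le_div_of_nonneg_right (by linarith [hr.2]) hS0.le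
  -- the relative position in the fiber, which is `0` in a trivial fiber since `0 / 0 = 0`
  set lam : ℝ → ℝ := fun s => (s - a (R s)) / (b (R s) - a (R s)) with hlam
  have hlamI : ∀ s ∈ Icc (0 : ℝ) 1, lam s ∈ Icc (0 : ℝ) 1 := fun s hs =>
    ⟨div_nonneg (sub_nonneg.2 (hRa s hs)) (sub_nonneg.2 (hab _)),
      div_le_one_of_le₀ (by linarith [hRb s hs]) (sub_nonneg.2 (hab _))⟩
  have hvsub : ∀ r ∈ Icc 0 h, ∀ i < N, ∀ p ∈ Icc (0 : ℝ) 1, ∀ q ∈ Icc (0 : ℝ) 1,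
      IntervalIntegrable (v r i) volume p q := fun r hr i hi p hp q hq =>
    (hvi r hr i hi).mono_set (by
      rw [uIcc_of_le zero_le_one]
      exact uIcc_subset_Icc hp hq)
  set V : ℕ → ℝ → ℝ := fun i s => (m i).real (Iio (R s)) + ∫ σ in (0 : ℝ)..lam s, v (R s) i σ
    with hV
  -- the part of an atom that has been spent
  have hpart : ∀ i < N, ∀ r ∈ Icc 0 h, ∀ q ∈ Icc (0 : ℝ) 1,
      0 ≤ ∫ σ in (0 : ℝ)..q, v r i σ ∧ ∫ σ in (0 : ℝ)..q, v r i σ ≤ (m i).real {r} := by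
    intro i hi r hr q hq
    have h1 := intervalIntegral.integral_add_adjacent_intervals
      (hvsub r hr i hi 0 (by simp) q hq) (hvsub r hr i hi q hq 1 (by simp))
    rw [hvm r hr i hi] at h1
    have h2 : 0 ≤ ∫ σ in (0 : ℝ)..q, v r i σ := intervalIntegral.integral_nonneg hq.1
      fun σ hσ => hv0 r hr i hi σ ⟨hσ.1, hσ.2.trans hq.2⟩
    have h3 : 0 ≤ ∫ σ in q..1, v r i σ := intervalIntegral.integral_nonneg hq.2
      fun σ hσ => hv0 r hr i hi σ ⟨hq.1.trans hσ.1, hσ.2⟩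
    exact ⟨h2, by linarith⟩
  have hVmono : ∀ i < N, MonotoneOn (V i) (Icc 0 1) := by
    intro i hi s hs t ht hst
    rcases (hRmono s hs t ht hst).eq_or_lt with heq | hlt
    · have hle : lam s ≤ lam t := by
        simp only [hlam, heq]
        exact div_le_div_of_nonneg_right (by linarith) (sub_nonneg.2 (hab _))
      have h1 := intervalIntegral.integral_add_adjacent_intervals
        (hvsub (R t) (hRmem t ht) i hi 0 (by simp) (lam s) (hlamI s hs))
        (hvsub (R t) (hRmem t ht) i hi (lam s) (hlamI s hs) (lam t) (hlamI t ht))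
      have h2 : 0 ≤ ∫ σ in lam s..lam t, v (R t) i σ := intervalIntegral.integral_nonneg hle
        fun σ hσ => hv0 (R t) (hRmem t ht) i hi σ
          ⟨(hlamI s hs).1.trans hσ.1, hσ.2.trans (hlamI t ht).2⟩
      simp only [hV, heq]
      linarith
    · have h1 := (hpart i hi (R s) (hRmem s hs) (lam s) (hlamI s hs)).2
      have h2 := (hpart i hi (R t) (hRmem t ht) (lam t) (hlamI t ht)).1
      have h3 : (m i).real (Iic (R s)) ≤ (m i).real (Iio (R t)) :=
        measureReal_mono (Iic_subset_Iio.2 hlt)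
      rw [hjump (m i)] at h3
      simp only [hV]
      linarith
  have hbsub : ∀ r, S * (b r - a r) = ν.real {r} := fun r => by
    simp only [ha, hb]
    rw [← sub_div, mul_div_cancel₀ _ hS0.ne', hjump ν]
    ring
  -- the total rate on a fiber is constant, so the parameter is proportional to time plus mass
  have hVsum : ∀ s ∈ Icc (0 : ℝ) 1, R s + ∑ i ∈ Finset.range N, V i s = s * S := by
    intro s hs
    have hr := hRmem s hs
    have h1 : ∑ i ∈ Finset.range N, ∫ σ in (0 : ℝ)..lam s, v (R s) i σ =
        lam s * ν.real {R s} := by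
      rw [← intervalIntegral.integral_finsetSum fun i hi =>
        hvsub (R s) hr i (Finset.mem_range.1 hi) 0 (by simp) (lam s) (hlamI s hs)]
      have : ∫ σ in (0 : ℝ)..lam s, ∑ i ∈ Finset.range N, v (R s) i σ =
          ∫ σ in (0 : ℝ)..lam s, ν.real {R s} := by
        refine intervalIntegral.integral_congr_ae ?_
        have h2 := hsum (R s) hr
        rw [ae_restrict_iff' measurableSet_Icc] at h2
        filter_upwards [h2] with σ hσ hmem
        rw [uIoc_of_le (hlamI s hs).1] at hmem
        rw [hσ ⟨hmem.1.le, hmem.2.trans (hlamI s hs).2⟩, hνreal]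
      rw [this, intervalIntegral.integral_const, sub_zero, smul_eq_mul]
    have h2 : lam s * (S * (b (R s) - a (R s))) = S * (s - a (R s)) := by
      rcases (hab (R s)).eq_or_lt with heq | hlt
      · have : s = a (R s) := le_antisymm ((hRb s hs).trans heq.symm.le) (hRa s hs)
        rw [← heq, sub_self, mul_zero, mul_zero, ← this, sub_self, mul_zero]
      · simp only [hlam]
        have := (sub_pos.2 hlt).ne'
        field_simp
    have h3 : S * a (R s) = R s + ν.real (Iio (R s)) := mul_div_cancel₀ _ hS0.ne'
    simp only [hV]
    rw [Finset.sum_add_distrib, h1, ← hνreal, ← hbsub, h2, mul_sub, h3]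
    ring
  set U : ℕ → ℝ → ℝ := fun k => Nat.rec R (fun i _ s => if i < N then V i s else 0) k with hU
  have hU1 : ∀ i < N, ∀ s, U (i + 1) s = V i s := fun i hi s => by simp [hU, hi]
  have hU2 : ∀ k, N < k → ∀ s, U k s = 0 := fun k hk s => by
    obtain ⟨i, rfl⟩ : ∃ i, k = i + 1 := ⟨k - 1, by omega⟩
    simp [hU, show ¬ i < N by omega]
  have hR0 : R 0 = 0 := hRuniq 0 (by simp) 0 ha0.le (ha0.symm.le.trans (hab 0))
  have hR1 : R 1 = h := hRuniq 1 (by simp) h ((hab h).trans hbh.le) hbh.ge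
  have hUmono : ∀ k, MonotoneOn (U k) (Icc 0 1) := by
    rintro (_ | i)
    · exact fun s hs t ht hst => hRmono s hs t ht hst
    · by_cases hi : i < N
      · exact (hVmono i hi).congr fun s _ => (hU1 i hi s).symm
      · exact fun s _ t _ _ => (hU2 (i + 1) (by omega) s).le.trans (hU2 (i + 1) (by omega) t).ge
  have hUzero : ∀ k, U k 0 = 0 := by
    rintro (_ | i)
    · exact hR0
    · by_cases hi : i < N
      · rw [hU1 i hi]
        simp only [hV, hlam, hR0, ha0, sub_zero, zero_div, intervalIntegral.integral_same, add_zero]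
        exact hmIio i hi
      · exact hU2 (i + 1) (by omega) _
  have hUsum : ∀ s ∈ Icc (0 : ℝ) 1, ∑ k ∈ Finset.range (N + 1), U k s = s * S := fun s hs => by
    rw [Finset.sum_range_succ', ← hVsum s hs, add_comm]
    exact congrArg₂ _ rfl (Finset.sum_congr rfl fun i hi => hU1 i (Finset.mem_range.1 hi) s)
  have h1I : (1 : ℝ) ∈ Icc (0 : ℝ) 1 := by simp
  set W : ℕ → ℝ → ℝ := fun k => extendLinear (U k) with hWdef
  have hWU : ∀ k, ∀ s ∈ Icc (0 : ℝ) 1, W k s = U k s := fun k s hs => extendLinear_of_mem hs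
  have hWsum1 : ∑ k ∈ Finset.range (N + 1), W k 1 = S := by
    rw [Finset.sum_congr rfl fun k _ => hWU k 1 h1I, hUsum 1 h1I, one_mul]
  have hWc : IsCompletedControl N h K W := by
    refine ⟨fun k => monotone_extendLinear (hUmono k) (hUzero k), fun k => ?_, fun k hk s => ?_,
      fun s => ?_, ?_, ?_⟩
    · rw [hWU k 0 (by simp), hUzero]
    · simp only [hWdef, extendLinear, hU2 k hk, mul_zero, ite_self]
    · rw [hWsum1]
      by_cases hs : s ∈ Icc (0 : ℝ) 1
      · rw [Finset.sum_congr rfl fun k _ => hWU k s hs, hUsum s hs]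
      · have : ∀ k, W k s = s * U k 1 := fun k => if_neg hs
        simp only [this]
        rw [← Finset.mul_sum, hUsum 1 h1I, one_mul]
    · rw [hWU 0 1 h1I]; exact hR1
    · have h2 := hUsum 1 h1I
      rw [Finset.sum_range_succ', one_mul] at h2
      have h3 : U 0 1 = h := hR1
      rw [Finset.sum_congr rfl fun k _ => hWU (k + 1) 1 h1I]
      rw [← hνreal] at hK
      linarith
  have hfiber : ∀ r ∈ Icc 0 h, {s ∈ Icc (0 : ℝ) 1 | W 0 s = r} = Icc (a r) (b r) := by
    intro r hr
    ext s
    constructor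
    · rintro ⟨hs, hsr⟩
      rw [hWU 0 s hs] at hsr
      have hsr' : R s = r := hsr
      exact ⟨hsr' ▸ hRa s hs, hsr' ▸ hRb s hs⟩
    · intro hs
      have hsI : s ∈ Icc (0 : ℝ) 1 := ⟨(ha_mem r hr).trans hs.1, hs.2.trans (hb_mem r hr)⟩
      exact ⟨hsI, (hWU 0 s hsI).trans (hRuniq s hsI r hs.1 hs.2)⟩
  have hfl : ∀ r ∈ Icc 0 h, fiberLeft (W 0) r = a r := fun r hr => by
    rw [fiberLeft, hfiber r hr, csInf_Icc (hab r)]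
  have hfr : ∀ r ∈ Icc 0 h, fiberRight (W 0) r = b r := fun r hr => by
    rw [fiberRight, hfiber r hr, csSup_Icc (hab r)]
  have hWV : ∀ r ∈ Icc 0 h, ∀ i < N, ∀ s ∈ Icc (a r) (b r), W (i + 1) s =
      (m i).real (Iio r) + ∫ σ in (0 : ℝ)..(s - a r) / (b r - a r), v r i σ := by
    intro r hr i hi s hs
    have hsI : s ∈ Icc (0 : ℝ) 1 := ⟨(ha_mem r hr).trans hs.1, hs.2.trans (hb_mem r hr)⟩
    rw [show W (i + 1) s = V i s from (hWU (i + 1) s hsI).trans (hU1 i hi s)]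
    simp only [hV, hlam, hRuniq s hsI r hs.1 hs.2]
  refine ⟨W, hWc, fun i hi => ?_, fun r hr i hi s hs => ?_⟩
  · have := hWc.isFiniteMeasure_pushDensity (i + 1)
    refine ext_of_Iic_of_carried hh.le (pushDensity_compl_Icc hWc.isTimeChange) (hm i hi)
      fun r hr => ?_
    refine (hWc.pushDensity_Iic (i + 1) hr).trans ?_
    rw [hfr r hr, show W (i + 1) (b r) = _ from hWV r hr i hi _ ⟨hab r, le_rfl⟩]
    -- in a trivial fiber the upper limit is `0 / 0 = 0`, but then there is no atom either
    have hfull : ∫ σ in (0 : ℝ)..(b r - a r) / (b r - a r), v r i σ = (m i).real {r} := by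
      rcases (hab r).eq_or_lt with heq | hlt
      · rw [heq, sub_self, div_zero, intervalIntegral.integral_same]
        have h1 := hbsub r
        rw [heq, sub_self, mul_zero, hνreal] at h1
        exact ((Finset.sum_eq_zero_iff_of_nonneg fun i _ => measureReal_nonneg).1 h1.symm i
          (Finset.mem_range.2 hi)).symm
      · rw [div_self (sub_pos.2 hlt).ne', hvm r hr i hi]
    rw [hfull, ← hjump, ofReal_measureReal]
  · rw [hfl r hr, hfr r hr] at hs ⊢
    refine (hWV r hr i hi s hs).trans ?_
    rw [show W (i + 1) (a r) = _ from hWV r hr i hi (a r) ⟨le_rfl, hab r⟩]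
    simp

/-! ### Discontinuities of functions of bounded variation -/

/-- A function of bounded variation has at most countably many discontinuities. -/
theorem BoundedVariationOn.countable_not_continuousAt {E : Type*} [PseudoMetricSpace E]
    {x : ℝ → E} {p q : ℝ} (hx : BoundedVariationOn x (Icc p q)) :
    {t ∈ Ioo p q | ¬ ContinuousAt x t}.Countable := by
  rcases le_or_gt p q with hpq | hpq
  swap
  · rw [Ioo_eq_empty (not_lt.2 hpq.le)]; simp
  have hp : p ∈ Icc p q := left_mem_Icc.2 hpq
  have hloc := hx.locallyBoundedVariationOn
  have hmono : MonotoneOn (variationOnFromTo x (Icc p q) p) (Icc p q) :=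
    variationOnFromTo.monotoneOn hloc hp
  have hcount := hmono.countable_not_continuousWithinAt
  refine Set.Countable.mono (fun t ht => ?_) hcount
  refine ⟨Ioo_subset_Icc_self ht.1, fun hv => ht.2 ?_⟩
  have hv' := hv.continuousAt (Icc_mem_nhds ht.1.1 ht.1.2)
  have hdist : ∀ s ∈ Icc p q, ∀ t ∈ Icc p q, s ≤ t → dist (x s) (x t) ≤
      variationOnFromTo x (Icc p q) p t - variationOnFromTo x (Icc p q) p s := by
    intro s hs t ht hst
    rw [← variationOnFromTo.add hloc hp hs ht, add_sub_cancel_left,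
      variationOnFromTo.eq_of_le _ _ hst, dist_edist]
    exact ENNReal.toReal_mono (hloc s t hs ht)
      (eVariationOn.edist_le _ ⟨hs, le_rfl, hst⟩ ⟨ht, hst, le_rfl⟩)
  rw [ContinuousAt, tendsto_iff_dist_tendsto_zero]
  have h0 := tendsto_iff_dist_tendsto_zero.1 hv'
  refine squeeze_zero' (.of_forall fun _ => dist_nonneg) ?_ h0
  filter_upwards [Icc_mem_nhds ht.1.1 ht.1.2] with s hs
  have htI := Ioo_subset_Icc_self ht.1
  rw [Real.dist_eq]
  rcases le_total s t with hst | hst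
  · rw [abs_sub_comm]
    exact (hdist s hs t htI hst).trans (le_abs_self _)
  · rw [dist_comm]
    exact (hdist t htI s hs hst).trans (le_abs_self _)

/-! ### Parts of an impulsive control on the delay intervals -/

noncomputable section
namespace DelaySystem
variable {n : ℕ} {D : DelaySystem n} {M : ℝ} {μ : Measure ℝ} {w : ℝ → ℕ → ℝ → ℝ}

section control
variable (hU : D.IsImpulsiveControl μ w)
include hU

/-- The total rate is a.e. constant, which bounds each rate. -/
theorem IsImpulsiveControl.exists_ae_norm_le {r : ℝ} (hr : r ∈ Icc 0 D.h) {i : ℕ}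
    (hi : i ∈ Finset.Icc 1 D.N) :
    ∃ B, ∀ᵐ s ∂(volume.restrict (Icc (0 : ℝ) 1)), ‖w r i s‖ ≤ B := by
  refine ⟨∑ i ∈ Finset.Icc 1 D.N, ∫ s' in (0 : ℝ)..1, w r i s', ?_⟩
  filter_upwards [hU.sum_eq r hr, ae_restrict_mem measurableSet_Icc] with s hs hmem
  rw [Real.norm_of_nonneg (hU.nonneg r hr i hi s hmem), ← hs]
  exact Finset.single_le_sum (f := fun i => w r i s) (fun j hj => hU.nonneg r hr j hj s hmem) hi

theorem IsImpulsiveControl.intervalIntegrable {r : ℝ} (hr : r ∈ Icc 0 D.h) {i : ℕ}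
    (hi : i ∈ Finset.Icc 1 D.N) : IntervalIntegrable (w r i) volume 0 1 := by
  obtain ⟨B, hB⟩ := hU.exists_ae_norm_le hr hi
  rw [intervalIntegrable_iff_integrableOn_Icc_of_le zero_le_one]
  exact Integrable.of_bound (hU.measurable r hr i hi).aestronglyMeasurable B hB

theorem IsImpulsiveControl.integral_nonneg {r : ℝ} (hr : r ∈ Icc 0 D.h) {i : ℕ}
    (hi : i ∈ Finset.Icc 1 D.N) : 0 ≤ ∫ s in (0 : ℝ)..1, w r i s :=
  intervalIntegral.integral_nonneg zero_le_one fun s hs => hU.nonneg r hr i hi s hs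

/-- The integral in the condition at a node may be split, also at the two end nodes, where one of
the functions vanishes by convention. -/
theorem IsImpulsiveControl.node_add (hh : 0 ≤ D.h) {k : ℕ} (hk : k ≤ D.N) :
    (∫ s in (0 : ℝ)..1, w D.h k s) + ∫ s in (0 : ℝ)..1, w 0 (k + 1) s =
      μ.real {(k : ℝ) * D.h} := by
  have hzero : ∀ φ : ℝ → ℝ, (∀ s ∈ Icc (0 : ℝ) 1, φ s = 0) → IntervalIntegrable φ volume 0 1 :=
    fun φ hφ => by
      refine (intervalIntegrable_const (c := (0 : ℝ))).congr fun s hs => ?_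
      rw [uIoc_of_le zero_le_one] at hs
      exact (hφ s ⟨hs.1.le, hs.2⟩).symm
  rw [← hU.atom_node k (by simpa using hk), intervalIntegral.integral_add]
  · rcases Nat.eq_zero_or_pos k with rfl | hk0
    · exact hzero _ hU.conv_zero
    · exact hU.intervalIntegrable ⟨hh, le_rfl⟩ (by simp; omega)
  · rcases hk.eq_or_lt with rfl | hlt
    · exact hzero _ hU.conv_last
    · exact hU.intervalIntegrable ⟨le_rfl, hh⟩ (by simp; omega)
end control

variable (D) in
/-- The part of an impulsive control that acts on the delay interval `[i h, i h + h]`, translated to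
`[0, h]`: the measure inside, and at each end the share of the atom that belongs to this
interval. -/
def delayPart (μ : Measure ℝ) (w : ℝ → ℕ → ℝ → ℝ) (i : ℕ) : Measure ℝ :=
  ENNReal.ofReal (∫ s in (0 : ℝ)..1, w 0 (i + 1) s) • Measure.dirac 0 +
    (μ.restrict (Ioo (i * D.h) (i * D.h + D.h))).map (· - i * D.h) +
    ENNReal.ofReal (∫ s in (0 : ℝ)..1, w D.h (i + 1) s) • Measure.dirac D.h

theorem isFiniteMeasure_delayPart [IsFiniteMeasure μ] (i : ℕ) :
    IsFiniteMeasure (D.delayPart μ w i) := by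
  have h1 : ∀ (c p : ℝ), IsFiniteMeasure (ENNReal.ofReal c • Measure.dirac p : Measure ℝ) :=
    fun c p => ⟨by simp⟩
  have := h1 (∫ s in (0 : ℝ)..1, w 0 (i + 1) s) 0
  have := h1 (∫ s in (0 : ℝ)..1, w D.h (i + 1) s) D.h
  unfold delayPart
  infer_instance

theorem delayPart_apply (i : ℕ) {A : Set ℝ} (hA : MeasurableSet A) :
    D.delayPart μ w i A =
      ENNReal.ofReal (∫ s in (0 : ℝ)..1, w 0 (i + 1) s) * A.indicator 1 0 +
      μ ((· - i * D.h) ⁻¹' A ∩ Ioo (i * D.h) (i * D.h + D.h)) +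
      ENNReal.ofReal (∫ s in (0 : ℝ)..1, w D.h (i + 1) s) * A.indicator 1 D.h := by
  have hm : Measurable fun t : ℝ => t - i * D.h := by fun_prop
  simp only [delayPart, Measure.coe_add, Pi.add_apply, Measure.coe_smul, Pi.smul_apply, smul_eq_mul,
    Measure.dirac_apply' _ hA, Measure.map_apply hm hA, Measure.restrict_apply (hm hA)]

theorem delayPart_compl_Icc (hh : 0 ≤ D.h) (i : ℕ) : D.delayPart μ w i (Icc 0 D.h)ᶜ = 0 := by
  rw [delayPart_apply i measurableSet_Icc.compl]
  have : (· - i * D.h) ⁻¹' (Icc 0 D.h)ᶜ ∩ Ioo (i * D.h) (i * D.h + D.h) = ∅ := by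
    rw [eq_empty_iff_forall_notMem]
    rintro t ⟨ht, ht'⟩
    exact ht ⟨by linarith [ht'.1], by linarith [ht'.2]⟩
  rw [this]
  simp [hh]

theorem restrict_Ioo_eq_map_delayPart (i : ℕ) :
    μ.restrict (Ioo (i * D.h) (i * D.h + D.h)) =
      ((D.delayPart μ w i).restrict (Ioo 0 D.h)).map (· + i * D.h) := by
  have hm : Measurable fun t : ℝ => t + i * D.h := by fun_prop
  ext A hA
  rw [Measure.map_apply hm hA, Measure.restrict_apply (hm hA), Measure.restrict_apply hA,
    delayPart_apply i ((hm hA).inter measurableSet_Ioo)]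
  have : (· - i * D.h) ⁻¹' ((· + i * D.h) ⁻¹' A ∩ Ioo 0 D.h) ∩ Ioo (i * D.h) (i * D.h + D.h) =
      A ∩ Ioo (i * D.h) (i * D.h + D.h) := by
    ext t
    simp only [mem_inter_iff, mem_preimage, sub_add_cancel, mem_Ioo]
    constructor
    · rintro ⟨⟨h1, -⟩, h2⟩; exact ⟨h1, h2⟩
    · rintro ⟨h1, h2⟩; exact ⟨⟨h1, by linarith [h2.1], by linarith [h2.2]⟩, h2⟩
  rw [this]
  simp

section control
variable (hU : D.IsImpulsiveControl μ w)
include hU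

/-- The condition on the atoms, in terms of the parts on the delay intervals. -/
theorem IsImpulsiveControl.delayPart_singleton (hh : 0 < D.h) {i : ℕ} (hi : i < D.N) {r : ℝ}
    (hr : r ∈ Icc 0 D.h) :
    (D.delayPart μ w i).real {r} = ∫ s in (0 : ℝ)..1, w r (i + 1) s := by
  have hiI : i + 1 ∈ Finset.Icc 1 D.N := by simp; omega
  have hpre : (· - i * D.h) ⁻¹' {r} ∩ Ioo (i * D.h) (i * D.h + D.h) =
      {r + i * D.h} ∩ Ioo (i * D.h) (i * D.h + D.h) := by
    congr 1; ext t; simp [sub_eq_iff_eq_add]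
  rw [Measure.real, delayPart_apply i (measurableSet_singleton r), hpre]
  rcases hr.1.eq_or_lt with rfl | h0
  · have : ({0 + i * D.h} ∩ Ioo (i * D.h) (i * D.h + D.h) : Set ℝ) = ∅ := by
      rw [eq_empty_iff_forall_notMem]
      rintro t ⟨rfl, ht⟩
      linarith [ht.1]
    rw [this]
    simp [hh.ne', ENNReal.toReal_ofReal (hU.integral_nonneg hr hiI)]
  rcases hr.2.eq_or_lt with rfl | hlt
  · have : ({D.h + i * D.h} ∩ Ioo (i * D.h) (i * D.h + D.h) : Set ℝ) = ∅ := by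
      rw [eq_empty_iff_forall_notMem]
      rintro t ⟨rfl, ht⟩
      linarith [ht.2]
    rw [this]
    simp [hh.ne, ENNReal.toReal_ofReal (hU.integral_nonneg hr hiI)]
  · have : ({r + i * D.h} ∩ Ioo (i * D.h) (i * D.h + D.h) : Set ℝ) = {r + i * D.h} :=
      inter_eq_left.2 (singleton_subset_iff.2 ⟨by linarith, by linarith⟩)
    rw [this, hU.atom_inner r ⟨h0, hlt⟩ (i + 1) hiI]
    simp [h0.ne, hlt.ne', Measure.real]

theorem IsImpulsiveControl.delayPart_univ (hh : 0 ≤ D.h) {i : ℕ} (hi : i < D.N) :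
    (D.delayPart μ w i).real univ = (∫ s in (0 : ℝ)..1, w 0 (i + 1) s) +
      μ.real (Ioo (i * D.h) (i * D.h + D.h)) + ∫ s in (0 : ℝ)..1, w D.h (i + 1) s := by
  have := hU.finite
  have hiI : i + 1 ∈ Finset.Icc 1 D.N := by simp; omega
  rw [Measure.real, delayPart_apply i MeasurableSet.univ]
  simp only [preimage_univ, univ_inter, indicator_univ, Pi.one_apply, mul_one]
  rw [ENNReal.toReal_add (by simp) (by simp), ENNReal.toReal_add (by simp) (by simp),
    ENNReal.toReal_ofReal (hU.integral_nonneg ⟨le_rfl, hh⟩ hiI),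
    ENNReal.toReal_ofReal (hU.integral_nonneg ⟨hh, le_rfl⟩ hiI)]
  rfl

/-- The parts on the delay intervals share out the mass of the control: at a node `i h`, the two
shares add up to the atom there. -/
theorem IsImpulsiveControl.sum_delayPart_le (hh : 0 < D.h) :
    ∑ i ∈ Finset.range D.N, (D.delayPart μ w i).real univ ≤ μ.real univ := by
  have := hU.finite
  have hsplit : ∀ t : ℝ, μ.real (Iic t) = μ.real (Iio t) + μ.real {t} := fun t => by
    rw [← Iio_union_right, measureReal_union (by simp) (measurableSet_singleton t)]
  have key : ∀ k ≤ D.N, ∑ i ∈ Finset.range k, (D.delayPart μ w i).real univ ≤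
      μ.real (Iio (k * D.h)) + ∫ s in (0 : ℝ)..1, w D.h k s := by
    intro k
    induction k with
    | zero =>
      intro _
      have : ∫ s in (0 : ℝ)..1, w D.h 0 s = 0 := by
        refine intervalIntegral.integral_zero_ae (.of_forall fun s hs => ?_)
        rw [uIoc_of_le zero_le_one] at hs
        exact hU.conv_zero s ⟨hs.1.le, hs.2⟩
      rw [this]
      simp
    | succ k ih =>
      intro hk
      have h1 := ih (by omega)
      have h2 := hU.node_add hh.le (k := k) (by omega)
      rw [Finset.sum_range_succ, hU.delayPart_univ hh.le (by omega)]
      have h3 : Iic (k * D.h) ∪ Ioo (k * D.h) (k * D.h + D.h) = Iio (k * D.h + D.h) :=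
        Iic_union_Ioo_eq_Iio (by linarith)
      have h4 : μ.real (Iio (k * D.h + D.h)) =
          μ.real (Iic (k * D.h)) + μ.real (Ioo (k * D.h) (k * D.h + D.h)) := by
        rw [← h3, measureReal_union _ measurableSet_Ioo]
        exact disjoint_left.2 fun t ht ht' => ht'.1.not_ge ht
      have e : ((k + 1 : ℕ) : ℝ) * D.h = k * D.h + D.h := by push_cast; ring
      rw [e, h4, hsplit]
      linarith
  refine (key D.N le_rfl).trans ?_
  have h1 := hU.node_add hh.le (k := D.N) le_rfl
  have h2 : ∫ s in (0 : ℝ)..1, w 0 (D.N + 1) s = 0 := by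
    refine intervalIntegral.integral_zero_ae (.of_forall fun s hs => ?_)
    rw [uIoc_of_le zero_le_one] at hs
    exact hU.conv_last s ⟨hs.1.le, hs.2⟩
  have h3 : μ.real (Iic (D.N * D.h)) ≤ μ.real univ := measureReal_mono (subset_univ _)
  rw [hsplit] at h3
  linarith
end control

end DelaySystem
end

/-! ### Gluing the attached functions -/

noncomputable section
namespace DelaySystem
variable {n : ℕ} {D : DelaySystem n} {M K : ℝ} {μ : Measure ℝ} {w : ℝ → ℕ → ℝ → ℝ}
  {x : ℝ → EuclideanSpace ℝ (Fin n)} {ζ : ℝ → ℕ → ℝ → EuclideanSpace ℝ (Fin n)} {W : ℕ → ℝ → ℝ}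

variable (D) in
/-- A completed control `W` that parametrizes the impulsive control `(μ, w)`: on each delay interval
it carries the measure, and it spends the atom at `r` at the rates `w r`, rescaled to the fiber
over `r`. -/
structure IsGraphCompletion (K : ℝ) (μ : Measure ℝ) (w : ℝ → ℕ → ℝ → ℝ) (W : ℕ → ℝ → ℝ) : Prop where
  control : IsCompletedControl D.N D.h K W
  interior : ∀ i < D.N, μ.restrict (Ioo (i * D.h) (i * D.h + D.h)) =
    ((pushDensity (W 0) (deriv (W (i + 1)))).restrict (Ioo 0 D.h)).map (· + i * D.h)
  atom : ∀ r ∈ Icc 0 D.h, ∀ i < D.N,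
    ∫ σ in (0 : ℝ)..1, w r (i + 1) σ =
      W (i + 1) (fiberRight (W 0) r) - W (i + 1) (fiberLeft (W 0) r)
  spending : ∀ r ∈ Icc 0 D.h, ∀ i < D.N, ∀ s ∈ Icc (fiberLeft (W 0) r) (fiberRight (W 0) r),
    W (i + 1) s = W (i + 1) (fiberLeft (W 0) r) +
      ∫ σ in (0 : ℝ)..(s - fiberLeft (W 0) r) / (fiberRight (W 0) r - fiberLeft (W 0) r),
        w r (i + 1) σ

theorem IsImpulsiveControl.exists_isGraphCompletion (hU : D.IsImpulsiveControl μ w) (hh : 0 < D.h)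
    (hK : μ.real univ ≤ K) : ∃ W, D.IsGraphCompletion K μ w W := by
  have := hU.finite
  have := fun i => isFiniteMeasure_delayPart (D := D) (μ := μ) (w := w) i
  have hI : ∀ i < D.N, i + 1 ∈ Finset.Icc 1 D.N := fun i hi => by simp; omega
  have hshift : ∀ φ : ℕ → ℝ, ∑ i ∈ Finset.Icc 1 D.N, φ i = ∑ i ∈ Finset.range D.N, φ (i + 1) :=
    fun φ => by
      rw [Finset.range_eq_Ico, Finset.sum_Ico_add' φ 0 D.N 1]
      rfl
  obtain ⟨W, hW, hpush, hfib⟩ := exists_isCompletedControl_of_measures hh (D.delayPart μ w)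
    (fun i _ => delayPart_compl_Icc hh.le i) ((hU.sum_delayPart_le hh).trans hK)
    (fun r i => w r (i + 1)) (fun r hr i hi s hs => hU.nonneg r hr _ (hI i hi) s hs)
    (fun r hr i hi => hU.intervalIntegrable hr (hI i hi))
    (fun r hr i hi => (hU.delayPart_singleton hh hi hr).symm)
    (fun r hr => by
      filter_upwards [hU.sum_eq r hr] with s hs
      rw [hshift, hshift] at hs
      rw [hs]
      exact Finset.sum_congr rfl fun i hi =>
        (hU.delayPart_singleton hh (Finset.mem_range.1 hi) hr).symm)
  refine ⟨W, hW, fun i hi => ?_, fun r hr i hi => ?_, hfib⟩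
  · rw [hpush i hi]; exact restrict_Ioo_eq_map_delayPart i
  · rw [← hW.pushDensity_singleton (i + 1) hr, hpush i hi, hU.delayPart_singleton hh hi hr]

variable (D) in
/-- The attached functions with the convention `ζ^r_0 ≡ ξ₀`, which changes `ζ^h_0` at the single
point `1`. -/
def atomTraj (ζ : ℝ → ℕ → ℝ → EuclideanSpace ℝ (Fin n)) (r : ℝ) (i : ℕ) (s : ℝ) :
    EuclideanSpace ℝ (Fin n) :=
  if i = 0 then D.ξ₀ else ζ r i s

variable (D) in
/-- The attached functions of all atoms, each run on the fiber over its time. -/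
def glued (R : ℝ → ℝ) (ζ : ℝ → ℕ → ℝ → EuclideanSpace ℝ (Fin n)) (i : ℕ) (s : ℝ) :
    EuclideanSpace ℝ (Fin n) :=
  D.atomTraj ζ (R s) i ((s - fiberLeft R (R s)) / (fiberRight R (R s) - fiberLeft R (R s)))

theorem atomTraj_succ (r : ℝ) (i : ℕ) (s : ℝ) : D.atomTraj ζ r (i + 1) s = ζ r (i + 1) s :=
  if_neg (Nat.succ_ne_zero i)

theorem glued_zero (R : ℝ → ℝ) (s : ℝ) : D.glued R ζ 0 s = D.ξ₀ := by
  simp [glued, atomTraj]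

theorem glued_of_mem {R : ℝ → ℝ} (hR : IsTimeChange D.h R) {r : ℝ} (hr : r ∈ Icc 0 D.h) {s : ℝ}
    (hs : s ∈ Icc (fiberLeft R r) (fiberRight R r)) (i : ℕ) :
    D.glued R ζ i s =
      D.atomTraj ζ r i ((s - fiberLeft R r) / (fiberRight R r - fiberLeft R r)) := by
  rw [glued, hR.apply_of_mem_fiber hr hs]

theorem glued_fiberLeft {R : ℝ → ℝ} (hR : IsTimeChange D.h R) {r : ℝ} (hr : r ∈ Icc 0 D.h) (i : ℕ) :
    D.glued R ζ (i + 1) (fiberLeft R r) = ζ r (i + 1) 0 := by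
  rw [glued_of_mem hR hr ⟨le_rfl, hR.fiberLeft_le_fiberRight hr⟩, sub_self, zero_div, atomTraj_succ]

section attached
variable (hg : Continuous (Function.uncurry D.g)) (hgM : ∀ a b, ‖D.g a b‖ ≤ M)
  (hU : D.IsImpulsiveControl μ w) (hA : D.IsAttached x w ζ)

include hA in
theorem IsAttached.continuousOn_atomTraj {r : ℝ} (hr : r ∈ Icc 0 D.h) {i : ℕ} (hi : i ≤ D.N) :
    ContinuousOn (D.atomTraj ζ r i) (Icc 0 1) := by
  rcases i with _ | i
  · exact continuousOn_const
  · have := (hA.absCont r hr (i + 1) (by simp; omega)).continuousOn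
    rw [uIcc_of_le zero_le_one] at this
    exact this.congr fun s _ => atomTraj_succ r i s

include hA in
theorem IsAttached.continuousOn_comp {F : EuclideanSpace ℝ (Fin n) → EuclideanSpace ℝ (Fin n) →
    EuclideanSpace ℝ (Fin n)} (hF : Continuous (Function.uncurry F)) {r : ℝ} (hr : r ∈ Icc 0 D.h)
    {i : ℕ} (hi : i < D.N) :
    ContinuousOn (fun σ => F (D.atomTraj ζ r (i + 1) σ) (D.atomTraj ζ r i σ)) (Icc 0 1) :=
  hF.comp_continuousOn
    ((hA.continuousOn_atomTraj hr hi).prodMk (hA.continuousOn_atomTraj hr hi.le))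

include hg hU hA in
theorem IsAttached.eq_add_integral {r : ℝ} (hr : r ∈ Icc 0 D.h) {i : ℕ} (hi : i < D.N) :
    ∀ s ∈ Icc (0 : ℝ) 1, ζ r (i + 1) s = ζ r (i + 1) 0 + ∫ σ in (0 : ℝ)..s,
      w r (i + 1) σ • D.g (D.atomTraj ζ r (i + 1) σ) (D.atomTraj ζ r i σ) := by
  have hiI : i + 1 ∈ Finset.Icc 1 D.N := by simp; omega
  obtain ⟨B, hB⟩ := hU.exists_ae_norm_le hr hiI
  have hc := hA.continuousOn_comp hg hr hi
  obtain ⟨G, hG⟩ := isCompact_Icc.exists_bound_of_continuousOn hc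
  refine AbsolutelyContinuousOnInterval.eq_add_integral_of_ae_hasDerivAt (B := B * G)
    (hA.absCont r hr _ hiI) ?_ ?_ ?_
  · have h1 : ∀ᵐ s ∂(volume.restrict (Icc (0 : ℝ) 1)), s ≠ 1 :=
      ae_restrict_of_ae (by simp [ae_iff, measure_singleton])
    filter_upwards [hA.ode r hr _ hiI, h1, ae_restrict_mem measurableSet_Icc] with s hs hs1 hmem
    rw [Nat.add_sub_cancel] at hs
    rw [atomTraj_succ]
    have : D.atomTraj ζ r i s = ζ r i s := by
      rcases i with _ | i
      · exact (hA.zero_eq r hr s hmem (Or.inl (lt_of_le_of_ne hmem.2 hs1))).symm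
      · exact atomTraj_succ r i s
    rw [this]
    exact hs
  · filter_upwards [hB, ae_restrict_mem measurableSet_Icc] with s hs hmem
    rw [norm_smul]
    exact mul_le_mul hs (hG s hmem) (norm_nonneg _) ((norm_nonneg _).trans hs)
  · exact (hU.measurable r hr _ hiI).aestronglyMeasurable.smul
      (hc.aestronglyMeasurable measurableSet_Icc)

include hg hgM hU hA in
/-- Without an atom, the attached functions do not move. -/
theorem IsAttached.apply_one_of_integral_eq_zero {r : ℝ} (hr : r ∈ Icc 0 D.h) {i : ℕ}
    (hi : i < D.N) (h0 : ∫ σ in (0 : ℝ)..1, w r (i + 1) σ = 0) :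
    ζ r (i + 1) 1 = ζ r (i + 1) 0 := by
  have hiI : i + 1 ∈ Finset.Icc 1 D.N := by simp; omega
  rw [hA.eq_add_integral hg hU hr hi 1 (by simp), add_eq_left, ← norm_le_zero_iff]
  have hint := hU.intervalIntegrable hr hiI
  refine (intervalIntegral.norm_integral_le_of_norm_le zero_le_one (g := fun σ => w r (i + 1) σ * M)
    ?_ (hint.mul_const M)).trans ?_
  · refine .of_forall fun σ hσ => ?_
    have := hU.nonneg r hr _ hiI σ ⟨hσ.1.le, hσ.2⟩
    rw [norm_smul, Real.norm_of_nonneg this]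
    exact mul_le_mul_of_nonneg_left (hgM _ _) this
  · rw [intervalIntegral.integral_mul_const, h0, zero_mul]

end attached

section fiber
variable (hg : Continuous (Function.uncurry D.g)) (hgM : ∀ a b, ‖D.g a b‖ ≤ M)
  (hU : D.IsImpulsiveControl μ w) (hA : D.IsAttached x w ζ) (hW : D.IsGraphCompletion K μ w W)

include hg hgM hU hA hW in
/-- If the fiber is a single point, the glued state there is `ζ^r (0)`; this is `ζ^r (1)` as there
is no atom at `r`. -/
theorem IsGraphCompletion.glued_fiberRight {r : ℝ} (hr : r ∈ Icc 0 D.h) {i : ℕ} (hi : i < D.N) :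
    D.glued (W 0) ζ (i + 1) (fiberRight (W 0) r) = ζ r (i + 1) 1 := by
  have hR := hW.control.isTimeChange
  have hab := hR.fiberLeft_le_fiberRight hr
  rw [glued_of_mem hR hr ⟨hab, le_rfl⟩, atomTraj_succ]
  rcases hab.eq_or_lt with heq | hlt
  · have h0 := hW.atom r hr i hi
    rw [heq, sub_self] at h0
    rw [heq, sub_self, div_zero, hA.apply_one_of_integral_eq_zero hg hgM hU hr hi h0]
  · rw [div_self (sub_pos.2 hlt).ne']

include hA hW in
theorem IsGraphCompletion.aestronglyMeasurable_comp_glued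
    {F : EuclideanSpace ℝ (Fin n) → EuclideanSpace ℝ (Fin n) → EuclideanSpace ℝ (Fin n)}
    (hF : Continuous (Function.uncurry F)) {r : ℝ} (hr : r ∈ Icc 0 D.h) {i : ℕ} (hi : i < D.N) :
    AEStronglyMeasurable (fun s => F (D.glued (W 0) ζ (i + 1) s) (D.glued (W 0) ζ i s))
      (volume.restrict (Icc (fiberLeft (W 0) r) (fiberRight (W 0) r))) := by
  have hR := hW.control.isTimeChange
  have hab := hR.fiberLeft_le_fiberRight hr
  set a := fiberLeft (W 0) r with ha
  set b := fiberRight (W 0) r with hb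
  have hmaps : MapsTo (fun s => (s - a) / (b - a)) (Icc a b) (Icc 0 1) := fun s hs =>
    ⟨div_nonneg (sub_nonneg.2 hs.1) (sub_nonneg.2 hab),
      div_le_one_of_le₀ (by linarith [hs.2]) (sub_nonneg.2 hab)⟩
  have hcont : Continuous fun s : ℝ => (s - a) / (b - a) := by fun_prop
  refine AEStronglyMeasurable.congr (((hA.continuousOn_comp hF hr hi).comp hcont.continuousOn
    hmaps).aestronglyMeasurable measurableSet_Icc) ?_
  filter_upwards [ae_restrict_mem measurableSet_Icc] with s hs
  rw [glued_of_mem hR hr hs, glued_of_mem hR hr hs]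
  rfl

include hU hW in
/-- Inside the fiber over `r` a completed control runs at the rescaled rates `w r`. -/
theorem IsGraphCompletion.ae_deriv_eq {r : ℝ} (hr : r ∈ Icc 0 D.h) {i : ℕ} (hi : i < D.N)
    (hlt : fiberLeft (W 0) r < fiberRight (W 0) r) :
    ∀ᵐ s, s ∈ Ioo (fiberLeft (W 0) r) (fiberRight (W 0) r) → deriv (W (i + 1)) s =
      (fiberRight (W 0) r - fiberLeft (W 0) r)⁻¹ *
        w r (i + 1) (s / (fiberRight (W 0) r - fiberLeft (W 0) r) -
          fiberLeft (W 0) r / (fiberRight (W 0) r - fiberLeft (W 0) r)) := by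
  have hfib := hW.spending r hr i hi
  set a := fiberLeft (W 0) r with ha
  set b := fiberRight (W 0) r with hb
  have hl : 0 < b - a := sub_pos.2 hlt
  have hint := hU.intervalIntegrable hr (i := i + 1) (by simp; omega)
  filter_upwards [ae_comp_affine (a := -(a / (b - a))) (c := (b - a)⁻¹) (inv_pos.2 hl).ne'
    hint.ae_hasDerivAt_integral] with s hs hmem
  have e : ∀ s, -(a / (b - a)) + (b - a)⁻¹ * s = (s - a) / (b - a) := fun s => by
    field_simp; ring
  have e' : s / (b - a) - a / (b - a) = (s - a) / (b - a) := by rw [sub_div]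
  rw [e, uIcc_of_le zero_le_one] at hs
  have hin : (s - a) / (b - a) ∈ Icc (0 : ℝ) 1 :=
    ⟨div_nonneg (sub_nonneg.2 hmem.1.le) hl.le, div_le_one_of_le₀ (by linarith [hmem.2]) hl.le⟩
  have haff : HasDerivAt (fun s : ℝ => (s - a) / (b - a)) ((b - a)⁻¹) s := by
    simpa using ((hasDerivAt_id s).sub_const a).div_const (b - a)
  have hd := ((hs hin 0 (by simp)).comp s haff).const_add (W (i + 1) a)
  rw [e', mul_comm]
  refine (hd.congr_of_eventuallyEq ?_).deriv
  filter_upwards [Ioo_mem_nhds hmem.1 hmem.2] with t ht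
  exact hfib t ⟨ht.1.le, ht.2.le⟩

include hg hgM hU hA hW in
/-- On the fiber over `r`, the glued state solves the equation of the attached functions. -/
theorem IsGraphCompletion.integral_fiber {r : ℝ} (hr : r ∈ Icc 0 D.h) {i : ℕ} (hi : i < D.N) {s : ℝ}
    (hs : s ∈ Icc (fiberLeft (W 0) r) (fiberRight (W 0) r)) :
    IntervalIntegrable (fun σ => deriv (W (i + 1)) σ •
      D.g (D.glued (W 0) ζ (i + 1) σ) (D.glued (W 0) ζ i σ)) volume (fiberLeft (W 0) r) s ∧
    ∫ σ in fiberLeft (W 0) r..s, deriv (W (i + 1)) σ •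
      D.g (D.glued (W 0) ζ (i + 1) σ) (D.glued (W 0) ζ i σ) =
        D.glued (W 0) ζ (i + 1) s - ζ r (i + 1) 0 := by
  have hR := hW.control.isTimeChange
  have hM : 0 ≤ M := (norm_nonneg _).trans (hgM 0 0)
  constructor
  · rw [intervalIntegrable_iff_integrableOn_Ioc_of_le hs.1]
    refine Integrable.of_bound (μ := volume.restrict (Ioc (fiberLeft (W 0) r) s)) ?_
      ((D.h + K) * M) (.of_forall fun σ => ?_)
    · have hsub : Ioc (fiberLeft (W 0) r) s ⊆ Icc (fiberLeft (W 0) r) (fiberRight (W 0) r) :=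
        fun σ hσ => ⟨hσ.1.le, hσ.2.trans hs.2⟩
      exact (measurable_deriv (W (i + 1))).aestronglyMeasurable.smul
        ((hW.aestronglyMeasurable_comp_glued hA hg hr hi).mono_measure
          (Measure.restrict_mono_set volume hsub))
    · rw [norm_smul]
      exact mul_le_mul (hW.control.norm_deriv_le _ _) (hgM _ _) (norm_nonneg _)
        hW.control.speed_nonneg
  · rw [glued_of_mem hR hr hs, atomTraj_succ]
    rcases (hR.fiberLeft_le_fiberRight hr).eq_or_lt with heq | hlt
    · rw [← heq] at hs
      rw [le_antisymm hs.2 hs.1, intervalIntegral.integral_same, sub_self, zero_div, sub_self]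
    have hder := hW.ae_deriv_eq hU hr hi hlt
    have hgl := fun σ (hσ : σ ∈ Icc (fiberLeft (W 0) r) (fiberRight (W 0) r)) (j : ℕ) =>
      glued_of_mem (ζ := ζ) hR hr hσ j
    set a := fiberLeft (W 0) r with ha
    set b := fiberRight (W 0) r with hb
    have hl : 0 < b - a := sub_pos.2 hlt
    have hin : (s - a) / (b - a) ∈ Icc (0 : ℝ) 1 :=
      ⟨div_nonneg (sub_nonneg.2 hs.1) hl.le, div_le_one_of_le₀ (by linarith [hs.2]) hl.le⟩
    rw [hA.eq_add_integral hg hU hr hi _ hin, add_sub_cancel_left]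
    set φ : ℝ → EuclideanSpace ℝ (Fin n) := fun σ =>
      w r (i + 1) σ • D.g (D.atomTraj ζ r (i + 1) σ) (D.atomTraj ζ r i σ) with hφ
    have h1 := intervalIntegral.inv_smul_integral_comp_div_sub (a := a) (b := s) φ (b - a)
      (a / (b - a))
    rw [sub_self, ← sub_div] at h1
    rw [← h1, ← intervalIntegral.integral_smul]
    refine intervalIntegral.integral_congr_ae ?_
    have hne : ∀ᵐ s : ℝ, s ≠ b := by simp [ae_iff, measure_singleton]
    filter_upwards [hder, hne] with σ hσ hσb hmem
    rw [uIoc_of_le hs.1] at hmem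
    have hσI : σ ∈ Icc a b := ⟨hmem.1.le, hmem.2.trans hs.2⟩
    rw [hσ ⟨hmem.1, lt_of_le_of_ne hσI.2 hσb⟩, hgl σ hσI, hgl σ hσI, hφ, smul_smul, sub_div]

include hg hgM hU hA hW in
theorem IsGraphCompletion.integral_velocity_fiber {r : ℝ} (hr : r ∈ Icc 0 D.h) {i : ℕ}
    (hi : i < D.N) {s : ℝ} (hs : s ∈ Icc (fiberLeft (W 0) r) (fiberRight (W 0) r)) :
    IntervalIntegrable (D.velocity W (D.glued (W 0) ζ) i) volume (fiberLeft (W 0) r) s ∧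
    ∫ σ in fiberLeft (W 0) r..s, D.velocity W (D.glued (W 0) ζ) i σ =
      D.glued (W 0) ζ (i + 1) s - ζ r (i + 1) 0 := by
  obtain ⟨h1, h2⟩ := hW.integral_fiber hg hgM hU hA hr hi hs
  have hae : ∀ᵐ σ, σ ∈ uIoc (fiberLeft (W 0) r) s → deriv (W (i + 1)) σ •
      D.g (D.glued (W 0) ζ (i + 1) σ) (D.glued (W 0) ζ i σ) =
        D.velocity W (D.glued (W 0) ζ) i σ := by
    have hne : ∀ᵐ s : ℝ, s ≠ fiberRight (W 0) r := by simp [ae_iff, measure_singleton]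
    filter_upwards [hne] with σ hσb hmem
    rw [uIoc_of_le hs.1] at hmem
    rw [velocity, hW.control.deriv_time_eq_zero hr
      ⟨hmem.1, lt_of_le_of_ne (hmem.2.trans hs.2) hσb⟩, zero_smul, zero_add]
  exact ⟨h1.congr_ae ((ae_restrict_iff' measurableSet_uIoc).2 hae),
    (intervalIntegral.integral_congr_ae hae).symm.trans h2⟩

end fiber
end DelaySystem
end

/-! ### The glued state as a completed trajectory -/

noncomputable section
namespace DelaySystem
variable {n : ℕ} {D : DelaySystem n} {M K : ℝ} {μ : Measure ℝ} {w : ℝ → ℕ → ℝ → ℝ}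
  {x : ℝ → EuclideanSpace ℝ (Fin n)} {ζ : ℝ → ℕ → ℝ → EuclideanSpace ℝ (Fin n)} {W : ℕ → ℝ → ℝ}

/-- The initial value at `r > 0` is a left limit of the state; delay intervals are counted from `0`. -/
theorem IsAttached.apply_zero (hA : D.IsAttached x w ζ) {r : ℝ} (hr : r ∈ Ioc 0 D.h) {i : ℕ}
    (hi : i < D.N) : ζ r (i + 1) 0 = Function.leftLim x (r + i * D.h) := by
  have := hA.init_pos r hr (i + 1) (by simp; omega)
  rwa [show (((i + 1 : ℕ) : ℝ) - 1) * D.h = i * D.h by push_cast; ring] at this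

variable (D) in
/-- The exceptional times of a delay interval: its end, the atoms, and the discontinuities of the
state and of the delayed state. -/
def exceptionalTimes (R : ℝ → ℝ) (x : ℝ → EuclideanSpace ℝ (Fin n)) (i : ℕ) : Set ℝ :=
  {D.h} ∪ {r ∈ Icc 0 D.h | fiberLeft R r < fiberRight R r} ∪
    ({r ∈ Ioo 0 D.h | ¬ ContinuousAt x (r + i * D.h)} ∪
      {r ∈ Ioo 0 D.h | ¬ ContinuousAt x (r + i * D.h - D.h)})

theorem countable_exceptionalTimes {R : ℝ → ℝ} (hR : IsTimeChange D.h R)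
    (hx : BoundedVariationOn x (Icc (-D.h) D.T)) (hh : 0 < D.h) {i : ℕ} (hi : i < D.N) :
    (D.exceptionalTimes R x i).Countable := by
  have hiN : (i : ℝ) + 1 ≤ D.N := by exact_mod_cast hi
  have h0 : (0 : ℝ) ≤ i * D.h := by positivity
  have hT : i * D.h + D.h ≤ D.T := by rw [T]; nlinarith
  have hc := hx.countable_not_continuousAt
  refine ((countable_singleton _).union hR.countable_nontrivial_fibers).union
    (Countable.union ?_ ?_)
  · refine (hc.preimage (add_left_injective (i * D.h))).mono fun r hr => ?_
    exact ⟨⟨by linarith [hr.1.1], by linarith [hr.1.2]⟩, hr.2⟩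
  · have hinj : Function.Injective fun r : ℝ => r + i * D.h - D.h := fun r r' h => by
      simpa using h
    refine (hc.preimage hinj).mono fun r hr => ?_
    exact ⟨⟨by linarith [hr.1.1], by linarith [hr.1.2]⟩, hr.2⟩

section
variable (hf : Continuous (Function.uncurry D.f)) (hg : Continuous (Function.uncurry D.g))
  (hfM : ∀ a b, ‖D.f a b‖ ≤ M) (hgM : ∀ a b, ‖D.g a b‖ ≤ M)
  (hh : 0 < D.h) (hx : BoundedVariationOn x (Icc (-D.h) D.T))
  (hhist : ∀ t ∈ Ico (-D.h) 0, x t = D.ξ₀) (hA : D.IsAttached x w ζ)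
  (hW : D.IsGraphCompletion K μ w W)

include hhist hA hW in
/-- Away from the exceptional times, the glued state at the parameter `s` is the state at the time
of `s`, and likewise for the delayed state. -/
theorem IsGraphCompletion.glued_eq {i : ℕ} (hi : i < D.N) {s : ℝ} (hs : s ∈ Ioc (0 : ℝ) 1)
    (hr : W 0 s ∈ Ioc 0 D.h \ D.exceptionalTimes (W 0) x i) :
    D.glued (W 0) ζ (i + 1) s = x (W 0 s + i * D.h) ∧
      D.glued (W 0) ζ i s = x (W 0 s + i * D.h - D.h) := by
  have hR := hW.control.isTimeChange
  have hsI : s ∈ Icc (0 : ℝ) 1 := ⟨hs.1.le, hs.2⟩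
  obtain ⟨hr0, hrC⟩ := hr
  have hl := hR.fiberLeft_le hsI
  have hu := hR.le_fiberRight hsI
  set r := W 0 s with hrdef
  have hrI : r ∈ Icc 0 D.h := ⟨hr0.1.le, hr0.2⟩
  have hne : r ≠ D.h := fun h => hrC (Or.inl (Or.inl h))
  have hroo : r ∈ Ioo 0 D.h := ⟨hr0.1, lt_of_le_of_ne hr0.2 hne⟩
  have hle : fiberRight (W 0) r ≤ fiberLeft (W 0) r := by
    by_contra! hlt
    exact hrC (Or.inl (Or.inr ⟨hrI, hlt⟩))
  have hc1 : ContinuousAt x (r + i * D.h) := by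
    by_contra hc
    exact hrC (Or.inr (Or.inl ⟨hroo, hc⟩))
  have hc2 : ContinuousAt x (r + i * D.h - D.h) := by
    by_contra hc
    exact hrC (Or.inr (Or.inr ⟨hroo, hc⟩))
  have hsa : s = fiberLeft (W 0) r := le_antisymm (hu.trans hle) hl
  rw [hsa, glued_fiberLeft hR hrI, hA.apply_zero hr0 hi]
  refine ⟨leftLim_eq_of_tendsto hc1.continuousWithinAt, ?_⟩
  rcases i with _ | i
  · rw [glued_zero, hhist]
    push_cast
    constructor <;> linarith [hroo.1, hroo.2]
  · rw [glued_fiberLeft hR hrI, hA.apply_zero hr0 (by omega)]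
    have e : r + ((i + 1 : ℕ) : ℝ) * D.h - D.h = r + i * D.h := by push_cast; ring
    rw [e] at hc2 ⊢
    exact leftLim_eq_of_tendsto hc2.continuousWithinAt

include hf hg hfM hgM hh hx hhist hA hW in
/-- The velocity of the glued state, integrated over the parameters of the times in `(0, ρ]`, in terms
of the state of the process. The states enter through their values at the non-exceptional times only. -/
theorem IsGraphCompletion.integral_velocity {i : ℕ} (hi : i < D.N) {ρ : ℝ} (hρ : ρ ∈ Icc 0 D.h) :
    IntegrableOn (D.velocity W (D.glued (W 0) ζ) i)
        (Ioc (fiberRight (W 0) 0) (fiberRight (W 0) ρ)) ∧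
      ∫ s in fiberRight (W 0) 0..fiberRight (W 0) ρ, D.velocity W (D.glued (W 0) ζ) i s =
      (∫ r in (0 : ℝ)..ρ, D.f (x (r + i * D.h)) (x (r + i * D.h - D.h))) +
      (∫ r in Ioc 0 ρ, D.g (x (r + i * D.h)) (x (r + i * D.h - D.h))
        ∂(continuousPart (pushDensity (W 0) (deriv (W (i + 1)))))) +
      ∑' r : Ioc (0 : ℝ) ρ, ∫ s in fiberLeft (W 0) r..fiberRight (W 0) r,
        deriv (W (i + 1)) s • D.g (D.glued (W 0) ζ (i + 1) s) (D.glued (W 0) ζ i s) := by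
  have hR := hW.control.isTimeChange
  set C := D.exceptionalTimes (W 0) x i with hC
  have hCc : C.Countable := countable_exceptionalTimes hR hx hh hi
  have hroo : ∀ r ∈ Ioc 0 ρ \ C, r ∈ Ioo 0 D.h := fun r hr =>
    ⟨hr.1.1, lt_of_le_of_ne (hr.1.2.trans hρ.2) fun h => hr.2 (Or.inl (Or.inl h))⟩
  have hmeas : ∀ F : EuclideanSpace ℝ (Fin n) → EuclideanSpace ℝ (Fin n) →
      EuclideanSpace ℝ (Fin n), Continuous (Function.uncurry F) → ∀ κ : Measure ℝ,
      AEStronglyMeasurable (fun r => F (x (r + i * D.h)) (x (r + i * D.h - D.h)))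
        (κ.restrict (Ioc 0 ρ \ C)) := by
    intro F hF κ
    refine ContinuousOn.aestronglyMeasurable (fun r hr => ContinuousAt.continuousWithinAt ?_)
      (measurableSet_Ioc.diff hCc.measurableSet)
    have hc1 : ContinuousAt x (r + i * D.h) := by
      by_contra hc
      exact hr.2 (Or.inr (Or.inl ⟨hroo r hr, hc⟩))
    have hc2 : ContinuousAt x (r + i * D.h - D.h) := by
      by_contra hc
      exact hr.2 (Or.inr (Or.inr ⟨hroo r hr, hc⟩))
    have h1 : ContinuousAt (fun r : ℝ => x (r + i * D.h)) r :=
      ContinuousAt.comp (f := fun r : ℝ => r + i * D.h) hc1 (by fun_prop)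
    have h2 : ContinuousAt (fun r : ℝ => x (r + i * D.h - D.h)) r :=
      ContinuousAt.comp (f := fun r : ℝ => r + i * D.h - D.h) hc2 (by fun_prop)
    exact hF.continuousAt.comp (h1.prodMk h2)
  have hIoc : ∀ r ∈ Ioc 0 ρ, r ∈ Icc 0 D.h := fun r hr => ⟨hr.1.le, hr.2.trans hρ.2⟩
  have hglue := fun s (hs : s ∈ Ioc (0 : ℝ) 1) (hsr : W 0 s ∈ Ioc 0 ρ \ C) =>
    hW.glued_eq hhist hA hi hs ⟨⟨hsr.1.1, hsr.1.2.trans hρ.2⟩, hsr.2⟩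
  exact hW.control.integral_velocity_eq (i + 1) hρ hCc
    (fun r hr hrC => by
      by_contra hne
      exact hrC (Or.inl (Or.inr ⟨hIoc r hr,
        lt_of_le_of_ne (hR.fiberLeft_le_fiberRight (hIoc r hr)) hne⟩)))
    (Ff := fun s => D.f (D.glued (W 0) ζ (i + 1) s) (D.glued (W 0) ζ i s))
    (Fg := fun s => D.g (D.glued (W 0) ζ (i + 1) s) (D.glued (W 0) ζ i s))
    (fun s => hfM _ _) (fun s => hgM _ _)
    (fun r hr => hW.aestronglyMeasurable_comp_glued hA hf (hIoc r hr) hi)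
    (fun r hr => hW.aestronglyMeasurable_comp_glued hA hg (hIoc r hr) hi)
    (hmeas D.f hf) (hmeas D.g hg)
    (fun s hs hsr => by simp only [(hglue s hs hsr).1, (hglue s hs hsr).2])
    (fun s hs hsr => by simp only [(hglue s hs hsr).1, (hglue s hs hsr).2])

variable (hU : D.IsImpulsiveControl μ w)

include hf hg hfM hgM hh hx hhist hA hW hU in
theorem IsGraphCompletion.intervalIntegrable_velocity {i : ℕ} (hi : i < D.N) :
    IntervalIntegrable (D.velocity W (D.glued (W 0) ζ) i) volume 0 1 := by
  have hR := hW.control.isTimeChange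
  have h0 : (0 : ℝ) ∈ Icc 0 D.h := ⟨le_rfl, hh.le⟩
  have h1 : D.h ∈ Icc 0 D.h := ⟨hh.le, le_rfl⟩
  have hfirst := (hW.integral_velocity_fiber hg hgM hU hA h0 hi
    ⟨hR.fiberLeft_le_fiberRight h0, le_rfl⟩).1
  rw [hR.fiberLeft_zero] at hfirst
  have hsecond := (hW.integral_velocity hf hg hfM hgM hh hx hhist hA hi h1).1
  rw [hR.fiberRight_one] at hsecond
  exact hfirst.trans ((intervalIntegrable_iff_integrableOn_Ioc_of_le
    (hR.fiberRight_mem h0).1.2).2 hsecond)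

variable (hdyn : ∀ i < D.N, ∀ ρ ∈ Ioo 0 D.h, x (ρ + i * D.h) = ζ 0 (i + 1) 1
    + (∫ t' in (i * D.h : ℝ)..(ρ + i * D.h), D.f (x t') (x (t' - D.h)))
    + (∫ t' in Icc (i * D.h : ℝ) (ρ + i * D.h), D.g (x t') (x (t' - D.h)) ∂(continuousPart μ))
    + ∑' r : Ioc (0 : ℝ) ρ, (ζ r (i + 1) 1 - Function.leftLim x ((r : ℝ) + i * D.h)))

include hf hg hfM hgM hh hx hhist hA hW hU hdyn

/-- Inside a delay interval, the state is the integral of the velocity of the glued state. -/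
theorem IsGraphCompletion.apply_add {i : ℕ} (hi : i < D.N) {ρ : ℝ} (hρ : ρ ∈ Ioo 0 D.h) :
    x (ρ + i * D.h) = ζ 0 (i + 1) 1 + ∫ s in fiberRight (W 0) 0..fiberRight (W 0) ρ,
      D.velocity W (D.glued (W 0) ζ) i s := by
  have hR := hW.control.isTimeChange
  rw [hdyn i hi ρ hρ, (hW.integral_velocity hf hg hfM hgM hh hx hhist hA hi ⟨hρ.1.le, hρ.2.le⟩).2]
  have e1 : ∫ t' in (i * D.h : ℝ)..(ρ + i * D.h), D.f (x t') (x (t' - D.h)) =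
      ∫ r in (0 : ℝ)..ρ, D.f (x (r + i * D.h)) (x (r + i * D.h - D.h)) := by
    have := intervalIntegral.integral_comp_add_right (a := 0) (b := ρ)
      (fun t' => D.f (x t') (x (t' - D.h))) (i * D.h)
    rw [zero_add] at this
    exact this.symm
  have e2 : ∫ t' in Icc (i * D.h : ℝ) (ρ + i * D.h), D.g (x t') (x (t' - D.h))
        ∂(continuousPart μ) =
      ∫ r in Ioc 0 ρ, D.g (x (r + i * D.h)) (x (r + i * D.h - D.h))
        ∂(continuousPart (pushDensity (W 0) (deriv (W (i + 1))))) := by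
    rw [add_comm ρ, setIntegral_continuousPart_shift (hW.interior i hi) hρ]
  have e3 : ∑' r : Ioc (0 : ℝ) ρ, (ζ r (i + 1) 1 - Function.leftLim x ((r : ℝ) + i * D.h)) =
      ∑' r : Ioc (0 : ℝ) ρ, ∫ s in fiberLeft (W 0) r..fiberRight (W 0) r,
        deriv (W (i + 1)) s • D.g (D.glued (W 0) ζ (i + 1) s) (D.glued (W 0) ζ i s) := by
    refine tsum_congr fun r => ?_
    have hr : (r : ℝ) ∈ Ioc 0 D.h := ⟨r.2.1, r.2.2.trans hρ.2.le⟩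
    have hrI : (r : ℝ) ∈ Icc 0 D.h := ⟨hr.1.le, hr.2⟩
    rw [(hW.integral_fiber hg hgM hU hA hrI hi ⟨hR.fiberLeft_le_fiberRight hrI, le_rfl⟩).2,
      hW.glued_fiberRight hg hgM hU hA hrI hi, hA.apply_zero hr hi]
  rw [e1, e2, e3]
  abel

/-- The glued state is the primitive of its velocity. Between the atoms this is the equation of the
process; the starting value on a fiber is the left limit of the state, which is the limit of the
primitive along the right ends of earlier fibers. -/
theorem IsGraphCompletion.glued_eq_integral {i : ℕ} (hi : i < D.N) {s : ℝ}
    (hs : s ∈ Icc (0 : ℝ) 1) : D.glued (W 0) ζ (i + 1) s =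
      ζ 0 (i + 1) 0 + ∫ σ in (0 : ℝ)..s, D.velocity W (D.glued (W 0) ζ) i σ := by
  have hR := hW.control.isTimeChange
  have h0 : (0 : ℝ) ∈ Icc 0 D.h := ⟨le_rfl, hh.le⟩
  have hint := hW.intervalIntegrable_velocity hf hg hfM hgM hh hx hhist hA hU hi
  set q := D.velocity W (D.glued (W 0) ζ) i with hq
  have hsub : ∀ s ∈ Icc (0 : ℝ) 1, ∀ t ∈ Icc (0 : ℝ) 1, IntervalIntegrable q volume s t :=
    fun s hs t ht => hint.mono_set (by
      rw [uIcc_of_le zero_le_one]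
      exact uIcc_subset_Icc hs ht)
  set I : ℝ → EuclideanSpace ℝ (Fin n) := fun s => ζ 0 (i + 1) 0 + ∫ σ in (0 : ℝ)..s, q σ with hI
  have hIadd : ∀ s ∈ Icc (0 : ℝ) 1, ∀ t ∈ Icc (0 : ℝ) 1, I t = I s + ∫ σ in s..t, q σ := by
    intro s hs t ht
    simp only [hI]
    rw [add_assoc, intervalIntegral.integral_add_adjacent_intervals (hsub 0 (by simp) s hs)
      (hsub s hs t ht)]
  have hIcont : ContinuousOn I (Icc 0 1) := by
    have hii : IntegrableOn q (uIcc 0 1) := by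
      rw [uIcc_of_le zero_le_one]
      exact (intervalIntegrable_iff_integrableOn_Icc_of_le zero_le_one).1 hint
    have := intervalIntegral.continuousOn_primitive_interval hii
    rw [uIcc_of_le zero_le_one] at this
    exact continuousOn_const.add this
  have hIb0 : I (fiberRight (W 0) 0) = ζ 0 (i + 1) 1 := by
    have := (hW.integral_velocity_fiber hg hgM hU hA h0 hi
      ⟨hR.fiberLeft_le_fiberRight h0, le_rfl⟩).2
    rw [hR.fiberLeft_zero, hW.glued_fiberRight hg hgM hU hA h0 hi] at this
    simp only [hI, hq, this, add_sub_cancel]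
  have hIb : ∀ ρ ∈ Ioo 0 D.h, x (ρ + i * D.h) = I (fiberRight (W 0) ρ) := fun ρ hρ => by
    rw [hIadd _ (hR.fiberRight_mem h0).1 _ (hR.fiberRight_mem ⟨hρ.1.le, hρ.2.le⟩).1, hIb0]
    exact hW.apply_add hf hg hfM hgM hh hx hhist hA hU hdyn hi hρ
  -- both sides are the limit of the state as time increases to `r + i h`
  have hIa : ∀ r ∈ Ioc 0 D.h, ζ r (i + 1) 0 = I (fiberLeft (W 0) r) := by
    intro r hr
    have hrI : r ∈ Icc 0 D.h := ⟨hr.1.le, hr.2⟩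
    rw [hA.apply_zero hr hi]
    refine leftLim_eq_of_tendsto ?_
    have h1 : Tendsto (fun ρ => I (fiberRight (W 0) ρ)) (𝓝[<] r) (𝓝 (I (fiberLeft (W 0) r))) := by
      refine (hIcont _ (hR.fiberLeft_mem hrI).1).tendsto.comp (tendsto_nhdsWithin_iff.2
        ⟨hR.tendsto_fiberRight hr, ?_⟩)
      filter_upwards [Ioo_mem_nhdsLT hr.1] with ρ hρ
      exact (hR.fiberRight_mem ⟨hρ.1.le, hρ.2.le.trans hr.2⟩).1
    have h2 : Tendsto (fun t => t - i * D.h) (𝓝[<] (r + i * D.h)) (𝓝[<] r) := by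
      refine tendsto_nhdsWithin_iff.2 ⟨?_, ?_⟩
      · refine tendsto_nhdsWithin_of_tendsto_nhds ?_
        have : Continuous fun t : ℝ => t - i * D.h := by fun_prop
        have := this.tendsto (r + i * D.h)
        simpa using this
      · filter_upwards [self_mem_nhdsWithin] with t ht
        have ht' : t < r + i * D.h := ht
        change t - i * D.h < r
        linarith
    refine (h1.comp h2).congr' ?_
    have hlt : i * D.h < r + i * D.h := by linarith [hr.1]
    filter_upwards [Ioo_mem_nhdsLT hlt] with t ht
    have := hIb (t - i * D.h) ⟨by linarith [ht.1], by linarith [ht.2, hr.2]⟩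
    rw [sub_add_cancel] at this
    exact this.symm
  have hIa' : ∀ r ∈ Icc 0 D.h, ζ r (i + 1) 0 = I (fiberLeft (W 0) r) := fun r hr => by
    rcases hr.1.eq_or_lt with rfl | hpos
    · simp only [hI, hR.fiberLeft_zero, intervalIntegral.integral_same, add_zero]
    · exact hIa r ⟨hpos, hr.2⟩
  have hrI := hR.mapsTo hs
  have hfs := (hW.integral_velocity_fiber hg hgM hU hA hrI hi
    ⟨hR.fiberLeft_le hs, hR.le_fiberRight hs⟩).2
  change _ = I s
  rw [hIadd _ (hR.fiberLeft_mem hrI).1 s hs, hfs, ← hIa' _ hrI, add_sub_cancel]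

end

/-- Extended processes are trajectories of the graph completion. -/
theorem extendedReachableSet_subset (hf : Continuous (Function.uncurry D.f))
    (hg : Continuous (Function.uncurry D.g)) (hfM : ∀ a b, ‖D.f a b‖ ≤ M)
    (hgM : ∀ a b, ‖D.g a b‖ ≤ M) (hh : 0 < D.h) (hN : 0 < D.N) :
    D.extendedReachableSet K ⊆ D.completedReachableSet K := by
  rintro y ⟨x, μ, w, hP, hK, rfl⟩
  have hU := hP.control
  have hhist := hP.history
  obtain ⟨ζ, hA, -, hdyn0, hend⟩ := hP.dynamics
  obtain ⟨W, hW⟩ := hU.exists_isGraphCompletion hh hK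
  have hR := hW.control.isTimeChange
  have hdyn : ∀ i < D.N, ∀ ρ ∈ Ioo 0 D.h, x (ρ + i * D.h) = ζ 0 (i + 1) 1
      + (∫ t' in (i * D.h : ℝ)..(ρ + i * D.h), D.f (x t') (x (t' - D.h)))
      + (∫ t' in Icc (i * D.h : ℝ) (ρ + i * D.h), D.g (x t') (x (t' - D.h))
        ∂(continuousPart μ))
      + ∑' r : Ioc (0 : ℝ) ρ, (ζ r (i + 1) 1 - Function.leftLim x ((r : ℝ) + i * D.h)) := by
    intro i hi ρ hρ
    have e : (((i + 1 : ℕ) : ℝ) - 1) * D.h = i * D.h := by push_cast; ring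
    have e' : ((i + 1 : ℕ) : ℝ) * D.h = i * D.h + D.h := by push_cast; ring
    have := hdyn0 (i + 1) (by simp; omega) (ρ + i * D.h)
    rw [e, e', add_sub_cancel_right] at this
    exact this ⟨by linarith [hρ.1], by linarith [hρ.2]⟩
  -- completed trajectories are continuous on all of `ℝ`
  set clamp : ℝ → ℝ := fun s => max 0 (min s 1) with hclamp
  have hclamp_mem : ∀ s, clamp s ∈ Icc (0 : ℝ) 1 := fun s =>
    ⟨le_max_left _ _, max_le zero_le_one (min_le_right _ _)⟩
  have hclamp_eq : ∀ s ∈ Icc (0 : ℝ) 1, clamp s = s := fun s hs => by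
    simp only [hclamp]; rw [min_eq_left hs.2, max_eq_right hs.1]
  have hclamp_cont : Continuous clamp := by fun_prop
  set z : ℕ → ℝ → EuclideanSpace ℝ (Fin n) := fun i s =>
    if i ≤ D.N then D.glued (W 0) ζ i (clamp s) else 0 with hz
  have hzeq : ∀ i ≤ D.N, ∀ s ∈ Icc (0 : ℝ) 1, z i s = D.glued (W 0) ζ i s := fun i hi s hs => by
    simp only [hz, if_pos hi, hclamp_eq s hs]
  have hIeq := fun i (hi : i < D.N) s (hs : s ∈ Icc (0 : ℝ) 1) =>
    hW.glued_eq_integral hf hg hfM hgM hh hP.bv hhist hA hU hdyn hi hs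
  have hh1 : D.h ∈ Icc 0 D.h := ⟨hh.le, le_rfl⟩
  have hz1 : ∀ i < D.N, z (i + 1) 1 = ζ D.h (i + 1) 1 := fun i hi => by
    have := hW.glued_fiberRight hg hgM hU hA hh1 hi
    rw [hR.fiberRight_one] at this
    rw [hzeq (i + 1) hi 1 (by simp), this]
  refine ⟨W, z, hW.control, ⟨fun s => ?_, fun i => ?_, fun i hi s hs => ?_⟩, ?_⟩
  · simp only [hz, Nat.zero_le, if_true, glued_zero]
  · by_cases hi : i ≤ D.N
    swap
    · simp only [hz, hi, if_false]; exact continuous_const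
    simp only [hz, hi, if_true]
    rcases i with _ | i
    · simp only [glued_zero]; exact continuous_const
    · have hint := hW.intervalIntegrable_velocity hf hg hfM hgM hh hP.bv hhist hA hU hi
      have hii : IntegrableOn (D.velocity W (D.glued (W 0) ζ) i) (uIcc 0 1) := by
        rw [uIcc_of_le zero_le_one]
        exact (intervalIntegrable_iff_integrableOn_Icc_of_le zero_le_one).1 hint
      have hprim := intervalIntegral.continuousOn_primitive_interval hii
      rw [uIcc_of_le zero_le_one] at hprim
      have := (continuous_const (y := ζ 0 (i + 1) 0)).add
        (hprim.comp_continuous hclamp_cont hclamp_mem)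
      exact this.congr fun s => (hIeq i hi _ (hclamp_mem s)).symm
  · rw [hzeq (i + 1) hi s hs, hIeq i hi s hs]
    congr 1
    · have := hA.init_zero (i + 1) (by simp; omega)
      rw [Nat.add_sub_cancel] at this
      rw [this, start]
      rcases i with _ | i
      · rw [if_pos rfl]; exact hA.zero_end
      · rw [if_neg (Nat.succ_ne_zero i), hz1 i (by omega)]
    · refine intervalIntegral.integral_congr fun σ hσ => ?_
      rw [uIcc_of_le hs.1] at hσ
      have hσI : σ ∈ Icc (0 : ℝ) 1 := ⟨hσ.1, hσ.2.trans hs.2⟩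
      simp only [velocity, hzeq (i + 1) hi σ hσI, hzeq i hi.le σ hσI]
  · obtain ⟨N', hN'⟩ : ∃ N', D.N = N' + 1 := ⟨D.N - 1, by omega⟩
    have := hz1 N' (by omega)
    rw [hN', this, hend, hN']

/-- The total variation of the measure of a strict sense process is the integral of its control. -/
theorem strictReachableSet_subset (hh : 0 ≤ D.h) :
    D.strictReachableSet K ⊆ D.extendedReachableSet K := by
  rintro y ⟨x, u, ⟨hu0, hu, w, hP⟩, hK, rfl⟩
  refine ⟨x, _, w, hP, le_of_eq_of_le ?_ hK, rfl⟩
  have hT : 0 ≤ D.T := mul_nonneg (Nat.cast_nonneg _) hh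
  rw [densityMeasure, Measure.real, withDensity_apply _ MeasurableSet.univ, Measure.restrict_univ,
    intervalIntegral.integral_of_le hT, ← integral_Icc_eq_integral_Ioc,
    integral_eq_lintegral_of_nonneg_ae _ hu.aestronglyMeasurable]
  filter_upwards [ae_restrict_mem measurableSet_Icc] with t ht
  exact hu0 t ht

end DelaySystem
end

/-! ### Compactness and density -/

theorem proposition4p2 (n : ℕ) (D : DelaySystem n)
    (hf : ContDiff ℝ 1 (Function.uncurry D.f)) (hg : ContDiff ℝ 1 (Function.uncurry D.g))
    (hf_bdd : ∃ M : ℝ, ∀ a b, ‖D.f a b‖ ≤ M) (hg_bdd : ∃ M : ℝ, ∀ a b, ‖D.g a b‖ ≤ M)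
    (hh : 0 < D.h) (hN : 0 < D.N) (K : ℝ) (hK : 0 < K) :
    (D.extendedReachableSet K).Nonempty ∧ IsCompact (D.extendedReachableSet K) ∧
      D.extendedReachableSet K = closure (D.strictReachableSet K) := by
  obtain ⟨M₁, hM₁⟩ := hf_bdd
  obtain ⟨M₂, hM₂⟩ := hg_bdd
  have hfM : ∀ a b, ‖D.f a b‖ ≤ max M₁ M₂ := fun a b => (hM₁ a b).trans (le_max_left _ _)
  have hgM : ∀ a b, ‖D.g a b‖ ≤ max M₁ M₂ := fun a b => (hM₂ a b).trans (le_max_right _ _)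
  have hS : 0 < D.h + K := add_pos hh hK
  have heq : D.extendedReachableSet K = D.completedReachableSet K := by
    refine (DelaySystem.extendedReachableSet_subset hf.continuous hg.continuous hfM hgM hh
      hN).antisymm ?_
    rintro _ ⟨W, z, hW, hz, rfl⟩
    exact DelaySystem.completedTraj_end_mem_extended hf.continuous hg.continuous hfM hgM hW hz hh hN
  have hcompact : IsCompact (D.extendedReachableSet K) :=
    heq ▸ DelaySystem.isCompact_completedReachableSet hf hg hfM hgM hS
  refine ⟨heq ▸ DelaySystem.completedReachableSet_nonempty hf hg hfM hgM hS hh.le hK.le,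
    hcompact, Subset.antisymm (fun y hy => ?_)
      (closure_minimal (DelaySystem.strictReachableSet_subset hh.le) hcompact.isClosed)⟩
  rw [heq] at hy
  refine Metric.mem_closure_iff.2 fun ε hε => ?_
  obtain ⟨W, z, hW, hz, ⟨c, hc, hspeed⟩, hnear⟩ :=
    DelaySystem.exists_strictMono_near hf hg hfM hgM hS hh hK.le hy (half_pos hε)
  refine ⟨z D.N 1, DelaySystem.completedTraj_end_mem_strict hf.continuous hg.continuous hfM hgM
    hW hz hh hN hc hspeed, ?_⟩
  rw [dist_comm, dist_eq_norm]
  linarith
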